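/- Let $n\ge 3$. A signed permutation of $\{\pm1,\dots,\pm n\}$ is a bijection $w$ with $w(-i)=-w(i)$; write $(\!(i\;j)\!)=(i\;j)(-i\;-j)$, $[i]=(i\;-i)$ and $[i_1\dots i_k]=(i_1\dots i_k\;-i_1\dots -i_k)$. Let $W(D_n)$ be the group generated by the reflections $(\!(i\;j)\!)$ with $1\le i<|j|\le n$, let $\ell(w)$ be the least number of reflections whose product is $w$, and let $v\le w$ if $\ell(w)=\ell(v)+\ell(v^{-1}w)$ (the absolute order). Let $c=s_1s_2\cdots s_n=[1\dots n-1][n]$, where $s_i=(\!(i\;i+1)\!)$ for $1\le i<n$ and $s_n=(\!(-(n-1)\;n)\!)$, and let $NC(D_n)=\{w\in W(D_n): w\le c\}$ with the absolute order. Let $\mathrm{Aut}(NC(D_n))$ be the group of its (poset, equivalently lattice) automorphisms. Then there are $l,r\in W(D_n)$ with $c=lr$ and $l^2=r^2=1$. For every such pair let $\varphi_l(w)=lw^{-1}l$, $\varphi_r(w)=rw^{-1}r$ and $\varphi_n(w)=[n]w[n]$; these are automorphisms of $NC(D_n)$. Let $D^*\le \mathrm{Aut}(NC(D_n))$ be the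 subgroup generated by $\varphi_l$ and $\varphi_r\circ\varphi_n$. Then: 1. $D^*$ is a dihedral group of order $4(n-1)$. 2. If $n\ne 4$, then $\mathrm{Aut}(NC(D_n))=D^*$. 3. If $n=4$, then $D^*$ (of order $12$) is a proper subgroup of $\mathrm{Aut}(NC(D_4))$. More precisely, there is an automorphism $\zeta\notin D^*$ of order $2$ that exchanges the two reflections in each of the pairs $$(\!(1\;2)\!)\leftrightarrow(\!(1\;4)\!),\quad (\!(2\;3)\!)\leftrightarrow(\!(3\;4)\!),\quad (\!(1\;-3)\!)\leftrightarrow(\!(-2\;4)\!),\quad (\!(-1\;4)\!)\leftrightarrow(\!(-3\;4)\!),\quad (\!(2\;-3)\!)\leftrightarrow(\!(1\;-2)\!)$$ and fixes $(\!(2\;4)\!)$ and $(\!(1\;3)\!)$. -/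

import Mathlib

noncomputable section

namespace NCD

/-! ### Word length with respect to a set of generators -/

section Length

variable {G : Type*} [Group G]

/-- The length of `w` with respect to `T`: the least number of letters of a word in the letters
`T` whose product is `w`. It is used only for `w` in the subgroup generated by a set `T` that is
closed under inverses, where such words exist. -/
def wordLength (T : Set G) (w : G) : ℕ :=
  sInf {k | ∃ L : List G, (∀ t ∈ L, t ∈ T) ∧ L.prod = w ∧ L.length = k}

theorem wordLength_le {T : Set G} (L : List G) (hL : ∀ t ∈ L, t ∈ T) :
    wordLength T L.prod ≤ L.length :=
  Nat.sInf_le ⟨L, hL, rfl, rfl⟩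

theorem exists_word {T : Set G} (hT : ∀ t ∈ T, t⁻¹ ∈ T) {w : G}
    (hw : w ∈ Subgroup.closure T) :
    ∃ L : List G, (∀ t ∈ L, t ∈ T) ∧ L.prod = w ∧ L.length = wordLength T w := by
  have hne : {k | ∃ L : List G, (∀ t ∈ L, t ∈ T) ∧ L.prod = w ∧ L.length = k}.Nonempty := by
    rw [← Subgroup.mem_toSubmonoid, Subgroup.closure_toSubmonoid] at hw
    obtain ⟨L, hL, hp⟩ := Submonoid.exists_list_of_mem_closure hw
    refine ⟨L.length, L, fun t ht => ?_, hp, rfl⟩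
    rcases hL t ht with h | h
    · exact h
    · simpa using hT _ h
  exact Nat.sInf_mem hne

theorem wordLength_one (T : Set G) : wordLength T 1 = 0 :=
  Nat.le_zero.mp (wordLength_le (T := T) [] (by simp))

theorem eq_one_of_wordLength {T : Set G} (hT : ∀ t ∈ T, t⁻¹ ∈ T) {w : G}
    (hw : w ∈ Subgroup.closure T) (h : wordLength T w = 0) : w = 1 := by
  obtain ⟨L, -, hp, hl⟩ := exists_word hT hw
  rw [h, List.length_eq_zero_iff] at hl
  rw [← hp, hl, List.prod_nil]

theorem wordLength_mul_le {T : Set G} (hT : ∀ t ∈ T, t⁻¹ ∈ T) {v w : G}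
    (hv : v ∈ Subgroup.closure T) (hw : w ∈ Subgroup.closure T) :
    wordLength T (v * w) ≤ wordLength T v + wordLength T w := by
  obtain ⟨L, hL, hp, hl⟩ := exists_word hT hv
  obtain ⟨M, hM, hq, hm⟩ := exists_word hT hw
  have h := wordLength_le (T := T) (L ++ M) (by
    intro t ht
    rcases List.mem_append.mp ht with h | h
    · exact hL t h
    · exact hM t h)
  rw [List.prod_append, List.length_append, hp, hq, hl, hm] at h
  exact h

theorem wordLength_inv_le {T : Set G} (hT : ∀ t ∈ T, t⁻¹ ∈ T) {w : G}
    (hw : w ∈ Subgroup.closure T) : wordLength T w⁻¹ ≤ wordLength T w := by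
  obtain ⟨L, hL, hp, hl⟩ := exists_word hT hw
  have h := wordLength_le (T := T) (L.map (fun x => x⁻¹)).reverse (by
    intro t ht
    simp only [List.mem_reverse, List.mem_map] at ht
    obtain ⟨s, hs, rfl⟩ := ht
    exact hT s (hL s hs))
  rw [← List.prod_inv_reverse, hp] at h
  simpa [hl] using h

theorem wordLength_inv {T : Set G} (hT : ∀ t ∈ T, t⁻¹ ∈ T) {w : G}
    (hw : w ∈ Subgroup.closure T) : wordLength T w⁻¹ = wordLength T w := by
  refine le_antisymm (wordLength_inv_le hT hw) ?_
  simpa using wordLength_inv_le hT (inv_mem hw)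

theorem conj_mem_closure {T : Set G} {g : G} (hg : ∀ t ∈ T, g * t * g⁻¹ ∈ T) {w : G}
    (hw : w ∈ Subgroup.closure T) : g * w * g⁻¹ ∈ Subgroup.closure T := by
  have h : Subgroup.closure T ≤ (Subgroup.closure T).comap (MulAut.conj g).toMonoidHom := by
    rw [Subgroup.closure_le]
    intro t ht
    exact Subgroup.subset_closure (hg t ht)
  exact h hw

theorem wordLength_conj_le {T : Set G} (hT : ∀ t ∈ T, t⁻¹ ∈ T) {g : G}
    (hg : ∀ t ∈ T, g * t * g⁻¹ ∈ T) {w : G} (hw : w ∈ Subgroup.closure T) :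
    wordLength T (g * w * g⁻¹) ≤ wordLength T w := by
  obtain ⟨L, hL, hp, hl⟩ := exists_word hT hw
  have h := wordLength_le (T := T) (L.map (MulAut.conj g)) (by
    intro t ht
    simp only [List.mem_map] at ht
    obtain ⟨s, hs, rfl⟩ := ht
    exact hg s (hL s hs))
  rw [← map_list_prod, hp, List.length_map, hl] at h
  exact h

/-- Conjugation by an involution that normalizes `T` preserves the length. -/
theorem wordLength_conj {T : Set G} (hT : ∀ t ∈ T, t⁻¹ ∈ T) {g : G} (h2 : g * g = 1)
    (hg : ∀ t ∈ T, g * t * g⁻¹ ∈ T) {w : G} (hw : w ∈ Subgroup.closure T) :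
    wordLength T (g * w * g⁻¹) = wordLength T w := by
  refine le_antisymm (wordLength_conj_le hT hg hw) ?_
  have h := wordLength_conj_le hT hg (conj_mem_closure hg hw)
  have hi : g⁻¹ = g := inv_eq_of_mul_eq_one_left h2
  have e : g * (g * w * g⁻¹) * g⁻¹ = w := by
    rw [hi, show g * (g * w * g) * g = (g * g) * w * (g * g) by group, h2]
    simp
  rwa [e] at h

end Length

/-! ### The Coxeter group of type `D` -/

/-- The paired cycle `((i j)) = (i j)(-i -j)`. -/
def paired (i j : ℤ) : Equiv.Perm ℤ := Equiv.swap i j * Equiv.swap (-i) (-j)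

/-- The balanced cycle `[i] = (i -i)`. -/
def balanced (i : ℤ) : Equiv.Perm ℤ := Equiv.swap i (-i)

/-- The reflections `((i j))`, `1 ≤ i < |j| ≤ n`, of the Coxeter group of type `D_n`. -/
def refl (n : ℕ) : Set (Equiv.Perm ℤ) :=
  {t | ∃ i j : ℤ, 1 ≤ i ∧ i < |j| ∧ |j| ≤ n ∧ t = paired i j}

/-- The Coxeter group `W(D_n)`, generated by its reflections. A signed permutation of
`{±1, …, ±n}` is regarded as a permutation of `ℤ` that fixes `0` and all `i` with `|i| > n`. -/
def W (n : ℕ) : Subgroup (Equiv.Perm ℤ) := Subgroup.closure (refl n)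

/-- The absolute length on `W(D_n)`. -/
def absLength (n : ℕ) (w : Equiv.Perm ℤ) : ℕ := wordLength (refl n) w

/-- The relation of the absolute order on `W(D_n)`. -/
def AbsLE (n : ℕ) (v w : Equiv.Perm ℤ) : Prop :=
  absLength n w = absLength n v + absLength n (v⁻¹ * w)

/-- The standard Coxeter element `c = s₁ s₂ ⋯ sₙ = [1 … n-1][n]`, where `sᵢ = ((i i+1))` for
`1 ≤ i < n` and `sₙ = ((-(n-1) n))`. -/
def cox (n : ℕ) : Equiv.Perm ℤ :=
  ((List.range (n - 1)).map fun k : ℕ => paired ((k : ℤ) + 1) ((k : ℤ) + 2)).prod *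
    paired (-((n : ℤ) - 1)) n

/-- The non-crossing partitions `NC(D_n)`: the elements of `W(D_n)` below `c`. -/
def NC (n : ℕ) : Type := {w : Equiv.Perm ℤ // w ∈ W n ∧ AbsLE n w (cox n)}

theorem paired_apply_neg {i j : ℤ} (hi : i ≠ 0) (hj : j ≠ 0) (x : ℤ) : paired i j (-x) = -paired i j x := by
  simp only [paired, Equiv.Perm.mul_apply, Equiv.swap_apply_def]
  split_ifs <;> omega

theorem paired_inv {i j : ℤ} (h1 : i ≠ 0) (h2 : j ≠ 0) (h3 : i ≠ j) (h4 : i ≠ -j) :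
    (paired i j)⁻¹ = paired i j := by
  apply inv_eq_of_mul_eq_one_left
  ext x
  simp only [paired, Equiv.Perm.mul_apply, Equiv.swap_apply_def, Equiv.Perm.one_apply]
  split_ifs <;> omega

theorem refl_inv {n : ℕ} : ∀ t ∈ refl n, t⁻¹ ∈ refl n := by
  rintro t ⟨i, j, h1, h2, h3, rfl⟩
  have : i ≠ j ∧ i ≠ -j ∧ j ≠ 0 := by
    rcases abs_cases j with h | h <;> omega
  rw [paired_inv (by omega) this.2.2 this.1 this.2.1]
  exact ⟨i, j, h1, h2, h3, rfl⟩

theorem paired_neg (i j : ℤ) (h1 : i ≠ 0) (h2 : j ≠ 0) (h3 : i ≠ j) (h4 : i ≠ -j) :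
    paired (-i) (-j) = paired i j := by
  ext x
  simp only [paired, Equiv.Perm.mul_apply, Equiv.swap_apply_def]
  split_ifs <;> omega

theorem paired_comm (i j : ℤ) : paired i j = paired j i := by
  simp only [paired, Equiv.swap_comm]

/-- Up to equivalence of cycles, every `((i j))` with `i ≠ ±j` is a reflection. -/
theorem paired_mem_refl {n : ℕ} {i j : ℤ} (hi : i ≠ 0) (hj : j ≠ 0) (hi' : |i| ≤ n)
    (hj' : |j| ≤ n) (h3 : i ≠ j) (h4 : i ≠ -j) : paired i j ∈ refl n := by
  have key : ∀ i j : ℤ, i ≠ 0 → j ≠ 0 → |i| ≤ n → |j| ≤ n → i ≠ j → i ≠ -j → |i| < |j| →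
      paired i j ∈ refl n := by
    intro i j hi hj hi' hj' h3 h4 h
    rcases lt_or_gt_of_ne hi with hn | hp
    · refine ⟨-i, -j, by omega, ?_, ?_, (paired_neg i j hi hj h3 h4).symm⟩
      · rw [abs_neg]; rwa [abs_of_neg hn] at h
      · rwa [abs_neg]
    · exact ⟨i, j, by omega, by rwa [abs_of_pos hp] at h, hj', rfl⟩
  rcases lt_trichotomy |i| |j| with h | h | h
  · exact key i j hi hj hi' hj' h3 h4 h
  · rcases abs_eq_abs.mp h with h | h
    · exact absurd h h3
    · exact absurd h h4
  · rw [paired_comm]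
    exact key j i hj hi hj' hi' (Ne.symm h3) (by omega) h

theorem conj_paired (g : Equiv.Perm ℤ) (hg : ∀ x, g (-x) = -g x) (i j : ℤ) :
    g * paired i j * g⁻¹ = paired (g i) (g j) := by
  have h : ∀ a b : ℤ, g * Equiv.swap a b * g⁻¹ = Equiv.swap (g a) (g b) := fun a b => by
    rw [Equiv.mul_swap_eq_swap_mul, mul_inv_cancel_right]
  calc g * paired i j * g⁻¹
      = (g * Equiv.swap i j * g⁻¹) * (g * Equiv.swap (-i) (-j) * g⁻¹) := by
        simp only [paired]; group
    _ = paired (g i) (g j) := by rw [h, h, hg, hg]; rfl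

theorem paired_commute {a b : ℤ} (ha : 0 < a) (hb : 0 < b) (hab : a ≠ b) :
    paired (-a) b * paired a b = paired a b * paired (-a) b := by
  have g1 : paired a b a = b := by
    rw [paired, Equiv.Perm.mul_apply,
      Equiv.swap_apply_of_ne_of_ne (a := -a) (by omega) (by omega), Equiv.swap_apply_left]
  have g2 : paired a b b = a := by
    rw [paired, Equiv.Perm.mul_apply,
      Equiv.swap_apply_of_ne_of_ne (a := -a) (by omega) (by omega), Equiv.swap_apply_right]
  have hg := paired_apply_neg (i := a) (j := b) (by omega) (by omega)
  have h := conj_paired (paired a b) hg (-a) b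
  rw [hg, g1, g2, ← paired_neg (-b) a (by omega) (by omega) (by omega) (by omega), neg_neg,
    paired_comm b (-a)] at h
  exact (mul_inv_eq_iff_eq_mul.mp h).symm

/-- `g` is a signed permutation of `{±1, …, ±n}`. -/
def IsSigned (n : ℕ) (g : Equiv.Perm ℤ) : Prop :=
  (∀ x, g (-x) = -g x) ∧ ∀ x, (n : ℤ) < |x| → g x = x

theorem conj_refl {n : ℕ} {g : Equiv.Perm ℤ} (hg : IsSigned n g) :
    ∀ t ∈ refl n, g * t * g⁻¹ ∈ refl n := by
  rintro t ⟨i, j, h1, h2, h3, rfl⟩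
  have h0 : g 0 = 0 := by have := hg.1 0; simp only [neg_zero] at this; omega
  have hle : ∀ x : ℤ, |x| ≤ n → |g x| ≤ n := by
    intro x hx
    by_contra h
    have h' := hg.2 (g x) (by omega)
    rw [g.injective h'] at h
    exact h hx
  have hj : i ≠ j ∧ i ≠ -j ∧ j ≠ 0 ∧ |i| ≤ n := by
    rcases abs_cases j with h | h <;> rcases abs_cases i with h' | h' <;> omega
  rw [conj_paired g hg.1]
  refine paired_mem_refl ?_ ?_ (hle i hj.2.2.2) (hle j h3) ?_ ?_
  · rw [← h0]; exact g.injective.ne (by omega)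
  · rw [← h0]; exact g.injective.ne hj.2.2.1
  · exact g.injective.ne hj.1
  · rw [← hg.1]; exact g.injective.ne hj.2.1

theorem isSigned_of_mem {n : ℕ} {g : Equiv.Perm ℤ} (hg : g ∈ W n) : IsSigned n g := by
  induction hg using Subgroup.closure_induction with
  | mem t ht =>
    obtain ⟨i, j, h1, h2, h3, rfl⟩ := ht
    have hj : j ≠ 0 := by rcases abs_cases j with h | h <;> omega
    refine ⟨paired_apply_neg (by omega) hj, fun x hx => ?_⟩
    have : x ≠ i ∧ x ≠ -i ∧ x ≠ j ∧ x ≠ -j := by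
      rcases abs_cases j with h | h <;> rcases abs_cases x with h' | h' <;> omega
    simp only [paired, Equiv.Perm.mul_apply]
    rw [Equiv.swap_apply_of_ne_of_ne this.2.1 this.2.2.2,
      Equiv.swap_apply_of_ne_of_ne this.1 this.2.2.1]
  | one => exact ⟨fun x => rfl, fun x _ => rfl⟩
  | mul a b _ _ ha hb =>
    refine ⟨fun x => ?_, fun x hx => ?_⟩
    · simp only [Equiv.Perm.mul_apply, hb.1, ha.1]
    · simp only [Equiv.Perm.mul_apply, hb.2 x hx, ha.2 x hx]
  | inv a _ ha =>
    refine ⟨fun x => ?_, fun x hx => ?_⟩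
    · rw [Equiv.Perm.inv_eq_iff_eq, ha.1, ← Equiv.Perm.mul_apply, mul_inv_cancel,
        Equiv.Perm.one_apply]
    · rw [Equiv.Perm.inv_eq_iff_eq, ha.2 x hx]

/-- `NC(D_n)` is partially ordered by the absolute order. -/
instance (n : ℕ) : PartialOrder (NC n) where
  le v w := AbsLE n v.1 w.1
  le_refl v := by simp [AbsLE, absLength, wordLength_one]
  le_trans u v w huv hvw := by
    have h1 := wordLength_mul_le refl_inv (mul_mem (inv_mem u.2.1) v.2.1)
      (mul_mem (inv_mem v.2.1) w.2.1)
    have h2 := wordLength_mul_le refl_inv u.2.1 (mul_mem (inv_mem u.2.1) w.2.1)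
    rw [mul_inv_cancel_left] at h2
    rw [show (u.1⁻¹ * v.1) * (v.1⁻¹ * w.1) = u.1⁻¹ * w.1 by group] at h1
    simp only [AbsLE, absLength] at huv hvw ⊢
    omega
  le_antisymm v w h1 h2 := by
    simp only [AbsLE, absLength] at h1 h2
    have h : wordLength (refl n) (v.1⁻¹ * w.1) = 0 := by omega
    have := eq_one_of_wordLength refl_inv (mul_mem (inv_mem v.2.1) w.2.1) h
    exact Subtype.ext (inv_mul_eq_one.mp this)

/-! ### The automorphisms -/

theorem absLE_conj {n : ℕ} {g v w : Equiv.Perm ℤ} (hg : IsSigned n g) (h2 : g * g = 1)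
    (hv : v ∈ W n) (hw : w ∈ W n) (h : AbsLE n v w) :
    AbsLE n (g * v * g⁻¹) (g * w * g⁻¹) := by
  simp only [AbsLE, absLength] at h ⊢
  rw [show (g * v * g⁻¹)⁻¹ * (g * w * g⁻¹) = g * (v⁻¹ * w) * g⁻¹ by group,
    wordLength_conj refl_inv h2 (conj_refl hg) hv,
    wordLength_conj refl_inv h2 (conj_refl hg) hw,
    wordLength_conj refl_inv h2 (conj_refl hg) (mul_mem (inv_mem hv) hw), h]

theorem absLE_inv {n : ℕ} {v w : Equiv.Perm ℤ} (hv : v ∈ W n) (hw : w ∈ W n)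
    (h : AbsLE n v w) : AbsLE n v⁻¹ w⁻¹ := by
  simp only [AbsLE, absLength] at h ⊢
  have hvw : v⁻¹ * w ∈ Subgroup.closure (refl n) := mul_mem (inv_mem hv) hw
  have h1 : wordLength (refl n) (v⁻¹⁻¹ * w⁻¹) ≤ wordLength (refl n) (v⁻¹ * w) := by
    rw [← wordLength_inv refl_inv hvw,
      show v⁻¹⁻¹ * w⁻¹ = v * (v⁻¹ * w)⁻¹ * v⁻¹ by group]
    exact wordLength_conj_le refl_inv (conj_refl (isSigned_of_mem hv)) (inv_mem hvw)
  have h2 := wordLength_mul_le refl_inv (inv_mem hv)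
    (mul_mem (inv_mem (inv_mem hv)) (inv_mem hw))
  rw [mul_inv_cancel_left] at h2
  rw [wordLength_inv refl_inv hv, wordLength_inv refl_inv hw] at *
  omega

theorem cox_mem {n : ℕ} (hn : 2 ≤ n) : cox n ∈ W n := by
  refine mul_mem (list_prod_mem fun t ht => ?_) (Subgroup.subset_closure ?_)
  · simp only [List.mem_map, List.mem_range] at ht
    obtain ⟨k, hk, rfl⟩ := ht
    refine Subgroup.subset_closure ⟨_, _, ?_, ?_, ?_, rfl⟩
    · omega
    · rw [abs_of_pos (by omega)]; omega
    · rw [abs_of_pos (by omega)]; omega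
  · refine paired_mem_refl (by omega) (by omega) ?_ ?_ (by omega) (by omega)
    · rw [abs_neg, abs_of_pos (by omega)]; omega
    · rw [abs_of_pos (by omega)]

/-- The bipartitions `c = l r`, `l² = r² = 1`, of the Coxeter element. -/
structure IsBipartition (n : ℕ) (l r : Equiv.Perm ℤ) : Prop where
  left_mem : l ∈ W n
  right_mem : r ∈ W n
  left_sq : l * l = 1
  right_sq : r * r = 1
  mul_eq : l * r = cox n

theorem IsBipartition.cox_mem {n : ℕ} {l r : Equiv.Perm ℤ} (h : IsBipartition n l r) :
    cox n ∈ W n := h.mul_eq ▸ mul_mem h.left_mem h.right_mem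

theorem IsBipartition.conj_left {n : ℕ} {l r : Equiv.Perm ℤ} (h : IsBipartition n l r) :
    l * (cox n)⁻¹ * l⁻¹ = cox n := by
  have hr : r⁻¹ = r := inv_eq_of_mul_eq_one_left h.right_sq
  have hl : l⁻¹ = l := inv_eq_of_mul_eq_one_left h.left_sq
  rw [← h.mul_eq, mul_inv_rev, hr, hl, mul_assoc, mul_assoc r l l, h.left_sq, mul_one]

theorem IsBipartition.conj_right {n : ℕ} {l r : Equiv.Perm ℤ} (h : IsBipartition n l r) :
    r * (cox n)⁻¹ * r⁻¹ = cox n := by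
  have hr : r⁻¹ = r := inv_eq_of_mul_eq_one_left h.right_sq
  have hl : l⁻¹ = l := inv_eq_of_mul_eq_one_left h.left_sq
  rw [← h.mul_eq, mul_inv_rev, hr, hl, ← mul_assoc r r l, h.right_sq, one_mul]

theorem conj_inv_mem {n : ℕ} {g : Equiv.Perm ℤ} (hg : g ∈ W n) (h2 : g * g = 1)
    (hc : cox n ∈ W n) (hgc : g * (cox n)⁻¹ * g⁻¹ = cox n) (w : NC n) :
    g * w.1⁻¹ * g⁻¹ ∈ W n ∧ AbsLE n (g * w.1⁻¹ * g⁻¹) (cox n) := by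
  refine ⟨mul_mem (mul_mem hg (inv_mem w.2.1)) (inv_mem hg), ?_⟩
  have h := absLE_conj (isSigned_of_mem hg) h2 (inv_mem w.2.1) (inv_mem hc)
    (absLE_inv w.2.1 hc w.2.2)
  rwa [hgc] at h

/-- The automorphism `w ↦ g w⁻¹ g = g w⁻¹ g⁻¹` of `NC(D_n)`, for an involution `g` that inverts
the Coxeter element. -/
def conjInv {n : ℕ} {g : Equiv.Perm ℤ} (hg : g ∈ W n) (h2 : g * g = 1)
    (hc : cox n ∈ W n) (hgc : g * (cox n)⁻¹ * g⁻¹ = cox n) : NC n ≃o NC n :=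
  have inv : ∀ w : Equiv.Perm ℤ, g * (g * w⁻¹ * g⁻¹)⁻¹ * g⁻¹ = w := fun w => by
    have hi : g⁻¹ = g := inv_eq_of_mul_eq_one_left h2
    rw [show g * (g * w⁻¹ * g⁻¹)⁻¹ * g⁻¹ = (g * g) * w * (g * g)⁻¹ by group, h2]
    simp
  have mono : ∀ v w : NC n, v ≤ w →
      AbsLE n (g * v.1⁻¹ * g⁻¹) (g * w.1⁻¹ * g⁻¹) := fun v w h =>
    absLE_conj (isSigned_of_mem hg) h2 (inv_mem v.2.1) (inv_mem w.2.1)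
      (absLE_inv v.2.1 w.2.1 h)
  { toFun := fun w => ⟨g * w.1⁻¹ * g⁻¹, conj_inv_mem hg h2 hc hgc w⟩
    invFun := fun w => ⟨g * w.1⁻¹ * g⁻¹, conj_inv_mem hg h2 hc hgc w⟩
    left_inv := fun w => Subtype.ext (inv w.1)
    right_inv := fun w => Subtype.ext (inv w.1)
    map_rel_iff' := by
      intro v w
      refine ⟨fun h => ?_, fun h => mono v w h⟩
      have h' := mono ⟨_, conj_inv_mem hg h2 hc hgc v⟩ ⟨_, conj_inv_mem hg h2 hc hgc w⟩ h
      simp only [inv] at h'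
      exact h' }

/-- The automorphism `φ_l : w ↦ l w⁻¹ l` of `NC(D_n)`. -/
def phiL {n : ℕ} {l r : Equiv.Perm ℤ} (h : IsBipartition n l r) : NC n ≃o NC n :=
  conjInv h.left_mem h.left_sq h.cox_mem h.conj_left

/-- The automorphism `φ_r : w ↦ r w⁻¹ r` of `NC(D_n)`. -/
def phiR {n : ℕ} {l r : Equiv.Perm ℤ} (h : IsBipartition n l r) : NC n ≃o NC n :=
  conjInv h.right_mem h.right_sq h.cox_mem h.conj_right

theorem coe_phiL {n : ℕ} {l r : Equiv.Perm ℤ} (h : IsBipartition n l r) (w : NC n) :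
    (phiL h w).1 = l * w.1⁻¹ * l := by
  change l * w.1⁻¹ * l⁻¹ = _
  rw [inv_eq_of_mul_eq_one_left h.left_sq]

theorem coe_phiR {n : ℕ} {l r : Equiv.Perm ℤ} (h : IsBipartition n l r) (w : NC n) :
    (phiR h w).1 = r * w.1⁻¹ * r := by
  change r * w.1⁻¹ * r⁻¹ = _
  rw [inv_eq_of_mul_eq_one_left h.right_sq]

theorem balanced_sq (i : ℤ) : balanced i * balanced i = 1 := Equiv.swap_mul_self _ _

theorem balanced_inv (i : ℤ) : (balanced i)⁻¹ = balanced i :=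
  inv_eq_of_mul_eq_one_left (balanced_sq i)

theorem balanced_signed {n : ℕ} (hn : 2 ≤ n) : IsSigned n (balanced n) := by
  refine ⟨fun x => ?_, fun x hx => ?_⟩
  · simp only [balanced, Equiv.swap_apply_def]
    split_ifs <;> omega
  · have : x ≠ n ∧ x ≠ -n := by rcases abs_cases x with h | h <;> omega
    exact Equiv.swap_apply_of_ne_of_ne this.1 this.2

theorem balanced_conj_cox {n : ℕ} (hn : 2 ≤ n) :
    balanced n * cox n * (balanced n)⁻¹ = cox n := by
  obtain ⟨m, rfl⟩ : ∃ m, n = m + 2 := ⟨n - 2, by omega⟩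
  have hs := balanced_signed hn
  set b := balanced ((m + 2 : ℕ) : ℤ) with hb
  have b1 : b ((m + 2 : ℕ) : ℤ) = -((m + 2 : ℕ) : ℤ) := Equiv.swap_apply_left _ _
  have b2 : ∀ x : ℤ, |x| < m + 2 → b x = x := fun x hx => by
    refine Equiv.swap_apply_of_ne_of_ne ?_ ?_ <;>
      rcases abs_cases x with h | h <;> push_cast <;> omega
  set P := ((List.range m).map fun k : ℕ => paired ((k : ℤ) + 1) ((k : ℤ) + 2)).prod with hP
  have hPb : Commute b P := by
    refine Commute.list_prod_right _ _ fun t ht => ?_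
    simp only [List.mem_map, List.mem_range] at ht
    obtain ⟨k, hk, rfl⟩ := ht
    have h := conj_paired b hs.1 ((k : ℤ) + 1) ((k : ℤ) + 2)
    rw [b2 _ (by rw [abs_of_pos] <;> omega), b2 _ (by rw [abs_of_pos] <;> omega)] at h
    exact mul_inv_eq_iff_eq_mul.mp h
  have hc : cox (m + 2) = P * (paired ((m : ℤ) + 1) ((m : ℤ) + 2) *
      paired (-((m : ℤ) + 1)) ((m : ℤ) + 2)) := by
    have e1 : (-(((m + 2 : ℕ) : ℤ) - 1)) = -((m : ℤ) + 1) := by push_cast; ring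
    have e2 : ((m + 2 : ℕ) : ℤ) = (m : ℤ) + 2 := by push_cast; ring
    rw [cox, e1, e2, show m + 2 - 1 = m + 1 by omega, List.range_succ]
    rw [List.map_append, List.prod_append, ← hP, List.map_singleton, List.prod_singleton, mul_assoc]
  have e2 : ((m + 2 : ℕ) : ℤ) = (m : ℤ) + 2 := by push_cast; ring
  have c1 := conj_paired b hs.1 ((m : ℤ) + 1) ((m : ℤ) + 2)
  have c2 := conj_paired b hs.1 (-((m : ℤ) + 1)) ((m : ℤ) + 2)
  rw [hs.1] at c2
  rw [e2] at b1
  have b3 := b2 ((m : ℤ) + 1) (by rw [abs_of_pos] <;> omega)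
  rw [b1, b3] at c1 c2
  rw [paired_neg _ _ (by omega) (by omega) (by omega) (by omega)] at c2
  have c1' : paired ((m : ℤ) + 1) (-((m : ℤ) + 2)) = paired (-((m : ℤ) + 1)) ((m : ℤ) + 2) := by
    rw [← paired_neg _ _ (by omega) (by omega) (by omega) (by omega), neg_neg]
  rw [c1'] at c1
  have hcomm : paired (-((m : ℤ) + 1)) ((m : ℤ) + 2) * paired ((m : ℤ) + 1) ((m : ℤ) + 2) =
      paired ((m : ℤ) + 1) ((m : ℤ) + 2) * paired (-((m : ℤ) + 1)) ((m : ℤ) + 2) := by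
    exact paired_commute (by omega) (by omega) (by omega)
  rw [hc]
  calc b * (P * (paired ((m : ℤ) + 1) ((m : ℤ) + 2) *
      paired (-((m : ℤ) + 1)) ((m : ℤ) + 2))) * b⁻¹
      = (b * P * b⁻¹) * ((b * paired ((m : ℤ) + 1) ((m : ℤ) + 2) * b⁻¹) *
        (b * paired (-((m : ℤ) + 1)) ((m : ℤ) + 2) * b⁻¹)) := by group
    _ = _ := by
      rw [c1, c2, hcomm, hPb.eq, mul_inv_cancel_right]

theorem conj_balanced_mem {n : ℕ} (hn : 2 ≤ n) (w : NC n) :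
    balanced n * w.1 * (balanced n)⁻¹ ∈ W n ∧
      AbsLE n (balanced n * w.1 * (balanced n)⁻¹) (cox n) := by
  refine ⟨conj_mem_closure (conj_refl (balanced_signed hn)) w.2.1, ?_⟩
  have h := absLE_conj (balanced_signed hn) (balanced_sq n) w.2.1 (cox_mem hn) w.2.2
  rwa [balanced_conj_cox hn] at h

/-- The automorphism `φ_n : w ↦ [n] w [n] = [n] w [n]⁻¹` of `NC(D_n)`. -/
def phiN {n : ℕ} (hn : 2 ≤ n) : NC n ≃o NC n :=
  have inv : ∀ w : Equiv.Perm ℤ,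
      balanced n * (balanced n * w * (balanced n)⁻¹) * (balanced n)⁻¹ = w := fun w => by
    rw [show balanced n * (balanced n * w * (balanced n)⁻¹) * (balanced n)⁻¹ =
      (balanced n * balanced n) * w * (balanced n * balanced n)⁻¹ by group, balanced_sq]
    simp
  have mono : ∀ v w : NC n, v ≤ w → AbsLE n (balanced n * v.1 * (balanced n)⁻¹)
      (balanced n * w.1 * (balanced n)⁻¹) := fun v w h =>
    absLE_conj (balanced_signed hn) (balanced_sq n) v.2.1 w.2.1 h
  { toFun := fun w => ⟨balanced n * w.1 * (balanced n)⁻¹, conj_balanced_mem hn w⟩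
    invFun := fun w => ⟨balanced n * w.1 * (balanced n)⁻¹, conj_balanced_mem hn w⟩
    left_inv := fun w => Subtype.ext (inv w.1)
    right_inv := fun w => Subtype.ext (inv w.1)
    map_rel_iff' := by
      intro v w
      refine ⟨fun h => ?_, fun h => mono v w h⟩
      have h' := mono ⟨_, conj_balanced_mem hn v⟩ ⟨_, conj_balanced_mem hn w⟩ h
      simp only [inv] at h'
      exact h' }

theorem coe_phiN {n : ℕ} (hn : 2 ≤ n) (w : NC n) :
    (phiN hn w).1 = balanced n * w.1 * balanced n := by
  change balanced n * w.1 * (balanced n)⁻¹ = _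
  rw [balanced_inv]

/-- The group `D*` of automorphisms of `NC(D_n)` generated by `φ_l` and `φ_r ∘ φ_n`. The
multiplication of automorphisms is composition. -/
def DStar {n : ℕ} (hn : 2 ≤ n) {l r : Equiv.Perm ℤ} (h : IsBipartition n l r) :
    Subgroup (NC n ≃o NC n) :=
  Subgroup.closure {phiL h, phiR h * phiN hn}

/-- The pairs of reflections of `W(D_4)` that the exotic automorphism of `NC(D_4)` exchanges. -/
def exoticPairs : List (Equiv.Perm ℤ × Equiv.Perm ℤ) :=
  [(paired 1 2, paired 1 4), (paired 2 3, paired 3 4), (paired 1 (-3), paired (-2) 4),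
    (paired (-1) 4, paired (-3) 4), (paired 2 4, paired 2 4), (paired 2 (-3), paired 1 (-2)),
    (paired 1 3, paired 1 3)]

end NCD

end

/-!
`W(D_n)` acts on the odd functions `ℤ → ℚ` supported in `[-n, n]`, and by Carter's lemma the
absolute length of `w` is the codimension of the space `Fix w` of its fixed vectors; so a
reflection lies below `w` if and only if `Fix w` is orthogonal to its root. As observed by Brady
and Watt, an element below the Coxeter element `c` is determined by its fixed space, hence an
automorphism of `NC(D_n)` by its action on the reflections.

The points `pₖ = cᵏ(1)` are the vertices of a `2(n - 1)`-gon with `n` in its centre, and every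
reflection is a chord `((pᵢ pⱼ))` or a spoke `((pᵢ n))`. For `n ≠ 4` the sides of the polygon are
the atoms that have a common upper bound of rank two with all atoms but one; this makes the
spokes recognisable inside the poset. An automorphism therefore permutes the spokes, it preserves
their adjacency, and it is the identity if it fixes two neighbouring ones. Since `φ_l` reflects
the polygon and `φ_l ∘ φ_r ∘ φ_n` rotates it by one step, every automorphism lies in `D*`.

For `n = 4` there is an orthogonal involution of the root system `D₄` that is not a signed
permutation and conjugates `c` to `c⁻¹`. Conjugation by it, followed by inversion, is an
automorphism of `NC(D₄)` that sends some spoke to a chord, which no element of `D*` does.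
-/

noncomputable section

namespace NCD

open Module

section Reflections

variable {n : ℕ} {a b i k : ℤ} {v w : Equiv.Perm ℤ} {x y z : ℤ → ℚ}

/-! ### Signed permutations and odd vectors -/

theorem perm_apply_inv_self (w : Equiv.Perm ℤ) (k : ℤ) : w (w⁻¹ k) = k := w.apply_symm_apply k

theorem perm_inv_apply_self (w : Equiv.Perm ℤ) (k : ℤ) : w⁻¹ (w k) = k := w.symm_apply_apply k

namespace IsSigned

theorem map_zero (hw : IsSigned n w) : w 0 = 0 := by
  have h := hw.1 0
  rw [neg_zero] at h
  omega

theorem inv (hw : IsSigned n w) : IsSigned n w⁻¹ := by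
  refine ⟨fun x => ?_, fun x hx => ?_⟩
  · rw [Equiv.Perm.inv_eq_iff_eq, hw.1, perm_apply_inv_self]
  · rw [Equiv.Perm.inv_eq_iff_eq, hw.2 x hx]

theorem abs_le_of_apply_ne (hw : IsSigned n w) (hi : w i ≠ i) : |i| ≤ n :=
  not_lt.mp fun h => hi (hw.2 i h)

theorem ne_zero_of_apply_ne (hw : IsSigned n w) (hi : w i ≠ i) : i ≠ 0 := by
  rintro rfl
  exact hi hw.map_zero

theorem abs_apply_le (hw : IsSigned n w) (hi : |i| ≤ n) : |w i| ≤ n := by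
  by_cases h : w i = i
  · rwa [h]
  · exact hw.abs_le_of_apply_ne (w.injective.ne h)

theorem abs_apply_le_iff (hw : IsSigned n w) : |w i| ≤ n ↔ |i| ≤ n :=
  ⟨fun h => by simpa using hw.inv.abs_apply_le h, hw.abs_apply_le⟩

theorem apply_ne_zero (hw : IsSigned n w) (hi : i ≠ 0) : w i ≠ 0 :=
  hw.map_zero ▸ w.injective.ne hi

theorem eq_balanced (hw : IsSigned n w) (hi : w i = -i)
    (hfix : ∀ j, w j ≠ j → j = i ∨ j = -i) : w = balanced i := by
  ext k
  rw [balanced, Equiv.swap_apply_def]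
  split_ifs with hk hk'
  · rw [hk, hi]
  · rw [hk', hw.1, hi, neg_neg]
  · by_contra h
    exact (hfix k h).elim hk hk'

end IsSigned

/-- The space of odd functions on `ℤ` with support in `[-n, n]`. It stands for the reflection
representation of `W(D_n)`: the coordinates are `x 1, …, x n`, and `w` acts by `x ↦ x ∘ w⁻¹`. -/
def oddSpace (n : ℕ) : Submodule ℚ (ℤ → ℚ) where
  carrier := {x | (∀ i, x (-i) = -x i) ∧ ∀ i : ℤ, (n : ℤ) < |i| → x i = 0}
  add_mem' := fun {a b} ha hb =>
    ⟨fun i => by simp only [Pi.add_apply, ha.1, hb.1]; ring,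
      fun i hi => by simp only [Pi.add_apply, ha.2 i hi, hb.2 i hi, add_zero]⟩
  zero_mem' := ⟨fun i => by simp, fun i _ => rfl⟩
  smul_mem' := fun c a ha =>
    ⟨fun i => by simp only [Pi.smul_apply, ha.1, smul_neg],
      fun i hi => by simp only [Pi.smul_apply, ha.2 i hi, smul_zero]⟩

/-- The subspace of the vectors fixed by a signed permutation `w`. -/
def fixedSpace (n : ℕ) (w : Equiv.Perm ℤ) : Submodule ℚ (ℤ → ℚ) where
  carrier := {x | x ∈ oddSpace n ∧ ∀ i, x (w i) = x i}
  add_mem' := fun {a b} ha hb =>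
    ⟨add_mem ha.1 hb.1, fun i => by simp only [Pi.add_apply, ha.2, hb.2]⟩
  zero_mem' := ⟨zero_mem _, fun i => rfl⟩
  smul_mem' := fun c a ha =>
    ⟨Submodule.smul_mem _ c ha.1, fun i => by simp only [Pi.smul_apply, ha.2]⟩

theorem fixedSpace_le_oddSpace (n : ℕ) (w : Equiv.Perm ℤ) : fixedSpace n w ≤ oddSpace n :=
  fun _ hx => hx.1

theorem oddSpace_apply_zero (hx : x ∈ oddSpace n) : x 0 = 0 := by
  have h := hx.1 0
  rw [neg_zero] at h
  linarith

theorem comp_mem_oddSpace (hw : IsSigned n w) (hx : x ∈ oddSpace n) :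
    (fun k => x (w k)) ∈ oddSpace n :=
  ⟨fun i => by simp only [hw.1, hx.1], fun i hi => by simp only [hw.2 i hi, hx.2 i hi]⟩

theorem eq_zero_of_mem_oddSpace (hx : x ∈ oddSpace n) (h : ∀ k : ℤ, 1 ≤ k → k ≤ n → x k = 0) :
    x = 0 := by
  funext k
  rcases le_or_gt |k| n with hk | hk
  · rcases lt_trichotomy k 0 with h0 | rfl | h0
    · have hneg := h (-k) (by omega) (by rwa [abs_of_neg h0] at hk)
      rwa [hx.1, neg_eq_zero] at hneg
    · exact oddSpace_apply_zero hx
    · exact h k (by omega) (by rwa [abs_of_pos h0] at hk)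
  · exact hx.2 k hk

instance finiteDimensional_oddSpace (n : ℕ) : FiniteDimensional ℚ (oddSpace n) := by
  let coords : oddSpace n →ₗ[ℚ] (Fin n → ℚ) :=
    (LinearMap.funLeft ℚ ℚ (fun k : Fin n => ((k : ℕ) : ℤ) + 1)) ∘ₗ (oddSpace n).subtype
  refine FiniteDimensional.of_injective coords ?_
  rw [← LinearMap.ker_eq_bot, LinearMap.ker_eq_bot']
  rintro ⟨x, hx⟩ h
  refine Subtype.ext (eq_zero_of_mem_oddSpace hx fun k hk hk' => ?_)
  have hcoord : x ((((k - 1).toNat : ℕ) : ℤ) + 1) = 0 := congrFun h ⟨(k - 1).toNat, by omega⟩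
  rwa [show (((k - 1).toNat : ℕ) : ℤ) + 1 = k by omega] at hcoord

instance finiteDimensional_fixedSpace (n : ℕ) (w : Equiv.Perm ℤ) :
    FiniteDimensional ℚ (fixedSpace n w) :=
  Submodule.finiteDimensional_of_le (fixedSpace_le_oddSpace n w)

/-- The basis vector `e_k` of `oddSpace n`, with the convention `e_{-k} = -e_k`. -/
def unitVec (k : ℤ) : ℤ → ℚ := Pi.single k 1 - Pi.single (-k) 1

theorem unitVec_apply (k i : ℤ) :
    unitVec k i = (if i = k then 1 else 0) - (if i = -k then 1 else 0) := by
  simp [unitVec, Pi.single_apply]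

theorem unitVec_neg (k : ℤ) : unitVec (-k) = -unitVec k := by
  simp [unitVec]

theorem unitVec_self (hk : k ≠ 0) : unitVec k k = 1 := by
  rw [unitVec_apply, if_pos rfl, if_neg (by omega), sub_zero]

theorem unitVec_of_ne (h : i ≠ k) (h' : i ≠ -k) : unitVec k i = 0 := by
  rw [unitVec_apply, if_neg h, if_neg h', sub_zero]

theorem unitVec_mem_oddSpace (hk : |k| ≤ n) : unitVec k ∈ oddSpace n := by
  refine ⟨fun i => ?_, fun i hi => unitVec_of_ne ?_ ?_⟩
  · simp only [unitVec_apply, neg_eq_iff_eq_neg, neg_neg]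
    ring
  · rintro rfl
    exact hi.not_ge hk
  · rintro rfl
    exact hi.not_ge (by rwa [abs_neg])

theorem unitVec_inv_apply (hw : ∀ x, w (-x) = -w x) (k i : ℤ) :
    unitVec k (w⁻¹ i) = unitVec (w k) i := by
  simp only [unitVec_apply, Equiv.Perm.inv_eq_iff_eq, hw]

/-- The standard scalar product of `oddSpace n`. Each coordinate is counted twice, once for `k` and
once for `-k`. -/
def pairing (n : ℕ) : LinearMap.BilinForm ℚ (ℤ → ℚ) :=
  ∑ k ∈ Finset.Icc (-(n : ℤ)) n,
    (LinearMap.mul ℚ ℚ).compl₁₂ (LinearMap.proj k) (LinearMap.proj k)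

theorem pairing_apply (n : ℕ) (x y : ℤ → ℚ) :
    pairing n x y = ∑ k ∈ Finset.Icc (-(n : ℤ)) n, x k * y k := by
  simp [pairing]

theorem pairing_comm (x y : ℤ → ℚ) : pairing n x y = pairing n y x := by
  simp only [pairing_apply, mul_comm]

theorem mem_Icc_neg_iff_abs_le : k ∈ Finset.Icc (-(n : ℤ)) n ↔ |k| ≤ n := by
  rw [Finset.mem_Icc, abs_le]

theorem pairing_comp (hw : IsSigned n w) (x y : ℤ → ℚ) :
    pairing n (fun k => x (w k)) (fun k => y (w k)) = pairing n x y := by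
  simp only [pairing_apply]
  exact Finset.sum_equiv w
    (fun k => by rw [mem_Icc_neg_iff_abs_le, mem_Icc_neg_iff_abs_le, hw.abs_apply_le_iff])
    fun k _ => rfl

theorem pairing_unitVec (hx : x ∈ oddSpace n) (hk : |k| ≤ n) :
    pairing n x (unitVec k) = 2 * x k := by
  simp only [pairing_apply, unitVec_apply, mul_sub, mul_ite, mul_one, mul_zero,
    Finset.sum_sub_distrib]
  rw [Finset.sum_ite_eq', Finset.sum_ite_eq']
  simp only [mem_Icc_neg_iff_abs_le, abs_neg, if_pos hk, hx.1]
  ring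

theorem sum_smul_unitVec (hx : x ∈ oddSpace n) :
    ∑ k ∈ Finset.Icc (-(n : ℤ)) n, x k • unitVec k = (2 : ℚ) • x := by
  funext i
  have hflip : ∀ k, i = -k ↔ k = -i := fun k => by omega
  simp only [Finset.sum_apply, Pi.smul_apply, unitVec_apply, smul_eq_mul, mul_sub, mul_ite, mul_one,
    mul_zero, Finset.sum_sub_distrib, hflip, eq_comm (a := i)]
  rw [Finset.sum_ite_eq', Finset.sum_ite_eq']
  simp only [mem_Icc_neg_iff_abs_le, abs_neg]
  split_ifs with h
  · rw [hx.1]; ring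
  · rw [hx.2 i (by omega)]; ring

theorem apply_inv_of_mem_fixedSpace (hx : x ∈ fixedSpace n w) (k : ℤ) : x (w⁻¹ k) = x k := by
  rw [← hx.2, perm_apply_inv_self]

theorem pairing_sub_eq_zero_of_mem_fixedSpace (hw : IsSigned n w) (hx : x ∈ fixedSpace n w)
    (y : ℤ → ℚ) : pairing n x (fun k => y (w⁻¹ k) - y k) = 0 := by
  have hinv : (fun k => x (w⁻¹ k)) = x := funext (apply_inv_of_mem_fixedSpace hx)
  have hcomp := pairing_comp hw.inv x y
  rw [hinv] at hcomp
  calc pairing n x (fun k => y (w⁻¹ k) - y k)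
      = pairing n x (fun k => y (w⁻¹ k)) - pairing n x y := map_sub (pairing n x) _ _
    _ = 0 := by rw [hcomp, sub_self]

-- A functional that vanishes on the image of `w - 1` has a `w`-invariant coordinate vector.
theorem mem_fixedSpace_of_dual (hw : IsSigned n w) (φ : Dual ℚ (ℤ → ℚ))
    (hφ : ∀ y ∈ oddSpace n, φ (fun k => y (w⁻¹ k) - y k) = 0) :
    (fun k : ℤ => if |k| ≤ n then φ (unitVec k) else 0) ∈ fixedSpace n w := by
  refine ⟨⟨fun i => ?_, fun i hi => if_neg (by omega)⟩, fun i => ?_⟩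
  · simp only [abs_neg, unitVec_neg, map_neg]
    split_ifs <;> simp
  · simp only [hw.abs_apply_le_iff]
    split_ifs with hi
    · have h := hφ _ (unitVec_mem_oddSpace hi)
      simp only [unitVec_inv_apply hw.1] at h
      rw [← sub_eq_zero, ← map_sub]
      exact h
    · rfl

theorem exists_apply_inv_sub_eq (hw : IsSigned n w) (hz : z ∈ oddSpace n)
    (horth : ∀ x ∈ fixedSpace n w, pairing n x z = 0) :
    ∃ y ∈ oddSpace n, ∀ k, y (w⁻¹ k) - y k = z k := by
  let D : (ℤ → ℚ) →ₗ[ℚ] (ℤ → ℚ) := LinearMap.funLeft ℚ ℚ (w⁻¹ : Equiv.Perm ℤ) - LinearMap.id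
  by_contra hne
  have hzD : z ∉ (oddSpace n).map D := by
    rintro ⟨y, hy, hyz⟩
    exact hne ⟨y, hy, fun k => congrFun hyz k⟩
  obtain ⟨φ, hφz, hφD⟩ := Submodule.exists_dual_map_eq_bot_of_notMem hzD inferInstance
  have hφ : ∀ y ∈ oddSpace n, φ (D y) = 0 := fun y hy => by
    rw [← Submodule.mem_bot ℚ, ← hφD]
    exact Submodule.mem_map_of_mem (Submodule.mem_map_of_mem hy)
  have hpair := horth _ (mem_fixedSpace_of_dual hw φ hφ)
  have hφ2 : φ ((2 : ℚ) • z) = 0 := by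
    rw [← hpair, ← sum_smul_unitVec hz, map_sum, pairing_apply]
    refine Finset.sum_congr rfl fun k hk => ?_
    rw [map_smul, smul_eq_mul, mul_comm, if_pos (mem_Icc_neg_iff_abs_le.mp hk)]
  rw [map_smul, smul_eq_mul] at hφ2
  exact hφz (by linarith)

/-! ### Roots and reflections -/

/-- The vector `e_a - e_b` is a root of type `D_n`. The signs of `a` and `b` are arbitrary, so
every root has this form and its reflection is `paired a b`. -/
structure IsRoot (n : ℕ) (a b : ℤ) : Prop where
  left_ne_zero : a ≠ 0
  right_ne_zero : b ≠ 0
  abs_left_le : |a| ≤ n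
  abs_right_le : |b| ≤ n
  ne : a ≠ b
  ne_neg : a ≠ -b

namespace IsRoot

theorem symm (h : IsRoot n a b) : IsRoot n b a :=
  ⟨h.2, h.1, h.4, h.3, h.5.symm, fun e => h.6 (by omega)⟩

theorem neg (h : IsRoot n a b) : IsRoot n (-a) (-b) :=
  ⟨neg_ne_zero.mpr h.1, neg_ne_zero.mpr h.2, (abs_neg a).trans_le h.3, (abs_neg b).trans_le h.4,
    neg_injective.ne h.5, neg_injective.ne h.6⟩

theorem mem_refl (h : IsRoot n a b) : paired a b ∈ refl n :=
  paired_mem_refl h.1 h.2 h.3 h.4 h.5 h.6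

theorem mem_W (h : IsRoot n a b) : paired a b ∈ W n :=
  Subgroup.subset_closure h.mem_refl

theorem paired_apply (h : IsRoot n a b) (k : ℤ) :
    paired a b k = if k = a then b else if k = b then a else if k = -a then -b else
      if k = -b then -a else k := by
  obtain ⟨ha, hb, -, -, hab, hab'⟩ := h
  simp only [paired, Equiv.Perm.mul_apply, Equiv.swap_apply_def]
  split_ifs <;> omega

theorem paired_apply_left (h : IsRoot n a b) : paired a b a = b := by
  rw [h.paired_apply, if_pos rfl]

theorem paired_apply_right (h : IsRoot n a b) : paired a b b = a := by
  rw [paired_comm, h.symm.paired_apply_left]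

theorem inv_paired (h : IsRoot n a b) : (paired a b)⁻¹ = paired a b :=
  paired_inv h.1 h.2 h.5 h.6

theorem paired_mul_self (h : IsRoot n a b) : paired a b * paired a b = 1 :=
  mul_eq_one_iff_eq_inv.mpr h.inv_paired.symm

theorem sub_unitVec_mem_oddSpace (h : IsRoot n a b) : unitVec a - unitVec b ∈ oddSpace n :=
  sub_mem (unitVec_mem_oddSpace h.3) (unitVec_mem_oddSpace h.4)

theorem pairing_sub_unitVec (h : IsRoot n a b) (hx : x ∈ oddSpace n) :
    pairing n x (unitVec a - unitVec b) = 2 * (x a - x b) := by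
  rw [map_sub, pairing_unitVec hx h.3, pairing_unitVec hx h.4, mul_sub]

theorem sub_unitVec_apply_left (h : IsRoot n a b) : (unitVec a - unitVec b) a = 1 := by
  rw [Pi.sub_apply, unitVec_self h.1, unitVec_of_ne h.5 h.6, sub_zero]

theorem sub_unitVec_apply_right (h : IsRoot n a b) : (unitVec a - unitVec b) b = -1 := by
  rw [Pi.sub_apply, unitVec_self h.2, unitVec_of_ne h.symm.5 h.symm.6, zero_sub]

theorem apply_paired (h : IsRoot n a b) (hx : x ∈ oddSpace n) (k : ℤ) :
    x (paired a b k) = x k + (x b - x a) * (unitVec a - unitVec b) k := by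
  have hodd : ∀ i, (unitVec a - unitVec b) (-i) = -(unitVec a - unitVec b) i :=
    h.sub_unitVec_mem_oddSpace.1
  have hl := h.sub_unitVec_apply_left
  have hr := h.sub_unitVec_apply_right
  rw [h.paired_apply]
  split_ifs with ha hb ha' hb'
  · rw [ha, hl]; ring
  · rw [hb, hr]; ring
  · rw [ha', hx.1, hx.1, hodd, hl]; ring
  · rw [hb', hx.1, hx.1, hodd, hr]; ring
  · rw [Pi.sub_apply, unitVec_of_ne ha ha', unitVec_of_ne hb hb']; ring

theorem mem_fixedSpace_iff (h : IsRoot n a b) (hx : x ∈ oddSpace n) :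
    x ∈ fixedSpace n (paired a b) ↔ x a = x b := by
  refine ⟨fun hf => ?_, fun hab => ⟨hx, fun k => ?_⟩⟩
  · rw [← hf.2 b, h.paired_apply_right]
  · rw [h.apply_paired hx, hab, sub_self, zero_mul, add_zero]

end IsRoot

theorem exists_isRoot_of_mem_refl {t : Equiv.Perm ℤ} (ht : t ∈ refl n) :
    ∃ a b, IsRoot n a b ∧ t = paired a b := by
  obtain ⟨i, j, hi, hij, hj, rfl⟩ := ht
  refine ⟨i, j, ?_, rfl⟩
  rcases abs_cases j with h | h <;> rcases abs_cases i with h' | h' <;> constructor <;> omega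

/-! ### Balanced cycles are not in `W(D_n)` -/

theorem exists_ofSubtype_eq_of_mem_W (hw : w ∈ W n) :
    ∃ u : Equiv.Perm {k : ℤ // k ∈ Finset.Icc (-(n : ℤ)) n},
      Equiv.Perm.sign u = 1 ∧ Equiv.Perm.ofSubtype u = w := by
  induction hw using Subgroup.closure_induction with
  | mem t ht =>
    obtain ⟨a, b, h, rfl⟩ := exists_isRoot_of_mem_refl ht
    refine ⟨Equiv.swap ⟨a, mem_Icc_neg_iff_abs_le.mpr h.3⟩ ⟨b, mem_Icc_neg_iff_abs_le.mpr h.4⟩ *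
      Equiv.swap ⟨-a, mem_Icc_neg_iff_abs_le.mpr h.neg.3⟩
        ⟨-b, mem_Icc_neg_iff_abs_le.mpr h.neg.4⟩, ?_, ?_⟩
    · rw [Equiv.Perm.sign_mul, Equiv.Perm.sign_swap, Equiv.Perm.sign_swap]
      · rfl
      · simpa using h.ne
      · simpa using h.ne
    · rw [map_mul, Equiv.Perm.ofSubtype_swap_eq, Equiv.Perm.ofSubtype_swap_eq]
      rfl
  | one => exact ⟨1, map_one _, map_one _⟩
  | mul a b _ _ ha hb =>
    obtain ⟨u, hu, rfl⟩ := ha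
    obtain ⟨v, hv, rfl⟩ := hb
    exact ⟨u * v, by rw [map_mul, hu, hv, one_mul], map_mul _ _ _⟩
  | inv a _ ha =>
    obtain ⟨u, hu, rfl⟩ := ha
    exact ⟨u⁻¹, by rw [map_inv, hu, inv_one], map_inv _ _⟩

theorem balanced_notMem_W (h0 : i ≠ 0) (hi : |i| ≤ n) : balanced i ∉ W n := by
  intro hw
  obtain ⟨u, hu, hbal⟩ := exists_ofSubtype_eq_of_mem_W hw
  let p : {k : ℤ // k ∈ Finset.Icc (-(n : ℤ)) n} := ⟨i, mem_Icc_neg_iff_abs_le.mpr hi⟩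
  let q : {k : ℤ // k ∈ Finset.Icc (-(n : ℤ)) n} :=
    ⟨-i, mem_Icc_neg_iff_abs_le.mpr ((abs_neg i).trans_le hi)⟩
  have hpq : p ≠ q := fun h => by
    have : i = -i := congrArg Subtype.val h
    omega
  have hswap : u = Equiv.swap p q :=
    Equiv.Perm.ofSubtype_injective (hbal.trans (Equiv.Perm.ofSubtype_swap_eq p q).symm)
  rw [hswap, Equiv.Perm.sign_swap hpq] at hu
  exact absurd hu (by decide)

/-! ### Absolute length is the codimension of the fixed space -/

theorem fixedSpace_one (n : ℕ) : fixedSpace n 1 = oddSpace n :=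
  le_antisymm (fixedSpace_le_oddSpace n 1) fun _ hx => ⟨hx, fun _ => rfl⟩

theorem fixedSpace_inf_le_mul (n : ℕ) (v w : Equiv.Perm ℤ) :
    fixedSpace n v ⊓ fixedSpace n w ≤ fixedSpace n (v * w) :=
  fun _ hx => ⟨hx.1.1, fun i => by rw [Equiv.Perm.mul_apply, hx.1.2, hx.2.2]⟩

theorem finrank_fixedSpace_le (n : ℕ) (w : Equiv.Perm ℤ) :
    finrank ℚ (fixedSpace n w) ≤ finrank ℚ (oddSpace n) :=
  Submodule.finrank_mono (fixedSpace_le_oddSpace n w)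

theorem finrank_fixedSpace_add_le (n : ℕ) (v w : Equiv.Perm ℤ) :
    finrank ℚ (fixedSpace n v) + finrank ℚ (fixedSpace n w) ≤
      finrank ℚ (oddSpace n) +
        finrank ℚ (fixedSpace n v ⊓ fixedSpace n w : Submodule ℚ (ℤ → ℚ)) := by
  rw [← Submodule.finrank_sup_add_finrank_inf_eq]
  exact Nat.add_le_add_right (Submodule.finrank_mono
    (sup_le (fixedSpace_le_oddSpace n v) (fixedSpace_le_oddSpace n w))) _

theorem IsRoot.finrank_oddSpace_le (h : IsRoot n a b) :
    finrank ℚ (oddSpace n) ≤ finrank ℚ (fixedSpace n (paired a b)) + 1 := by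
  let f : oddSpace n →ₗ[ℚ] ℚ :=
    ((LinearMap.proj a : (ℤ → ℚ) →ₗ[ℚ] ℚ) - LinearMap.proj b) ∘ₗ (oddSpace n).subtype
  have hdim := LinearMap.finrank_range_add_finrank_ker f
  have hrange : finrank ℚ (LinearMap.range f) ≤ 1 := by
    simpa using Submodule.finrank_le (LinearMap.range f)
  have hker : finrank ℚ (LinearMap.ker f) ≤ finrank ℚ (fixedSpace n (paired a b)) := by
    rw [(Submodule.equivMapOfInjective (oddSpace n).subtype Subtype.val_injective
      (LinearMap.ker f)).finrank_eq]
    refine Submodule.finrank_mono ?_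
    rintro _ ⟨⟨x, hx⟩, hk, rfl⟩
    exact (h.mem_fixedSpace_iff hx).mpr (sub_eq_zero.mp hk)
  omega

theorem finrank_oddSpace_le_absLength_add (hw : w ∈ W n) :
    finrank ℚ (oddSpace n) ≤ absLength n w + finrank ℚ (fixedSpace n w) := by
  obtain ⟨L, hL, rfl, hl⟩ := exists_word refl_inv hw
  rw [absLength, ← hl]
  clear hl hw
  induction L with
  | nil => rw [List.prod_nil, fixedSpace_one]; exact Nat.le_add_left _ _
  | cons t L ih =>
    obtain ⟨a, b, hab, rfl⟩ := exists_isRoot_of_mem_refl (hL t (by simp))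
    have htail := ih fun t ht => hL t (by simp [ht])
    have hroot := hab.finrank_oddSpace_le
    have hinf := finrank_fixedSpace_add_le n (paired a b) L.prod
    have hmul := Submodule.finrank_mono (fixedSpace_inf_le_mul n (paired a b) L.prod)
    rw [List.prod_cons, List.length_cons]
    omega

theorem IsRoot.apply_right_eq_of_translate (h : IsRoot n a b) (hw : IsSigned n w)
    (hy : y ∈ oddSpace n) (hyw : (fun k => y (w⁻¹ k)) = y + (unitVec a - unitVec b)) :
    y b = y a + 1 := by
  have hnorm := pairing_comp hw.inv y y
  have hroot : pairing n (unitVec a - unitVec b) (unitVec a - unitVec b) = 4 := by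
    rw [h.pairing_sub_unitVec h.sub_unitVec_mem_oddSpace, h.sub_unitVec_apply_left,
      h.sub_unitVec_apply_right]
    norm_num
  simp only [hyw, map_add, LinearMap.add_apply] at hnorm
  rw [hroot, pairing_comm (unitVec a - unitVec b) y, h.pairing_sub_unitVec hy] at hnorm
  linarith

-- The new fixed vector is the solution `y` of `(w - 1) y = e_a - e_b`: since `w` is an isometry,
-- `w y` and `y` have the same norm, so they are exchanged by the reflection.
theorem IsRoot.finrank_fixedSpace_lt (h : IsRoot n a b) (hw : IsSigned n w)
    (hf : ∀ x ∈ fixedSpace n w, x a = x b) :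
    finrank ℚ (fixedSpace n w) < finrank ℚ (fixedSpace n (paired a b * w)) := by
  obtain ⟨y, hy, hyw⟩ := exists_apply_inv_sub_eq hw h.sub_unitVec_mem_oddSpace fun x hx => by
    rw [h.pairing_sub_unitVec hx.1, hf x hx, sub_self, mul_zero]
  have hyab : y b = y a + 1 :=
    h.apply_right_eq_of_translate hw hy (funext fun k => eq_add_of_sub_eq' (hyw k))
  have hyfix : y ∈ fixedSpace n (paired a b * w) := by
    refine ⟨hy, fun k => ?_⟩
    rw [Equiv.Perm.mul_apply, h.apply_paired hy, ← hyw, hyab, perm_inv_apply_self]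
    ring
  refine Submodule.finrank_lt_finrank_of_lt (lt_of_le_of_ne (fun x hx => ?_) fun he => ?_)
  · exact fixedSpace_inf_le_mul n _ _ ⟨(h.mem_fixedSpace_iff hx.1).mpr (hf x hx), hx⟩
  · have := hf y (he ▸ hyfix)
    linarith

theorem apply_eq_zero_of_mem_fixedSpace (hx : x ∈ fixedSpace n w) (hi : w i = -i) : x i = 0 := by
  have h := hx.2 i
  rw [hi, hx.1.1] at h
  linarith

theorem exists_isRoot_of_ne_one (hw : w ∈ W n) (hne : w ≠ 1) :
    ∃ a b, IsRoot n a b ∧ ∀ x ∈ fixedSpace n w, x a = x b := by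
  have hs := isSigned_of_mem hw
  by_cases h : ∃ i, w i ≠ i ∧ w i ≠ -i
  · obtain ⟨i, hi, hi'⟩ := h
    have h0 := hs.ne_zero_of_apply_ne hi
    have hn := hs.abs_le_of_apply_ne hi
    exact ⟨i, w i, ⟨h0, hs.apply_ne_zero h0, hn, hs.abs_apply_le hn, hi.symm, by omega⟩,
      fun x hx => (hx.2 i).symm⟩
  have hneg : ∀ i, w i ≠ i → w i = -i := fun i hi => by
    by_contra hi'
    exact h ⟨i, hi, hi'⟩
  obtain ⟨i, hi⟩ : ∃ i, w i ≠ i := by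
    by_contra! hfix
    exact hne (Equiv.ext hfix)
  obtain ⟨j, hj, hji⟩ : ∃ j, w j ≠ j ∧ ¬(j = i ∨ j = -i) := by
    by_contra! hfix
    have hbal := hs.eq_balanced (hneg i hi) hfix
    exact balanced_notMem_W (hs.ne_zero_of_apply_ne hi) (hs.abs_le_of_apply_ne hi) (hbal ▸ hw)
  refine ⟨i, j, ⟨hs.ne_zero_of_apply_ne hi, hs.ne_zero_of_apply_ne hj, hs.abs_le_of_apply_ne hi,
    hs.abs_le_of_apply_ne hj, by omega, by omega⟩, fun x hx => ?_⟩
  rw [apply_eq_zero_of_mem_fixedSpace hx (hneg i hi),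
    apply_eq_zero_of_mem_fixedSpace hx (hneg j hj)]

theorem IsRoot.absLength_paired_le (h : IsRoot n a b) : absLength n (paired a b) ≤ 1 := by
  simpa [absLength] using wordLength_le (T := refl n) [paired a b] (by simpa using h.mem_refl)

theorem IsRoot.absLength_le_paired_mul (h : IsRoot n a b) (hw : w ∈ W n) :
    absLength n w ≤ absLength n (paired a b * w) + 1 := by
  have hmul := wordLength_mul_le refl_inv h.mem_W (mul_mem h.mem_W hw)
  rw [← mul_assoc, h.paired_mul_self, one_mul] at hmul
  have hone := h.absLength_paired_le
  simp only [absLength] at hone ⊢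
  omega

theorem absLength_add_finrank_fixedSpace (hw : w ∈ W n) :
    absLength n w + finrank ℚ (fixedSpace n w) = finrank ℚ (oddSpace n) := by
  refine le_antisymm ?_ (finrank_oddSpace_le_absLength_add hw)
  induction hk : finrank ℚ (oddSpace n) - finrank ℚ (fixedSpace n w) using Nat.strong_induction_on
    generalizing w with
  | _ k ih =>
    by_cases hne : w = 1
    · rw [hne, absLength, wordLength_one, zero_add]
      exact finrank_fixedSpace_le n 1
    · obtain ⟨a, b, hab, hf⟩ := exists_isRoot_of_ne_one hw hne
      have hlt := hab.finrank_fixedSpace_lt (isSigned_of_mem hw) hf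
      have hle := finrank_fixedSpace_le n (paired a b * w)
      have hrec := ih _ (by omega) (mul_mem hab.mem_W hw) rfl
      have hlen := hab.absLength_le_paired_mul hw
      omega

theorem AbsLE.fixedSpace_le (h : AbsLE n v w) (hv : v ∈ W n) (hw : w ∈ W n) :
    fixedSpace n w ≤ fixedSpace n v := by
  have hcodim_v := absLength_add_finrank_fixedSpace hv
  have hcodim_w := absLength_add_finrank_fixedSpace hw
  have hcodim_vw := absLength_add_finrank_fixedSpace (mul_mem (inv_mem hv) hw)
  have hdim := finrank_fixedSpace_add_le n v (v⁻¹ * w)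
  have hle := fixedSpace_inf_le_mul n v (v⁻¹ * w)
  rw [mul_inv_cancel_left] at hle
  rw [AbsLE] at h
  rw [← Submodule.eq_of_le_of_finrank_le hle (by omega)]
  exact inf_le_left

theorem IsRoot.absLength_paired (h : IsRoot n a b) : absLength n (paired a b) = 1 := by
  refine le_antisymm h.absLength_paired_le (Nat.one_le_iff_ne_zero.mpr fun h0 => h.ne ?_)
  have hone := eq_one_of_wordLength refl_inv h.mem_W h0
  rw [← h.paired_apply_left, hone, Equiv.Perm.one_apply]

theorem IsRoot.absLE_iff (h : IsRoot n a b) (hw : w ∈ W n) :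
    AbsLE n (paired a b) w ↔ ∀ x ∈ fixedSpace n w, x a = x b := by
  refine ⟨fun hle x hx => (h.mem_fixedSpace_iff hx.1).mp (hle.fixedSpace_le h.mem_W hw hx),
    fun hf => ?_⟩
  have hlt := h.finrank_fixedSpace_lt (isSigned_of_mem hw) hf
  have hcodim := absLength_add_finrank_fixedSpace hw
  have hcodim' := absLength_add_finrank_fixedSpace (mul_mem h.mem_W hw)
  have hlen := h.absLength_le_paired_mul hw
  rw [AbsLE, h.inv_paired, h.absLength_paired]
  omega

theorem eq_one_of_oddSpace_le_fixedSpace (hw : w ∈ W n) (h : oddSpace n ≤ fixedSpace n w) :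
    w = 1 := by
  by_contra hne
  obtain ⟨a, b, hab, hf⟩ := exists_isRoot_of_ne_one hw hne
  have heq := hf _ (h hab.sub_unitVec_mem_oddSpace)
  rw [hab.sub_unitVec_apply_left, hab.sub_unitVec_apply_right] at heq
  norm_num at heq

end Reflections

section Coxeter

variable {n : ℕ} {a b i j k : ℤ} {x : ℤ → ℚ}

/-! ### The Coxeter element -/

theorem prod_paired_succ_neg (m : ℕ) (k : ℤ) :
    ((List.range m).map fun j : ℕ => paired ((j : ℤ) + 1) ((j : ℤ) + 2)).prod (-k) =
      -((List.range m).map fun j : ℕ => paired ((j : ℤ) + 1) ((j : ℤ) + 2)).prod k := by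
  induction m generalizing k with
  | zero => simp
  | succ m ih =>
    rw [List.range_succ, List.map_append, List.prod_append, List.map_singleton, List.prod_singleton,
      Equiv.Perm.mul_apply, Equiv.Perm.mul_apply, paired_apply_neg (by omega) (by omega), ih]

theorem isRoot_of_pos_of_lt (ha : 0 < a) (hab : a < b) (hb : b ≤ n) : IsRoot n a b :=
  ⟨by omega, by omega, by rw [abs_of_pos ha]; omega, by rw [abs_of_pos] <;> omega, by omega,
    by omega⟩

theorem prod_paired_succ_apply (m : ℕ) (hk : 1 ≤ k) :
    ((List.range m).map fun j : ℕ => paired ((j : ℤ) + 1) ((j : ℤ) + 2)).prod k =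
      if k ≤ m then k + 1 else if k = m + 1 then 1 else k := by
  induction m generalizing k with
  | zero =>
    simp only [List.range_zero, List.map_nil, List.prod_nil, Equiv.Perm.one_apply]
    split_ifs <;> omega
  | succ m ih =>
    have hroot : IsRoot (m + 2) (m + 1) (m + 2) :=
      isRoot_of_pos_of_lt (by omega) (by omega) (by omega)
    rw [List.range_succ, List.map_append, List.prod_append, List.map_singleton, List.prod_singleton,
      Equiv.Perm.mul_apply, hroot.paired_apply]
    push_cast
    rw [ih]
    · split_ifs <;> omega
    · split_ifs <;> omega

theorem isRoot_neg_pred_self (hn : 2 ≤ n) : IsRoot n (-((n : ℤ) - 1)) n :=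
  ⟨by omega, by omega, by rw [abs_neg, abs_of_pos] <;> omega, by rw [abs_of_pos]; omega, by omega,
    by omega⟩

theorem cox_apply_of_lt (hn : 2 ≤ n) (hk : 1 ≤ k) (hkn : k < (n : ℤ) - 1) : cox n k = k + 1 := by
  rw [cox, Equiv.Perm.mul_apply, (isRoot_neg_pred_self hn).paired_apply, if_neg (by omega),
    if_neg (by omega), if_neg (by omega), if_neg (by omega), prod_paired_succ_apply _ hk,
    if_pos (by omega)]

theorem cox_apply_pred (hn : 2 ≤ n) : cox n ((n : ℤ) - 1) = -1 := by
  rw [cox, Equiv.Perm.mul_apply, (isRoot_neg_pred_self hn).paired_apply, if_neg (by omega),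
    if_neg (by omega), if_pos (by omega), prod_paired_succ_neg,
    prod_paired_succ_apply _ (by omega), if_neg (by omega), if_pos (by omega)]

theorem cox_apply_self (hn : 2 ≤ n) : cox n n = -n := by
  rw [cox, Equiv.Perm.mul_apply, (isRoot_neg_pred_self hn).paired_apply_right,
    prod_paired_succ_neg, prod_paired_succ_apply _ (by omega), if_pos (by omega)]
  omega

theorem isSigned_cox (hn : 2 ≤ n) : IsSigned n (cox n) :=
  isSigned_of_mem (cox_mem hn)

/-- The cyclic enumeration `1, 2, …, n - 1, -1, -2, …, -(n - 1)` of the long cycle of the Coxeter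
element, starting with `pos n 0 = 1`. -/
def pos (n : ℕ) (k : ℤ) : ℤ := (cox n ^ k) 1

theorem cox_pos (n : ℕ) (k : ℤ) : cox n (pos n k) = pos n (k + 1) := by
  rw [pos, pos, add_comm, zpow_add, zpow_one, Equiv.Perm.mul_apply]

theorem pos_eq (hn : 2 ≤ n) (hk : 0 ≤ k) (hkn : k < (n : ℤ) - 1) : pos n k = k + 1 := by
  lift k to ℕ using hk
  induction k with
  | zero => simp [pos]
  | succ k ih =>
    push_cast at hkn ⊢
    rw [← cox_pos, ih (by omega), cox_apply_of_lt hn (by omega) (by omega)]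

theorem pos_add_pred (hn : 2 ≤ n) (k : ℤ) : pos n (k + ((n : ℤ) - 1)) = -pos n k := by
  have hpred : pos n ((n : ℤ) - 1) = -1 := by
    rw [show (n : ℤ) - 1 = n - 2 + 1 by ring, ← cox_pos, pos_eq hn (by omega) (by omega),
      show (n : ℤ) - 2 + 1 = n - 1 by ring, cox_apply_pred hn]
  calc pos n (k + ((n : ℤ) - 1)) = (cox n ^ k) (pos n ((n : ℤ) - 1)) := by
        rw [pos, zpow_add, Equiv.Perm.mul_apply, pos]
    _ = -pos n k := by rw [hpred, (isSigned_of_mem (zpow_mem (cox_mem hn) k)).1, pos]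

theorem pos_sub_pred (hn : 2 ≤ n) (k : ℤ) : pos n (k - ((n : ℤ) - 1)) = -pos n k := by
  rw [eq_neg_iff_add_eq_zero, ← neg_add_eq_zero, neg_add, ← pos_add_pred hn, sub_add_cancel]
  ring

theorem pos_periodic (hn : 2 ≤ n) : Function.Periodic (pos n) (2 * ((n : ℤ) - 1)) := fun k => by
  rw [two_mul, ← add_assoc, pos_add_pred hn, pos_add_pred hn, neg_neg]

theorem pos_eq_of_dvd (hn : 2 ≤ n) (h : 2 * ((n : ℤ) - 1) ∣ j - k) : pos n j = pos n k := by
  obtain ⟨m, hm⟩ := h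
  rw [show j = k + m * (2 * ((n : ℤ) - 1)) by linarith]
  exact (pos_periodic hn).int_mul m k

theorem pos_eq_neg (hn : 2 ≤ n) (hk : (n : ℤ) - 1 ≤ k) (hkn : k < 2 * ((n : ℤ) - 1)) :
    pos n k = -(k - ((n : ℤ) - 1) + 1) := by
  rw [← pos_eq hn (by omega) (by omega), pos_sub_pred hn, neg_neg]

theorem dvd_sub_of_pos_eq (hn : 2 ≤ n) (h : pos n j = pos n k) : 2 * ((n : ℤ) - 1) ∣ j - k := by
  have hone : pos n (j - k) = 1 := by
    have := congrArg (cox n ^ (-k)) h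
    simp only [pos, ← Equiv.Perm.mul_apply, ← zpow_add] at this
    rwa [neg_add_cancel, neg_add_eq_sub] at this
  rw [pos_eq_of_dvd hn (Int.dvd_self_sub_emod (m := 2 * ((n : ℤ) - 1)))] at hone
  have hmod := Int.emod_nonneg (j - k) (b := 2 * ((n : ℤ) - 1)) (by omega)
  have hmod' := Int.emod_lt_of_pos (j - k) (b := 2 * ((n : ℤ) - 1)) (by omega)
  refine Int.dvd_of_emod_eq_zero ?_
  rcases lt_or_ge ((j - k) % (2 * ((n : ℤ) - 1))) ((n : ℤ) - 1) with hr | hr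
  · rw [pos_eq hn hmod hr] at hone
    omega
  · rw [pos_eq_neg hn hr hmod'] at hone
    omega

theorem pos_ne (hn : 2 ≤ n) (hjk : j < k) (hkj : k < j + 2 * ((n : ℤ) - 1)) :
    pos n j ≠ pos n k := fun h => by
  have := Int.le_of_dvd (by omega) (dvd_sub_of_pos_eq hn h.symm)
  omega

theorem pos_ne_neg (hn : 2 ≤ n) (hjk : j - ((n : ℤ) - 1) < k) (hkj : k < j + ((n : ℤ) - 1)) :
    pos n j ≠ -pos n k := fun h => by
  rw [← pos_add_pred hn] at h
  exact pos_ne hn (by omega) (by omega) h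

theorem exists_pos_eq (hn : 2 ≤ n) (i : ℤ) (ha0 : a ≠ 0) (ha : |a| ≤ (n : ℤ) - 1) :
    ∃ k, i ≤ k ∧ k < i + 2 * ((n : ℤ) - 1) ∧ pos n k = a := by
  obtain ⟨k, rfl⟩ : ∃ k, pos n k = a := by
    rcases lt_or_gt_of_ne ha0 with h | h
    · rw [abs_of_neg h] at ha
      exact ⟨(-a - 1) + ((n : ℤ) - 1), by
        rw [pos_add_pred hn, pos_eq hn (by omega) (by omega)]; ring⟩
    · rw [abs_of_pos h] at ha
      exact ⟨a - 1, by rw [pos_eq hn (by omega) (by omega)]; ring⟩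
  have hmod := Int.emod_nonneg (k - i) (b := 2 * ((n : ℤ) - 1)) (by omega)
  have hmod' := Int.emod_lt_of_pos (k - i) (b := 2 * ((n : ℤ) - 1)) (by omega)
  refine ⟨i + (k - i) % (2 * ((n : ℤ) - 1)), by omega, by omega, (pos_eq_of_dvd hn ?_).symm⟩
  rw [← sub_sub]
  exact Int.dvd_self_sub_emod

theorem pos_ne_zero (hn : 2 ≤ n) (k : ℤ) : pos n k ≠ 0 :=
  (isSigned_of_mem (zpow_mem (cox_mem hn) k)).apply_ne_zero one_ne_zero

theorem abs_pos_le (hn : 2 ≤ n) (k : ℤ) : |pos n k| ≤ (n : ℤ) - 1 := by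
  have hmod := Int.emod_nonneg k (b := 2 * ((n : ℤ) - 1)) (by omega)
  have hmod' := Int.emod_lt_of_pos k (b := 2 * ((n : ℤ) - 1)) (by omega)
  rw [pos_eq_of_dvd hn (Int.dvd_self_sub_emod (m := 2 * ((n : ℤ) - 1)))]
  rcases lt_or_ge (k % (2 * ((n : ℤ) - 1))) ((n : ℤ) - 1) with hr | hr
  · rw [pos_eq hn hmod hr, abs_of_pos] <;> omega
  · rw [pos_eq_neg hn hr hmod', abs_neg, abs_of_pos] <;> omega

theorem isRoot_pos (hn : 2 ≤ n) (hjk : j < k) (hkj : k < j + ((n : ℤ) - 1)) :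
    IsRoot n (pos n j) (pos n k) :=
  ⟨pos_ne_zero hn j, pos_ne_zero hn k, (abs_pos_le hn j).trans (by omega),
    (abs_pos_le hn k).trans (by omega), pos_ne hn hjk (by omega), pos_ne_neg hn (by omega) hkj⟩

theorem isRoot_pos_last (hn : 2 ≤ n) (k : ℤ) : IsRoot n (pos n k) n := by
  have h := abs_le.mp (abs_pos_le hn k)
  exact ⟨pos_ne_zero hn k, by omega, (abs_pos_le hn k).trans (by omega),
    by rw [abs_of_pos (by omega)], by omega, by omega⟩

theorem chord_or_spoke_of_mem_refl (hn : 2 ≤ n) {t : Equiv.Perm ℤ} (ht : t ∈ refl n) :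
    (∃ i j, i < j ∧ j < i + ((n : ℤ) - 1) ∧ t = paired (pos n i) (pos n j)) ∨
      ∃ i, t = paired (pos n i) n := by
  obtain ⟨a, b, ha0, hab, hb, rfl⟩ := ht
  have hb0 : b ≠ 0 := by rintro rfl; simp at hab; omega
  have ha : |a| = a := abs_of_pos (by omega)
  obtain ⟨i, -, -, rfl⟩ := exists_pos_eq hn 0 (a := a) (by omega) (by omega)
  by_cases hbn : |b| = n
  · rcases abs_choice b with h | h
    · exact Or.inr ⟨i, by rw [← hbn, h]⟩
    · have hroot := isRoot_pos_last hn (i + ((n : ℤ) - 1))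
      refine Or.inr ⟨i + ((n : ℤ) - 1), ?_⟩
      rw [← paired_neg _ _ hroot.1 hroot.2 hroot.5 hroot.6, pos_add_pred hn, neg_neg,
        show -(n : ℤ) = b by omega]
  · left
    obtain ⟨j, hij, hji, rfl⟩ := exists_pos_eq hn i hb0 (by omega)
    have hne : j ≠ i := by rintro rfl; omega
    have hne' : j ≠ i + ((n : ℤ) - 1) := by
      rintro rfl
      rw [pos_add_pred hn, abs_neg, ha] at hab
      omega
    rcases lt_or_gt_of_ne hne' with h | h
    · exact ⟨i, j, by omega, h, rfl⟩
    · refine ⟨j, i + 2 * ((n : ℤ) - 1), by omega, by omega, ?_⟩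
      rw [pos_periodic hn, paired_comm]

theorem eq_zero_of_pos (hn : 2 ≤ n) (hx : x ∈ oddSpace n) (hlast : x n = 0) (i : ℤ)
    (hpos : ∀ j, i ≤ j → j < i + ((n : ℤ) - 1) → x (pos n j) = 0) : x = 0 := by
  refine eq_zero_of_mem_oddSpace hx fun k hk hkn => ?_
  rcases eq_or_lt_of_le hkn with rfl | hkn
  · exact hlast
  obtain ⟨j, hij, hji, rfl⟩ := exists_pos_eq hn i (a := k) (by omega)
    (by rw [abs_of_pos (by omega)]; omega)
  rcases lt_or_ge j (i + ((n : ℤ) - 1)) with hj | hj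
  · exact hpos j hij hj
  · rw [← neg_neg (pos n j), ← pos_sub_pred hn, hx.1, hpos _ (by omega) (by omega), neg_zero]

theorem fixedSpace_cox (hn : 2 ≤ n) : fixedSpace n (cox n) = ⊥ := by
  rw [Submodule.eq_bot_iff]
  intro x hx
  have hper : Function.Periodic (fun k => x (pos n k)) (1 : ℤ) := fun k => by
    simp only [← cox_pos, hx.2]
  have hconst : ∀ k, x (pos n k) = x (pos n 0) := fun k => by
    simpa using hper.int_mul k 0
  have hneg := hconst (0 + ((n : ℤ) - 1))
  rw [pos_add_pred hn, hx.1.1] at hneg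
  refine eq_zero_of_pos hn hx.1 (apply_eq_zero_of_mem_fixedSpace hx (cox_apply_self hn)) 0
    fun j _ _ => ?_
  rw [hconst]
  linarith

theorem IsRoot.absLE_cox (h : IsRoot n a b) (hn : 2 ≤ n) : AbsLE n (paired a b) (cox n) := by
  refine (h.absLE_iff (cox_mem hn)).mpr fun x hx => ?_
  rw [fixedSpace_cox hn, Submodule.mem_bot] at hx
  rw [hx, Pi.zero_apply, Pi.zero_apply]

theorem absLength_cox (hn : 2 ≤ n) : absLength n (cox n) = finrank ℚ (oddSpace n) := by
  have h := absLength_add_finrank_fixedSpace (cox_mem hn)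
  rwa [fixedSpace_cox hn, finrank_bot, add_zero] at h

end Coxeter

section FixedSpaces

variable {n : ℕ} {a b i j k l : ℤ} {u v w : Equiv.Perm ℤ} {x : ℤ → ℚ}

/-! ### Fixed vectors of the coatoms -/

theorem IsRoot.apply_eq_of_mem_fixedSpace_paired_mul (h : IsRoot n a b)
    (hx : x ∈ fixedSpace n (paired a b * w)) (ha : w k ≠ a) (hb : w k ≠ b) (ha' : w k ≠ -a)
    (hb' : w k ≠ -b) : x (w k) = x k := by
  rw [← hx.2 k, Equiv.Perm.mul_apply, h.paired_apply, if_neg ha, if_neg hb, if_neg ha', if_neg hb']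

theorem IsRoot.exists_mem_fixedSpace_paired_mul_cox (h : IsRoot n a b) (hn : 2 ≤ n) :
    ∃ x ∈ fixedSpace n (paired a b * cox n), x ≠ 0 := by
  have hlt := h.finrank_fixedSpace_lt (isSigned_cox hn)
    ((h.absLE_iff (cox_mem hn)).mp (h.absLE_cox hn))
  refine Submodule.exists_mem_ne_zero_of_ne_bot fun hbot => ?_
  rw [hbot, finrank_bot] at hlt
  omega

theorem eq_of_forall_eq_pred {f : ℤ → ℚ} (hf : ∀ m, i < m → m < k → f m = f (m - 1))
    (hij : i ≤ j) (hjk : j < k) : f j = f i := by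
  induction j, hij using Int.leInduction with
  | base => rfl
  | succ j hij ih => rw [hf _ (by omega) hjk, add_sub_cancel_right, ih (by omega)]

theorem apply_pos_eq_pred_of_mem_fixedSpace_chord (hn : 2 ≤ n) (hil : i < l)
    (hli : l < i + ((n : ℤ) - 1))
    (hx : x ∈ fixedSpace n (paired (pos n i) (pos n l) * cox n)) (hij : i < j)
    (hji : j < i + ((n : ℤ) - 1)) (hjl : j ≠ l) : x (pos n j) = x (pos n (j - 1)) := by
  have hcox : cox n (pos n (j - 1)) = pos n j := by rw [cox_pos, sub_add_cancel]
  rw [← hcox]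
  refine (isRoot_pos hn hil hli).apply_eq_of_mem_fixedSpace_paired_mul hx ?_ ?_ ?_ ?_ <;> rw [hcox]
  · exact (pos_ne hn hij (by omega)).symm
  · rcases lt_or_gt_of_ne hjl with h | h
    · exact pos_ne hn h (by omega)
    · exact (pos_ne hn h (by omega)).symm
  · exact pos_ne_neg hn (by omega) (by omega)
  · exact pos_ne_neg hn (by omega) (by omega)

theorem apply_pos_eq_of_mem_fixedSpace_chord (hn : 2 ≤ n) (hil : i < l)
    (hli : l < i + ((n : ℤ) - 1))
    (hx : x ∈ fixedSpace n (paired (pos n i) (pos n l) * cox n)) (hij : i ≤ j) (hjl : j < l) :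
    x (pos n j) = x (pos n i) :=
  eq_of_forall_eq_pred (f := fun m => x (pos n m))
    (fun _ him hml => apply_pos_eq_pred_of_mem_fixedSpace_chord hn hil hli hx him (by omega)
      (by omega)) hij hjl

-- All coordinates from `l` up to `i + n - 2` agree, and after one more step along `cox n` the
-- vertex `-pos n i` is reflected to `-pos n l`.
theorem apply_pos_eq_zero_of_mem_fixedSpace_chord (hn : 2 ≤ n) (hil : i < l)
    (hli : l < i + ((n : ℤ) - 1))
    (hx : x ∈ fixedSpace n (paired (pos n i) (pos n l) * cox n)) (hlj : l ≤ j)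
    (hji : j < i + ((n : ℤ) - 1)) : x (pos n j) = 0 := by
  have hconst : ∀ m, l ≤ m → m < i + ((n : ℤ) - 1) → x (pos n m) = x (pos n l) :=
    fun m => eq_of_forall_eq_pred (f := fun m => x (pos n m)) fun m hlm hmi =>
      apply_pos_eq_pred_of_mem_fixedSpace_chord hn hil hli hx (by omega) hmi (by omega)
  have hroot := isRoot_pos hn hil hli
  have hlast := hconst (i + ((n : ℤ) - 1) - 1) (by omega) (by omega)
  have hwrap := hx.2 (pos n (i + ((n : ℤ) - 1) - 1))
  rw [Equiv.Perm.mul_apply, cox_pos, sub_add_cancel, pos_add_pred hn,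
    paired_apply_neg hroot.1 hroot.2, hroot.paired_apply_left, hx.1.1] at hwrap
  rw [hconst j hlj hji]
  linarith

theorem apply_last_eq_zero_of_mem_fixedSpace_chord (hn : 2 ≤ n) (hil : i < l)
    (hli : l < i + ((n : ℤ) - 1))
    (hx : x ∈ fixedSpace n (paired (pos n i) (pos n l) * cox n)) : x n = 0 := by
  have hi := isRoot_pos_last hn i
  have hl := isRoot_pos_last hn l
  have h := (isRoot_pos hn hil hli).apply_eq_of_mem_fixedSpace_paired_mul (k := n) hx
  rw [cox_apply_self hn, hx.1.1] at h
  have := h hi.6.symm hl.6.symm hi.neg.5.symm hl.neg.5.symm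
  linarith

theorem exists_mem_fixedSpace_chord (hn : 2 ≤ n) (hil : i < l) (hli : l < i + ((n : ℤ) - 1)) :
    ∃ x ∈ fixedSpace n (paired (pos n i) (pos n l) * cox n), x (pos n i) ≠ 0 := by
  obtain ⟨x, hx, hx0⟩ := (isRoot_pos hn hil hli).exists_mem_fixedSpace_paired_mul_cox hn
  refine ⟨x, hx, fun hi => hx0 (eq_zero_of_pos hn hx.1
    (apply_last_eq_zero_of_mem_fixedSpace_chord hn hil hli hx) i fun j hij hji => ?_)⟩
  rcases lt_or_ge j l with h | h
  · rw [apply_pos_eq_of_mem_fixedSpace_chord hn hil hli hx hij h, hi]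
  · exact apply_pos_eq_zero_of_mem_fixedSpace_chord hn hil hli hx h hji

theorem apply_pos_eq_of_mem_fixedSpace_spoke (hn : 2 ≤ n)
    (hx : x ∈ fixedSpace n (paired (pos n i) n * cox n)) (hij : i ≤ j)
    (hji : j < i + ((n : ℤ) - 1)) : x (pos n j) = x (pos n i) := by
  refine eq_of_forall_eq_pred (f := fun m => x (pos n m)) (fun m him hmi => ?_) hij hji
  have hcox : cox n (pos n (m - 1)) = pos n m := by rw [cox_pos, sub_add_cancel]
  have hm := isRoot_pos_last hn m
  rw [← hcox]
  refine (isRoot_pos_last hn i).apply_eq_of_mem_fixedSpace_paired_mul hx ?_ ?_ ?_ ?_ <;> rw [hcox]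
  · exact (pos_ne hn him (by omega)).symm
  · exact hm.5
  · exact pos_ne_neg hn (by omega) (by omega)
  · exact hm.6

theorem apply_last_eq_neg_of_mem_fixedSpace_spoke (hn : 2 ≤ n)
    (hx : x ∈ fixedSpace n (paired (pos n i) n * cox n)) : x n = -x (pos n i) := by
  have hroot := isRoot_pos_last hn i
  have hwrap := hx.2 (pos n (i + ((n : ℤ) - 1) - 1))
  rw [Equiv.Perm.mul_apply, cox_pos, sub_add_cancel, pos_add_pred hn,
    paired_apply_neg hroot.1 hroot.2, hroot.paired_apply_left, hx.1.1,
    apply_pos_eq_of_mem_fixedSpace_spoke hn hx (by omega) (by omega)] at hwrap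
  linarith

theorem exists_mem_fixedSpace_spoke (hn : 2 ≤ n) (i : ℤ) :
    ∃ x ∈ fixedSpace n (paired (pos n i) n * cox n), x (pos n i) ≠ 0 := by
  obtain ⟨x, hx, hx0⟩ := (isRoot_pos_last hn i).exists_mem_fixedSpace_paired_mul_cox hn
  refine ⟨x, hx, fun hi => hx0 (eq_zero_of_pos hn hx.1 ?_ i fun j hij hji => ?_)⟩
  · rw [apply_last_eq_neg_of_mem_fixedSpace_spoke hn hx, hi, neg_zero]
  · rw [apply_pos_eq_of_mem_fixedSpace_spoke hn hx hij hji, hi]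

/-! ### Elements of `NC(D_n)` are determined by their fixed spaces -/

theorem fixedSpace_le_inv (n : ℕ) (w : Equiv.Perm ℤ) : fixedSpace n w ≤ fixedSpace n w⁻¹ :=
  fun _ hx => ⟨hx.1, apply_inv_of_mem_fixedSpace hx⟩

theorem apply_inv_eq_of_mem_fixedSpace_inv_mul (hx : x ∈ fixedSpace n (v⁻¹ * w)) (k : ℤ) :
    x (v⁻¹ k) = x (w⁻¹ k) := by
  have h := hx.2 (w⁻¹ k)
  rwa [Equiv.Perm.mul_apply, perm_apply_inv_self] at h

theorem fixedSpace_sup_fixedSpace (hn : 2 ≤ n) (v : NC n) :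
    fixedSpace n v.1 ⊔ fixedSpace n (v.1⁻¹ * cox n) = oddSpace n := by
  have hinf := fixedSpace_inf_le_mul n v.1 (v.1⁻¹ * cox n)
  rw [mul_inv_cancel_left, fixedSpace_cox hn, le_bot_iff] at hinf
  have hdim := Submodule.finrank_sup_add_finrank_inf_eq
    (fixedSpace n v.1) (fixedSpace n (v.1⁻¹ * cox n))
  rw [hinf, finrank_bot] at hdim
  have hcodim := absLength_add_finrank_fixedSpace v.2.1
  have hcodim' := absLength_add_finrank_fixedSpace (mul_mem (inv_mem v.2.1) (cox_mem hn))
  have hle : AbsLE n v.1 (cox n) := v.2.2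
  rw [AbsLE, absLength_cox hn] at hle
  exact Submodule.eq_of_le_of_finrank_le
    (sup_le (fixedSpace_le_oddSpace _ _) (fixedSpace_le_oddSpace _ _)) (by omega)

-- Let `c` be the Coxeter element. If `c y = w y`, then `(w - 1) y` is orthogonal to the fixed
-- vectors of `w`, that is of `v`, hence equals `(v - 1) (z + a)` for some fixed vector `z` of `v`
-- and some `a` with `c a = v a`. So `(c - 1) y = (c - 1) a`, and `y = a` as `c` fixes no vector.
theorem fixedSpace_inv_mul_cox_le (hn : 2 ≤ n) {v w : NC n}
    (h : fixedSpace n v.1 = fixedSpace n w.1) :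
    fixedSpace n (w.1⁻¹ * cox n) ≤ fixedSpace n (v.1⁻¹ * cox n) := by
  intro y hy
  have hsv := isSigned_of_mem v.2.1
  have hsw := isSigned_of_mem w.2.1
  obtain ⟨y', hy', hyy'⟩ := exists_apply_inv_sub_eq hsv
    (sub_mem (comp_mem_oddSpace hsw.inv hy.1) hy.1) fun x hx =>
      pairing_sub_eq_zero_of_mem_fixedSpace hsw (h ▸ hx) y
  rw [← fixedSpace_sup_fixedSpace hn v, Submodule.mem_sup] at hy'
  obtain ⟨z, hz, a, ha, rfl⟩ := hy'
  have hya : y - a ∈ fixedSpace n (cox n) := by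
    refine ⟨sub_mem hy.1 ha.1, fun k => ?_⟩
    have hk := hyy' (cox n k)
    have hcy := apply_inv_eq_of_mem_fixedSpace_inv_mul hy (cox n k)
    have hca := apply_inv_eq_of_mem_fixedSpace_inv_mul ha (cox n k)
    rw [perm_inv_apply_self] at hcy hca
    simp only [Pi.add_apply, Pi.sub_apply, apply_inv_of_mem_fixedSpace hz, hca, hcy] at hk ⊢
    linarith
  rw [fixedSpace_cox hn, Submodule.mem_bot, sub_eq_zero] at hya
  rwa [hya]

theorem NC.ext_fixedSpace (hn : 2 ≤ n) {v w : NC n} (h : fixedSpace n v.1 = fixedSpace n w.1) :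
    v = w := by
  refine Subtype.ext (inv_mul_eq_one.mp
    (eq_one_of_oddSpace_le_fixedSpace (mul_mem (inv_mem v.2.1) w.2.1) ?_))
  rw [← fixedSpace_sup_fixedSpace hn w, sup_le_iff]
  constructor
  · exact fun x hx => fixedSpace_inf_le_mul n _ _ ⟨fixedSpace_le_inv n _ (h ▸ hx), hx⟩
  · intro x hx
    have hprod := fixedSpace_inf_le_mul n (v.1⁻¹ * cox n) (w.1⁻¹ * cox n)⁻¹
      ⟨fixedSpace_inv_mul_cox_le hn h hx, fixedSpace_le_inv n _ hx⟩
    rwa [mul_inv_rev, inv_inv, mul_assoc, mul_inv_cancel_left] at hprod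

/-! ### The rank function -/

theorem AbsLE.trans (huv : AbsLE n u v) (hvw : AbsLE n v w) (hu : u ∈ W n) (hv : v ∈ W n)
    (hw : w ∈ W n) : AbsLE n u w := by
  have hle := wordLength_mul_le refl_inv (mul_mem (inv_mem hu) hv) (mul_mem (inv_mem hv) hw)
  have hle' := wordLength_mul_le refl_inv hu (mul_mem (inv_mem hu) hw)
  rw [mul_inv_cancel_left] at hle'
  rw [mul_assoc, mul_inv_cancel_left] at hle
  simp only [AbsLE, absLength] at huv hvw ⊢
  omega

theorem IsRoot.map (h : IsRoot n a b) (hw : IsSigned n w) : IsRoot n (w a) (w b) :=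
  ⟨hw.apply_ne_zero h.1, hw.apply_ne_zero h.2, hw.abs_apply_le h.3, hw.abs_apply_le h.4,
    w.injective.ne h.5, hw.1 b ▸ w.injective.ne h.6⟩

theorem IsRoot.absLength_eq_paired_mul_add_one (h : IsRoot n a b)
    (hle : AbsLE n (paired a b) w) : absLength n w = absLength n (paired a b * w) + 1 := by
  rw [AbsLE, h.inv_paired, h.absLength_paired] at hle
  omega

theorem IsRoot.paired_mul_absLE (h : IsRoot n a b) (hw : w ∈ W n) (hle : AbsLE n (paired a b) w) :
    AbsLE n (paired a b * w) w := by
  have hs := (isSigned_of_mem hw).inv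
  have hquot : (paired a b * w)⁻¹ * w = paired (w⁻¹ a) (w⁻¹ b) := by
    rw [← conj_paired _ hs.1, mul_inv_rev, h.inv_paired, inv_inv]
  rw [AbsLE, hquot, (h.map hs).absLength_paired, h.absLength_eq_paired_mul_add_one hle]

/-- The rank of a non-crossing partition. -/
def rk (w : NC n) : ℕ := absLength n w.1

theorem fixedSpace_antitone : Antitone fun w : NC n => fixedSpace n w.1 :=
  fun v w h => AbsLE.fixedSpace_le h v.2.1 w.2.1

theorem rk_add_finrank_fixedSpace (w : NC n) :
    rk w + finrank ℚ (fixedSpace n w.1) = finrank ℚ (oddSpace n) :=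
  absLength_add_finrank_fixedSpace w.2.1

theorem eq_one_of_rk_eq_zero {w : NC n} (hw : rk w = 0) : w.1 = 1 :=
  eq_one_of_wordLength refl_inv w.2.1 hw

theorem mem_refl_of_absLength_eq_one (hw : w ∈ W n) (h : absLength n w = 1) : w ∈ refl n := by
  obtain ⟨L, hL, hprod, hlen⟩ := exists_word refl_inv hw
  rw [show wordLength (refl n) w = 1 from h, List.length_eq_one_iff] at hlen
  obtain ⟨t, rfl⟩ := hlen
  rw [← hprod, List.prod_singleton]
  exact hL t (List.mem_singleton_self t)

theorem mem_refl_of_rk_eq_one {s : NC n} (hs : rk s = 1) : s.1 ∈ refl n :=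
  mem_refl_of_absLength_eq_one s.2.1 hs

theorem IsRoot.rk_eq_one {s : NC n} (h : IsRoot n a b) (hs : s.1 = paired a b) : rk s = 1 := by
  rw [rk, hs, h.absLength_paired]

theorem IsRoot.le_iff {s w : NC n} (h : IsRoot n a b) (hs : s.1 = paired a b) :
    s ≤ w ↔ ∀ x ∈ fixedSpace n w.1, x a = x b := by
  rw [← h.absLE_iff w.2.1, ← hs]
  rfl

theorem le_iff_fixedSpace_le {s w : NC n} (hs : rk s = 1) :
    s ≤ w ↔ fixedSpace n w.1 ≤ fixedSpace n s.1 := by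
  obtain ⟨a, b, hab, e⟩ := exists_isRoot_of_mem_refl (mem_refl_of_rk_eq_one hs)
  rw [hab.le_iff e, e]
  exact forall₂_congr fun x hx => (hab.mem_fixedSpace_iff hx.1).symm

theorem rk_strictMono : StrictMono (rk : NC n → ℕ) := by
  intro v w h
  have hle : rk w = rk v + absLength n (v.1⁻¹ * w.1) := h.le
  have hne : absLength n (v.1⁻¹ * w.1) ≠ 0 := fun h0 => h.ne (Subtype.ext (inv_mul_eq_one.mp
    (eq_one_of_wordLength refl_inv (mul_mem (inv_mem v.2.1) w.2.1) h0)))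
  omega

theorem exists_atom_le_and_lt (hn : 2 ≤ n) {w : NC n} (hw : rk w ≠ 0) :
    ∃ s v : NC n, rk s = 1 ∧ s ≤ w ∧ v < w ∧ rk w = rk v + 1 ∧
      fixedSpace n s.1 ⊓ fixedSpace n v.1 ≤ fixedSpace n w.1 := by
  have hne : w.1 ≠ 1 := fun h => hw (by rw [rk, h, absLength, wordLength_one])
  obtain ⟨a, b, hab, hf⟩ := exists_isRoot_of_ne_one w.2.1 hne
  have hs : AbsLE n (paired a b) w.1 := (hab.absLE_iff w.2.1).mpr hf
  have hvW := mul_mem hab.mem_W w.2.1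
  have hvw := hab.paired_mul_absLE w.2.1 hs
  let v : NC n := ⟨paired a b * w.1, hvW, hvw.trans w.2.2 hvW w.2.1 (cox_mem hn)⟩
  have hrk : rk w = rk v + 1 := hab.absLength_eq_paired_mul_add_one hs
  refine ⟨⟨paired a b, hab.mem_W, hab.absLE_cox hn⟩, v, hab.absLength_paired, hs,
    lt_of_le_of_ne hvw fun e => ?_, hrk, ?_⟩
  · rw [e] at hrk
    omega
  · have hinf := fixedSpace_inf_le_mul n (paired a b) (paired a b * w.1)
    rwa [← mul_assoc, hab.paired_mul_self, one_mul] at hinf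

theorem rk_le_rk_apply (hn : 2 ≤ n) (ψ : NC n ≃o NC n) (w : NC n) : rk w ≤ rk (ψ w) := by
  induction hk : rk w generalizing w with
  | zero => exact Nat.zero_le _
  | succ k ih =>
    obtain ⟨-, v, -, -, hvw, hrk, -⟩ := exists_atom_le_and_lt hn (w := w) (by omega)
    have hv := ih v (by omega)
    have hlt := rk_strictMono (ψ.lt_iff_lt.mpr hvw)
    omega

theorem rk_apply (hn : 2 ≤ n) (ψ : NC n ≃o NC n) (w : NC n) : rk (ψ w) = rk w :=
  le_antisymm (by simpa using rk_le_rk_apply hn ψ.symm (ψ w)) (rk_le_rk_apply hn ψ w)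

theorem eq_one_of_forall_atom_apply_eq (hn : 2 ≤ n) {ψ : NC n ≃o NC n}
    (hψ : ∀ s, rk s = 1 → ψ s = s) : ψ = 1 := by
  refine RelIso.ext fun w => ?_
  change ψ w = w
  have hrkψ := rk_apply hn ψ w
  induction hk : rk w generalizing w with
  | zero =>
    rw [hk] at hrkψ
    exact Subtype.ext ((eq_one_of_rk_eq_zero hrkψ).trans (eq_one_of_rk_eq_zero hk).symm)
  | succ k ih =>
    obtain ⟨s, v, hs, hsw, hvw, hrk, hf⟩ := exists_atom_le_and_lt hn (w := w) (by omega)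
    have hle_s := fixedSpace_antitone (ψ.monotone hsw)
    have hle_v := fixedSpace_antitone (ψ.monotone hvw.le)
    rw [hψ s hs] at hle_s
    rw [ih v (rk_apply hn ψ v) (by omega)] at hle_v
    have hcodim := rk_add_finrank_fixedSpace w
    have hcodimψ := rk_add_finrank_fixedSpace (ψ w)
    exact NC.ext_fixedSpace hn
      (Submodule.eq_of_le_of_finrank_le ((le_inf hle_s hle_v).trans hf) (by omega))

end FixedSpaces

section Triangles

variable {n : ℕ} {a b c d : ℤ} {s t : Equiv.Perm ℤ} {x : ℤ → ℚ}

/-! ### Triangles of roots -/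

section SimplyLaced

variable {V : Type*} [AddCommGroup V] [Module ℚ V] {B : LinearMap.BilinForm ℚ V} {r : ℚ}
  {α β γ : V}

theorem abs_le_one_of_form_self_eq (hB : B.IsSymm) (hpos : ∀ x, x ≠ 0 → 0 < B x x) (hr : 0 < r)
    (hα : B α α = 2 * r) (hβ : B β β = 2 * r) {m : ℤ} (hm : B α β = m * r) (hne : α ≠ β)
    (hne' : α ≠ -β) : |m| ≤ 1 := by
  have hβα : B β α = m * r := (hB.eq α β).symm.trans hm
  have hsub := hpos (α - β) (sub_ne_zero.mpr hne)
  have hadd := hpos (α + β) fun h => hne' (eq_neg_of_add_eq_zero_left h)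
  simp only [map_sub, map_add, LinearMap.sub_apply, LinearMap.add_apply, hα, hβ, hm, hβα]
    at hsub hadd
  have hlt : (m : ℚ) < 2 := by nlinarith
  have hgt : (-2 : ℚ) < m := by nlinarith
  have hlt' : m < 2 := by exact_mod_cast hlt
  have hgt' : -2 < m := by exact_mod_cast hgt
  exact abs_le.mpr (by omega)

theorem reflection_coeffs_of_norm_eq {e p q : ℤ} (he : |e| ≤ 1) (hp : |p| ≤ 1) (hq : |q| ≤ 1)
    (h : 4 - e * e = p * p + q * q - e * p * q) :
    e * e = 1 ∧ (p = -e ∧ q = 1 ∨ p = e ∧ q = -1) := by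
  rw [abs_le] at he hp hq
  obtain ⟨he₁, he₂⟩ := he
  obtain ⟨hp₁, hp₂⟩ := hp
  obtain ⟨hq₁, hq₂⟩ := hq
  interval_cases e <;> interval_cases p <;> interval_cases q <;> simp at h ⊢

-- In a simply laced root system, a root in the span of two others is one of their reflections. The
-- proof projects `γ` to the orthogonal complement of `α` and `β`; by assumption the result is `0`.
theorem eq_reflection_or_eq_neg_reflection (hB : B.IsSymm) (hpos : ∀ x, x ≠ 0 → 0 < B x x)
    (hr : 0 < r) (hα : B α α = 2 * r) (hβ : B β β = 2 * r) (hγ : B γ γ = 2 * r) {e p q : ℤ}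
    (he : B α β = e * r) (hp : B α γ = p * r) (hq : B β γ = q * r) (he₁ : |e| ≤ 1)
    (hp₁ : |p| ≤ 1) (hq₁ : |q| ≤ 1) (h : ∀ x, B x α = 0 → B x β = 0 → B x γ = 0) :
    γ = β - (e : ℚ) • α ∨ γ = -(β - (e : ℚ) • α) := by
  have hβα : B β α = e * r := (hB.eq α β).symm.trans he
  have hγα : B γ α = p * r := (hB.eq α γ).symm.trans hp
  have hγβ : B γ β = q * r := (hB.eq β γ).symm.trans hq
  set f : V := (4 - e * e : ℚ) • γ - (2 * p - e * q : ℚ) • α - (2 * q - e * p : ℚ) • β with hf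
  have happly : ∀ x, B f x =
      (4 - e * e) * B γ x - (2 * p - e * q) * B α x - (2 * q - e * p) * B β x := fun x => by
    simp only [hf, map_sub, map_smul, LinearMap.sub_apply, LinearMap.smul_apply, smul_eq_mul]
  have hfα : B f α = 0 := by rw [happly, hγα, hα, hβα]; ring
  have hfβ : B f β = 0 := by rw [happly, hγβ, he, hβ]; ring
  have hfγ : B f γ = 0 := h f hfα hfβ
  have hf0 : f = 0 := by
    by_contra hne
    have hff := hpos f hne
    rw [hf, map_sub, map_sub, map_smul, map_smul, map_smul, ← hf, hfα, hfβ, hfγ] at hff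
    simp at hff
  have hnorm : (4 - e * e : ℚ) = p * p + q * q - e * p * q := by
    rw [happly, hγ, hp, hq] at hfγ
    refine mul_left_cancel₀ (mul_pos two_pos hr).ne' ?_
    linarith
  obtain ⟨hee, ⟨hpe, hq1⟩ | ⟨hpe, hq1⟩⟩ :=
    reflection_coeffs_of_norm_eq he₁ hp₁ hq₁ (by exact_mod_cast hnorm)
  all_goals
    have hee' : (e : ℚ) * e = 1 := by exact_mod_cast hee
    rw [hf, hee', hpe, hq1] at hf0
    push_cast at hf0
  · left
    have hcoeff : (2 - (e : ℚ) * -e) = 3 := by linarith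
    have hthree : (3 : ℚ) • (γ - (β - (e : ℚ) • α)) = 0 := by
      rw [← hf0, mul_one, mul_one, hcoeff]
      module
    exact sub_eq_zero.mp ((smul_eq_zero.mp hthree).resolve_left three_ne_zero)
  · right
    have hcoeff : (2 * -1 - (e : ℚ) * e) = -3 := by linarith
    have hthree : (3 : ℚ) • (γ - -(β - (e : ℚ) • α)) = 0 := by
      rw [← hf0, hcoeff]
      module
    exact sub_eq_zero.mp ((smul_eq_zero.mp hthree).resolve_left three_ne_zero)

end SimplyLaced

theorem pairing_self_pos (hx : x ∈ oddSpace n) (h0 : x ≠ 0) : 0 < pairing n x x := by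
  rw [pairing_apply]
  refine (Finset.sum_nonneg fun k _ => mul_self_nonneg (x k)).lt_of_ne fun h => h0 ?_
  rw [eq_comm, Finset.sum_eq_zero_iff_of_nonneg fun k _ => mul_self_nonneg (x k)] at h
  exact eq_zero_of_mem_oddSpace hx fun k hk hkn => mul_self_eq_zero.mp
    (h k (mem_Icc_neg_iff_abs_le.mpr (by rwa [abs_of_pos (by omega)])))

/-- The standard scalar product on `oddSpace n`, for which all roots have the same norm `4`. -/
def oddForm (n : ℕ) : LinearMap.BilinForm ℚ (oddSpace n) :=
  (pairing n).restrict (oddSpace n)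

theorem oddForm_isSymm (n : ℕ) : (oddForm n).IsSymm :=
  ⟨fun x y => pairing_comm x.1 y.1⟩

theorem oddForm_self_pos (x : oddSpace n) (hx : x ≠ 0) : 0 < oddForm n x x :=
  pairing_self_pos x.2 fun h => hx (Subtype.ext h)

namespace IsRoot

/-- The root `e_a - e_b` as an element of the reflection representation. -/
def toOddSpace (h : IsRoot n a b) : oddSpace n :=
  ⟨unitVec a - unitVec b, h.sub_unitVec_mem_oddSpace⟩

theorem oddForm_toOddSpace (h : IsRoot n a b) (x : oddSpace n) :
    oddForm n x h.toOddSpace = (x.1 a - x.1 b) * 2 := by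
  rw [mul_comm]
  exact h.pairing_sub_unitVec x.2

theorem oddForm_toOddSpace_self (h : IsRoot n a b) :
    oddForm n h.toOddSpace h.toOddSpace = 2 * 2 := by
  rw [oddForm_toOddSpace]
  change ((unitVec a - unitVec b) a - (unitVec a - unitVec b) b) * 2 = 2 * 2
  rw [h.sub_unitVec_apply_left, h.sub_unitVec_apply_right]
  norm_num

theorem exists_oddForm_eq_intCast (h : IsRoot n a b) (x : oddSpace n)
    (hx : ∀ i, ∃ m : ℤ, x.1 i = m) : ∃ m : ℤ, oddForm n x h.toOddSpace = m * 2 := by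
  obtain ⟨p, hp⟩ := hx a
  obtain ⟨q, hq⟩ := hx b
  exact ⟨p - q, by rw [oddForm_toOddSpace, hp, hq, Int.cast_sub]⟩

theorem exists_toOddSpace_apply_eq_intCast (h : IsRoot n a b) (i : ℤ) :
    ∃ m : ℤ, h.toOddSpace.1 i = m := by
  refine ⟨(if i = a then 1 else 0) - (if i = -a then 1 else 0) -
    ((if i = b then 1 else 0) - (if i = -b then 1 else 0)), ?_⟩
  push_cast
  rw [← unitVec_apply, ← unitVec_apply]
  rfl

theorem apply_paired_toOddSpace (h : IsRoot n a b) (x : oddSpace n) (k : ℤ) :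
    x.1 (paired a b k) = x.1 k - oddForm n x h.toOddSpace / 2 * h.toOddSpace.1 k := by
  rw [h.apply_paired x.2, oddForm_toOddSpace, toOddSpace]
  ring

theorem paired_eq_of_toOddSpace_eq (h : IsRoot n a b) (h' : IsRoot n c d)
    (heq : h.toOddSpace = h'.toOddSpace ∨ h.toOddSpace = -h'.toOddSpace) :
    paired a b = paired c d := by
  rw [← h'.inv_paired, ← mul_eq_one_iff_eq_inv]
  refine eq_one_of_oddSpace_le_fixedSpace (mul_mem h.mem_W h'.mem_W) fun x hx => ⟨hx, fun k => ?_⟩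
  have hsame : ∀ k, x (paired a b k) = x (paired c d k) := fun k => by
    refine (h.apply_paired_toOddSpace ⟨x, hx⟩ k).trans
      (.trans ?_ (h'.apply_paired_toOddSpace ⟨x, hx⟩ k).symm)
    rcases heq with e | e <;> simp [e, neg_div]
  rw [Equiv.Perm.mul_apply, hsame, ← Equiv.Perm.mul_apply, h'.paired_mul_self, Equiv.Perm.one_apply]

theorem abs_le_one_of_oddForm_eq (h : IsRoot n a b) (h' : IsRoot n c d) {m : ℤ}
    (hm : oddForm n h.toOddSpace h'.toOddSpace = m * 2) (hne : paired a b ≠ paired c d) :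
    |m| ≤ 1 :=
  abs_le_one_of_form_self_eq (oddForm_isSymm n) oddForm_self_pos two_pos h.oddForm_toOddSpace_self
    h'.oddForm_toOddSpace_self hm (fun e => hne (h.paired_eq_of_toOddSpace_eq h' (.inl e)))
    fun e => hne (h.paired_eq_of_toOddSpace_eq h' (.inr e))

theorem toOddSpace_map_paired (h : IsRoot n a b) (h' : IsRoot n c d) {m : ℤ}
    (hm : oddForm n h.toOddSpace h'.toOddSpace = m * 2) :
    (h'.map (isSigned_of_mem h.mem_W)).toOddSpace = h'.toOddSpace - (m : ℚ) • h.toOddSpace := by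
  have hm' := ((oddForm_isSymm n).eq h.toOddSpace h'.toOddSpace).symm.trans hm
  have hsigned := (isSigned_of_mem h.mem_W).1
  ext k
  have hk := h.apply_paired_toOddSpace h'.toOddSpace k
  rw [hm', mul_div_cancel_right₀ _ two_ne_zero, ← h.inv_paired] at hk
  change unitVec (paired a b c) k - unitVec (paired a b d) k = _
  rw [← unitVec_inv_apply hsigned, ← unitVec_inv_apply hsigned]
  exact hk

end IsRoot

theorem eq_conj_of_fixedSpace_inf_le {s t u : Equiv.Perm ℤ} (hs : s ∈ refl n) (ht : t ∈ refl n)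
    (hu : u ∈ refl n) (hst : s ≠ t) (hsu : s ≠ u) (htu : t ≠ u)
    (h : fixedSpace n s ⊓ fixedSpace n t ≤ fixedSpace n u) : u = s * t * s := by
  replace ⟨a, b, hs, hs_eq⟩ := exists_isRoot_of_mem_refl hs
  replace ⟨c, d, ht, ht_eq⟩ := exists_isRoot_of_mem_refl ht
  replace ⟨i, j, hu, hu_eq⟩ := exists_isRoot_of_mem_refl hu
  subst hs_eq ht_eq hu_eq
  obtain ⟨e, he⟩ := ht.exists_oddForm_eq_intCast _ hs.exists_toOddSpace_apply_eq_intCast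
  obtain ⟨p, hp⟩ := hu.exists_oddForm_eq_intCast _ hs.exists_toOddSpace_apply_eq_intCast
  obtain ⟨q, hq⟩ := hu.exists_oddForm_eq_intCast _ ht.exists_toOddSpace_apply_eq_intCast
  have hspan : ∀ x : oddSpace n, oddForm n x hs.toOddSpace = 0 → oddForm n x ht.toOddSpace = 0 →
      oddForm n x hu.toOddSpace = 0 := fun x hxs hxt => by
    rw [IsRoot.oddForm_toOddSpace, mul_eq_zero_iff_right two_ne_zero, sub_eq_zero] at *
    exact (hu.mem_fixedSpace_iff x.2).mp
      (h ⟨(hs.mem_fixedSpace_iff x.2).mpr hxs, (ht.mem_fixedSpace_iff x.2).mpr hxt⟩)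
  have hreflection := eq_reflection_or_eq_neg_reflection (oddForm_isSymm n) oddForm_self_pos two_pos
    hs.oddForm_toOddSpace_self ht.oddForm_toOddSpace_self hu.oddForm_toOddSpace_self he hp hq
    (hs.abs_le_one_of_oddForm_eq ht he hst) (hs.abs_le_one_of_oddForm_eq hu hp hsu)
    (ht.abs_le_one_of_oddForm_eq hu hq htu) hspan
  rw [← hs.toOddSpace_map_paired ht he] at hreflection
  rw [hu.paired_eq_of_toOddSpace_eq _ hreflection, ← conj_paired _ (isSigned_of_mem hs.mem_W).1,
    hs.inv_paired]

theorem inv_eq_of_mem_refl (hs : s ∈ refl n) : s⁻¹ = s := by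
  obtain ⟨a, b, hab, rfl⟩ := exists_isRoot_of_mem_refl hs
  exact hab.inv_paired

theorem fixedSpace_mul_cox_le_iff (hn : 2 ≤ n) (hs : s ∈ refl n) (ht : t ∈ refl n) :
    fixedSpace n (s * cox n) ≤ fixedSpace n t ↔
      absLength n (t * (s * cox n)) + 2 = absLength n (cox n) := by
  replace ⟨a, b, hs, hs_eq⟩ := exists_isRoot_of_mem_refl hs
  replace ⟨c, d, ht, ht_eq⟩ := exists_isRoot_of_mem_refl ht
  subst hs_eq ht_eq
  have hlength := hs.absLength_eq_paired_mul_add_one (hs.absLE_cox hn)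
  have hiff := ht.absLE_iff (mul_mem hs.mem_W (cox_mem hn))
  rw [AbsLE, ht.inv_paired, ht.absLength_paired] at hiff
  have hle : fixedSpace n (paired a b * cox n) ≤ fixedSpace n (paired c d) ↔
      ∀ x ∈ fixedSpace n (paired a b * cox n), x c = x d :=
    forall₂_congr fun x hx => ht.mem_fixedSpace_iff hx.1
  rw [hle, ← hiff]
  omega

/-! ### Elements of rank two -/

/-- Two non-crossing partitions are *compatible* if they have a common upper bound of rank two. -/
def Comp (s t : NC n) : Prop := ∃ w : NC n, rk w = 2 ∧ s ≤ w ∧ t ≤ w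

/-- A *triangle*: three distinct atoms with a common upper bound of rank two. -/
structure Tri (s t u : NC n) : Prop where
  rk_left : rk s = 1
  rk_mid : rk t = 1
  rk_right : rk u = 1
  left_ne_mid : s ≠ t
  left_ne_right : s ≠ u
  mid_ne_right : t ≠ u
  exists_le : ∃ w : NC n, rk w = 2 ∧ s ≤ w ∧ t ≤ w ∧ u ≤ w

section Compatible

variable {s t u w : NC n}

theorem Comp.symm : Comp s t → Comp t s
  | ⟨w, hw, hs, ht⟩ => ⟨w, hw, ht, hs⟩

theorem Tri.swap₁₂ (h : Tri s t u) : Tri t s u where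
  rk_left := h.rk_mid
  rk_mid := h.rk_left
  rk_right := h.rk_right
  left_ne_mid := h.left_ne_mid.symm
  left_ne_right := h.mid_ne_right
  mid_ne_right := h.left_ne_right
  exists_le := let ⟨w, hw, hs, ht, hu⟩ := h.exists_le; ⟨w, hw, ht, hs, hu⟩

theorem Tri.swap₂₃ (h : Tri s t u) : Tri s u t where
  rk_left := h.rk_left
  rk_mid := h.rk_right
  rk_right := h.rk_mid
  left_ne_mid := h.left_ne_right
  left_ne_right := h.left_ne_mid
  mid_ne_right := h.mid_ne_right.symm
  exists_le := let ⟨w, hw, hs, ht, hu⟩ := h.exists_le; ⟨w, hw, hs, hu, ht⟩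

theorem Comp.map (hn : 2 ≤ n) (ψ : NC n ≃o NC n) : Comp s t → Comp (ψ s) (ψ t)
  | ⟨w, hw, hs, ht⟩ => ⟨ψ w, (rk_apply hn ψ w).trans hw, ψ.monotone hs, ψ.monotone ht⟩

theorem comp_map_iff (hn : 2 ≤ n) (ψ : NC n ≃o NC n) : Comp (ψ s) (ψ t) ↔ Comp s t :=
  ⟨fun h => by simpa using h.map hn ψ.symm, fun h => h.map hn ψ⟩

theorem Tri.map (hn : 2 ≤ n) (ψ : NC n ≃o NC n) (h : Tri s t u) : Tri (ψ s) (ψ t) (ψ u) where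
  rk_left := (rk_apply hn ψ s).trans h.rk_left
  rk_mid := (rk_apply hn ψ t).trans h.rk_mid
  rk_right := (rk_apply hn ψ u).trans h.rk_right
  left_ne_mid := ψ.injective.ne h.left_ne_mid
  left_ne_right := ψ.injective.ne h.left_ne_right
  mid_ne_right := ψ.injective.ne h.mid_ne_right
  exists_le :=
    let ⟨w, hw, hs, ht, hu⟩ := h.exists_le
    ⟨ψ w, (rk_apply hn ψ w).trans hw, ψ.monotone hs, ψ.monotone ht, ψ.monotone hu⟩

theorem fixedSpace_inf_le_of_le (hn : 2 ≤ n) (hs : rk s = 1) (ht : rk t = 1) (hst : s ≠ t)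
    (hw : rk w = 2) (hsw : s ≤ w) (htw : t ≤ w) :
    fixedSpace n s.1 ⊓ fixedSpace n t.1 ≤ fixedSpace n w.1 := by
  have hs' := rk_add_finrank_fixedSpace s
  have ht' := rk_add_finrank_fixedSpace t
  have hw' := rk_add_finrank_fixedSpace w
  have hle : fixedSpace n w.1 ≤ fixedSpace n s.1 ⊓ fixedSpace n t.1 :=
    le_inf (fixedSpace_antitone hsw) (fixedSpace_antitone htw)
  refine (Submodule.eq_of_le_of_finrank_le hle ?_).ge
  by_contra hlt
  have hinf_left := Submodule.eq_of_le_of_finrank_le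
    (inf_le_left : fixedSpace n s.1 ⊓ fixedSpace n t.1 ≤ _) (by omega)
  have hinf_right := Submodule.eq_of_le_of_finrank_le
    (inf_le_right : fixedSpace n s.1 ⊓ fixedSpace n t.1 ≤ _) (by omega)
  exact hst (NC.ext_fixedSpace hn (hinf_left.symm.trans hinf_right))

theorem Tri.eq (hn : 2 ≤ n) (h : Tri s t u) : u.1 = s.1 * t.1 * s.1 := by
  obtain ⟨w, hw, hsw, htw, huw⟩ := h.exists_le
  have hle := fixedSpace_inf_le_of_le hn h.rk_left h.rk_mid h.left_ne_mid hw hsw htw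
  exact eq_conj_of_fixedSpace_inf_le (mem_refl_of_rk_eq_one h.rk_left)
    (mem_refl_of_rk_eq_one h.rk_mid) (mem_refl_of_rk_eq_one h.rk_right)
    (Subtype.coe_injective.ne h.left_ne_mid) (Subtype.coe_injective.ne h.left_ne_right)
    (Subtype.coe_injective.ne h.mid_ne_right) (hle.trans (fixedSpace_antitone huw))

theorem Comp.tri (h : Comp s t) (hs : rk s = 1) (ht : rk t = 1) (hu : rk u = 1) (hst : s ≠ t)
    (hsu : s ≠ u) (htu : t ≠ u) (hf : fixedSpace n s.1 ⊓ fixedSpace n t.1 ≤ fixedSpace n u.1) :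
    Tri s t u := by
  obtain ⟨w, hw, hsw, htw⟩ := h
  refine ⟨hs, ht, hu, hst, hsu, htu, w, hw, hsw, htw, (le_iff_fixedSpace_le hu).mpr ?_⟩
  exact (le_inf (fixedSpace_antitone hsw) (fixedSpace_antitone htw)).trans hf

theorem comp_of_fixedSpace_mul_cox_le (hn : 2 ≤ n) (hs : rk s = 1) (ht : rk t = 1)
    (h : fixedSpace n (s.1 * cox n) ≤ fixedSpace n t.1) : Comp s t := by
  have hs' := mem_refl_of_rk_eq_one hs
  have ht' := mem_refl_of_rk_eq_one ht
  rw [fixedSpace_mul_cox_le_iff hn hs' ht'] at h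
  have hst := mul_mem s.2.1 t.2.1
  have hinv : (s.1 * t.1)⁻¹ * cox n = t.1 * (s.1 * cox n) := by
    rw [mul_inv_rev, inv_eq_of_mem_refl hs', inv_eq_of_mem_refl ht', mul_assoc]
  have hle : absLength n (s.1 * t.1) ≤ rk s + rk t := wordLength_mul_le refl_inv s.2.1 t.2.1
  have hge : absLength n (cox n) ≤ absLength n (s.1 * t.1) + absLength n (t.1 * (s.1 * cox n)) := by
    rw [← hinv]
    conv_lhs => rw [← mul_inv_cancel_left (s.1 * t.1) (cox n)]
    exact wordLength_mul_le refl_inv hst (mul_mem (inv_mem hst) (cox_mem hn))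
  have hlength : absLength n (s.1 * t.1) = 2 := by omega
  let w : NC n := ⟨s.1 * t.1, hst, by rw [AbsLE, hinv, hlength]; omega⟩
  have hsw : s ≤ w := by
    change absLength n (s.1 * t.1) = rk s + absLength n (s.1⁻¹ * (s.1 * t.1))
    rw [inv_mul_cancel_left, hlength, hs]
    exact congrArg (1 + ·) ht.symm
  refine ⟨w, hlength, hsw, (le_iff_fixedSpace_le ht).mpr fun x hx => ⟨hx.1, fun k => ?_⟩⟩
  rw [← (fixedSpace_antitone hsw hx).2]
  exact hx.2 k

theorem eq_mul_or_eq_mul_of_rk_eq_two (hn : 2 ≤ n) (hs : rk s = 1) (ht : rk t = 1) (hst : s ≠ t)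
    (hw : rk w = 2) (hsw : s ≤ w) (htw : t ≤ w) : w.1 = s.1 * t.1 ∨ w.1 = t.1 * s.1 := by
  have hs' := mem_refl_of_rk_eq_one hs
  have hss : s.1 * s.1 = 1 := inv_eq_iff_mul_eq_one.mp (inv_eq_of_mem_refl hs')
  obtain ⟨u, hu⟩ : ∃ u, u = s.1⁻¹ * w.1 := ⟨_, rfl⟩
  have hwu : w.1 = s.1 * u := by rw [hu, mul_inv_cancel_left]
  have hu_refl : u ∈ refl n := by
    have hlength : rk w = rk s + absLength n (s.1⁻¹ * w.1) := hsw
    rw [hu]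
    exact mem_refl_of_absLength_eq_one (mul_mem (inv_mem s.2.1) w.2.1) (by omega)
  by_cases htu : t.1 = u
  · exact .inl (htu ▸ hwu)
  right
  have hsu : s.1 ≠ u := fun e => by
    rw [rk, hwu, ← e, hss, absLength, wordLength_one] at hw
    omega
  have hle : fixedSpace n s.1 ⊓ fixedSpace n t.1 ≤ fixedSpace n u := fun x hx => by
    have hxw := (fixedSpace_inf_le_of_le hn hs ht hst hw hsw htw hx).2
    refine ⟨hx.1.1, fun k => ?_⟩
    rw [← hxw k, hwu, Equiv.Perm.mul_apply, hx.1.2]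
  rw [hwu, eq_conj_of_fixedSpace_inf_le hs' (mem_refl_of_rk_eq_one ht) hu_refl
    (Subtype.coe_injective.ne hst) hsu htu hle, mul_assoc, ← mul_assoc, hss, one_mul]

theorem comp_iff (hn : 2 ≤ n) (hs : rk s = 1) (ht : rk t = 1) (hst : s ≠ t) :
    Comp s t ↔ fixedSpace n (s.1 * cox n) ≤ fixedSpace n t.1 ∨
      fixedSpace n (t.1 * cox n) ≤ fixedSpace n s.1 := by
  refine ⟨fun ⟨w, hw, hsw, htw⟩ => ?_, fun h => h.elim (comp_of_fixedSpace_mul_cox_le hn hs ht)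
    fun h => (comp_of_fixedSpace_mul_cox_le hn ht hs h).symm⟩
  have hs' := mem_refl_of_rk_eq_one hs
  have ht' := mem_refl_of_rk_eq_one ht
  have hwc : absLength n (cox n) = rk w + absLength n (w.1⁻¹ * cox n) := w.2.2
  refine (eq_mul_or_eq_mul_of_rk_eq_two hn hs ht hst hw hsw htw).imp (fun e => ?_) fun e => ?_
  · rw [fixedSpace_mul_cox_le_iff hn hs' ht', ← mul_assoc, hwc, e, mul_inv_rev,
      inv_eq_of_mem_refl hs', inv_eq_of_mem_refl ht', hw, add_comm]
  · rw [fixedSpace_mul_cox_le_iff hn ht' hs', ← mul_assoc, hwc, e, mul_inv_rev,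
      inv_eq_of_mem_refl hs', inv_eq_of_mem_refl ht', hw, add_comm]

end Compatible

end Triangles

section Chords

variable {n : ℕ} {a b c d i j k l p q : ℤ} {s t u : NC n} {x : ℤ → ℚ}

/-! ### Chords and spokes -/

/-- `s` is the chord `((pᵢ pⱼ))`, where `pₖ = pos n k`. -/
structure IsChord (s : NC n) (i j : ℤ) : Prop where
  lt : i < j
  lt_add : j < i + ((n : ℤ) - 1)
  coe_eq : s.1 = paired (pos n i) (pos n j)

/-- `s` is the spoke `((pᵢ n))`, where `pᵢ = pos n i`. -/
def IsSpoke (s : NC n) (i : ℤ) : Prop := s.1 = paired (pos n i) n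

theorem IsRoot.paired_inj (h : IsRoot n a b) (h' : IsRoot n c d) (e : paired a b = paired c d) :
    (a = c ∧ b = d) ∨ (a = d ∧ b = c) ∨ (a = -c ∧ b = -d) ∨ (a = -d ∧ b = -c) := by
  have hb : paired c d a = b := by rw [← e, h.paired_apply_left]
  rw [h'.paired_apply] at hb
  obtain ⟨_, _, -, -, _, _⟩ := h
  split_ifs at hb <;> omega

theorem IsRoot.paired_apply_of_ne (h : IsRoot n a b) (ha : k ≠ a) (hb : k ≠ b) (ha' : k ≠ -a)
    (hb' : k ≠ -b) : paired a b k = k := by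
  rw [h.paired_apply, if_neg ha, if_neg hb, if_neg ha', if_neg hb']

theorem IsRoot.paired_neg_left (h : IsRoot n a b) : paired (-a) b = paired a (-b) := by
  rw [← paired_neg a (-b) h.left_ne_zero (neg_ne_zero.mpr h.right_ne_zero) h.ne_neg
    (by rw [neg_neg]; exact h.ne), neg_neg]

theorem IsRoot.paired_eq_of_apply_ne (h : IsRoot n a b) (hp : paired a b p ≠ p)
    (hq : paired a b q ≠ q) (hpq : p ≠ q) (hpq' : p ≠ -q) :
    paired a b = paired p q ∨ paired a b = paired p (-q) := by
  have hneg := paired_neg a b h.left_ne_zero h.right_ne_zero h.ne h.ne_neg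
  have hmoved : ∀ {k}, paired a b k ≠ k → k = a ∨ k = b ∨ k = -a ∨ k = -b := fun hk => by
    by_contra! hne
    exact hk (h.paired_apply_of_ne hne.1 hne.2.1 hne.2.2.1 hne.2.2.2)
  rcases hmoved hp with rfl | rfl | rfl | rfl <;> rcases hmoved hq with rfl | rfl | rfl | rfl <;>
    simp_all [paired_comm]

theorem eq_of_pos_eq (hn : 2 ≤ n) (h : pos n j = pos n k) (hjk : j < k + 2 * ((n : ℤ) - 1))
    (hkj : k < j + 2 * ((n : ℤ) - 1)) : j = k := by
  by_contra hne
  rcases lt_or_gt_of_ne hne with hlt | hlt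
  · exact pos_ne hn hlt hkj h
  · exact pos_ne hn hlt hjk h.symm

theorem apply_pos_add_pred (hn : 2 ≤ n) (hx : x ∈ oddSpace n) (k : ℤ) :
    x (pos n (k + ((n : ℤ) - 1))) = -x (pos n k) := by
  rw [pos_add_pred hn, hx.1]

theorem exists_isChord (hn : 2 ≤ n) (hij : i < j) (hji : j < i + ((n : ℤ) - 1)) :
    ∃ s : NC n, IsChord s i j :=
  have h := isRoot_pos hn hij hji
  ⟨⟨_, h.mem_W, h.absLE_cox hn⟩, hij, hji, rfl⟩

theorem exists_isSpoke (hn : 2 ≤ n) (i : ℤ) : ∃ s : NC n, IsSpoke s i :=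
  have h := isRoot_pos_last hn i
  ⟨⟨_, h.mem_W, h.absLE_cox hn⟩, rfl⟩

theorem exists_isChord_or_exists_isSpoke (hn : 2 ≤ n) (hs : rk s = 1) :
    (∃ i j, IsChord s i j) ∨ ∃ i, IsSpoke s i := by
  rcases chord_or_spoke_of_mem_refl hn (mem_refl_of_rk_eq_one hs) with ⟨i, j, hij, hji, h⟩ | ⟨i, h⟩
  · exact .inl ⟨i, j, hij, hji, h⟩
  · exact .inr ⟨i, h⟩

namespace IsChord

theorem isRoot (h : IsChord s i j) (hn : 2 ≤ n) : IsRoot n (pos n i) (pos n j) :=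
  isRoot_pos hn h.lt h.lt_add

theorem rk_eq_one (h : IsChord s i j) (hn : 2 ≤ n) : rk s = 1 :=
  (h.isRoot hn).rk_eq_one h.coe_eq

theorem eq (h : IsChord s i j) (h' : IsChord t i j) : s = t :=
  Subtype.ext (h.coe_eq.trans h'.coe_eq.symm)

theorem mem_fixedSpace_iff (h : IsChord s i j) (hn : 2 ≤ n) (hx : x ∈ oddSpace n) :
    x ∈ fixedSpace n s.1 ↔ x (pos n i) = x (pos n j) := by
  rw [h.coe_eq, (h.isRoot hn).mem_fixedSpace_iff hx]

theorem add_pred_iff (hn : 2 ≤ n) :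
    IsChord s (i + ((n : ℤ) - 1)) (j + ((n : ℤ) - 1)) ↔ IsChord s i j := by
  have hneg : i < j → j < i + ((n : ℤ) - 1) →
      paired (pos n (i + ((n : ℤ) - 1))) (pos n (j + ((n : ℤ) - 1))) =
        paired (pos n i) (pos n j) := fun hij hji => by
    obtain ⟨hi, hj, -, -, hne, hne'⟩ := isRoot_pos hn hij hji
    rw [pos_add_pred hn, pos_add_pred hn, paired_neg _ _ hi hj hne hne']
  constructor
  · rintro ⟨hij, hji, hs⟩
    exact ⟨by omega, by omega, by rw [hs, hneg (by omega) (by omega)]⟩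
  · rintro ⟨hij, hji, hs⟩
    exact ⟨by omega, by omega, by rw [hs, hneg (by omega) (by omega)]⟩

theorem add_mul_pred (h : IsChord s i j) (hn : 2 ≤ n) (m : ℤ) :
    IsChord s (i + m * ((n : ℤ) - 1)) (j + m * ((n : ℤ) - 1)) := by
  induction m with
  | zero => simpa using h
  | succ m ih =>
    rw [← add_pred_iff hn] at ih
    convert ih using 1 <;> ring
  | pred m ih =>
    rw [← add_pred_iff hn]
    convert ih using 1 <;> ring

theorem exists_mem_window (h : IsChord s k l) (hn : 2 ≤ n) (i : ℤ) :
    ∃ k' l', i ≤ k' ∧ k' < i + ((n : ℤ) - 1) ∧ l' - k' = l - k ∧ IsChord s k' l' := by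
  have hnonneg := Int.emod_nonneg (k - i) (b := (n : ℤ) - 1) (by omega)
  have hlt := Int.emod_lt_of_pos (k - i) (b := (n : ℤ) - 1) (by omega)
  have hdiv := Int.emod_add_ediv_mul (k - i) ((n : ℤ) - 1)
  refine ⟨_, _, ?_, ?_, ?_, h.add_mul_pred hn (-((k - i) / ((n : ℤ) - 1)))⟩
  · rw [neg_mul]
    omega
  · rw [neg_mul]
    omega
  · ring

theorem index_unique (h : IsChord s i j) (h' : IsChord s k l) (hn : 2 ≤ n) (hik : i ≤ k)
    (hki : k < i + ((n : ℤ) - 1)) : k = i ∧ l = j := by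
  obtain ⟨hij, hji, hs⟩ := id h
  obtain ⟨hkl, hlk, hs'⟩ := id h'
  rcases (h.isRoot hn).paired_inj (h'.isRoot hn) (hs.symm.trans hs') with
    ⟨hik', hjl⟩ | ⟨hil, hjk⟩ | ⟨hik', -⟩ | ⟨-, hjk⟩
  · have hik'' := eq_of_pos_eq hn hik' (by omega) (by omega)
    exact ⟨hik''.symm, (eq_of_pos_eq hn hjl (by omega) (by omega)).symm⟩
  · have hjk' := eq_of_pos_eq hn hjk (by omega) (by omega)
    have hil' := eq_of_pos_eq hn hil (by omega) (by omega)
    omega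
  · exact absurd hik' (pos_ne_neg hn (by omega) (by omega))
  · exact absurd hjk (pos_ne_neg hn (by omega) (by omega))

end IsChord

namespace IsSpoke

theorem rk_eq_one (h : IsSpoke s i) (hn : 2 ≤ n) : rk s = 1 :=
  (isRoot_pos_last hn i).rk_eq_one h

theorem eq (h : IsSpoke s i) (h' : IsSpoke t i) : s = t :=
  Subtype.ext (h.trans h'.symm)

theorem mem_fixedSpace_iff (h : IsSpoke s i) (hn : 2 ≤ n) (hx : x ∈ oddSpace n) :
    x ∈ fixedSpace n s.1 ↔ x (pos n i) = x n := by
  rw [h, (isRoot_pos_last hn i).mem_fixedSpace_iff hx]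

theorem congr (h : IsSpoke s i) (hij : pos n i = pos n j) : IsSpoke s j := by
  rw [IsSpoke, ← hij]
  exact h

theorem pos_eq (h : IsSpoke s i) (h' : IsSpoke s j) (hn : 2 ≤ n) : pos n i = pos n j := by
  have hi := isRoot_pos_last hn i
  have hinj := hi.paired_inj (isRoot_pos_last hn j) (h.symm.trans h')
  obtain ⟨-, -, -, -, hne, hne'⟩ := hi
  omega

theorem exists_mem_window (h : IsSpoke s k) (hn : 2 ≤ n) (i : ℤ) :
    ∃ k', i ≤ k' ∧ k' < i + 2 * ((n : ℤ) - 1) ∧ IsSpoke s k' := by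
  obtain ⟨k', hik, hki, hk⟩ := exists_pos_eq hn i (pos_ne_zero hn k) (abs_pos_le hn k)
  exact ⟨k', hik, hki, h.congr hk.symm⟩

end IsSpoke

theorem IsChord.ne_of_isSpoke (h : IsChord s i j) (h' : IsSpoke t k) (hn : 2 ≤ n) : s ≠ t := by
  rintro rfl
  have hinj := (h.isRoot hn).paired_inj (isRoot_pos_last hn k) (h.coe_eq.symm.trans h')
  obtain ⟨-, -, -, -, hi, hi'⟩ := isRoot_pos_last hn i
  obtain ⟨-, -, -, -, hj, hj'⟩ := isRoot_pos_last hn j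
  omega

/-! ### Compatibility of chords and spokes -/

theorem IsChord.eq_smul_unitVec_of_side (h : IsChord s i (i + 1)) (hn : 2 ≤ n)
    (hx : x ∈ fixedSpace n (s.1 * cox n)) : x = x (pos n i) • unitVec (pos n i) := by
  have hi := isRoot_pos_last hn i
  rw [h.coe_eq] at hx
  rw [← sub_eq_zero]
  refine eq_zero_of_pos hn (sub_mem hx.1 (Submodule.smul_mem _ _
    (unitVec_mem_oddSpace hi.abs_left_le))) ?_ i fun j hij hji => ?_
  · rw [Pi.sub_apply, Pi.smul_apply, unitVec_of_ne hi.ne.symm (by have := hi.ne_neg; omega),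
      apply_last_eq_zero_of_mem_fixedSpace_chord hn h.lt h.lt_add hx, smul_zero, sub_zero]
  rw [Pi.sub_apply, Pi.smul_apply]
  rcases hij.eq_or_lt with rfl | hij
  · rw [unitVec_self hi.left_ne_zero, smul_eq_mul, mul_one, sub_self]
  · rw [unitVec_of_ne (pos_ne hn hij (by omega)).symm (pos_ne_neg hn (by omega) (by omega)),
      apply_pos_eq_zero_of_mem_fixedSpace_chord hn h.lt h.lt_add hx hij hji, smul_zero, sub_zero]

theorem IsChord.comp_of_apply_pos_eq (h : IsChord s i (i + 1)) (hn : 2 ≤ n) (ht : rk t = 1)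
    (hi : t.1 (pos n i) = pos n i) : Comp s t := by
  refine comp_of_fixedSpace_mul_cox_le hn (h.rk_eq_one hn) ht fun x hx => ⟨hx.1, fun k => ?_⟩
  have hinv : t.1⁻¹ (pos n i) = pos n i := Equiv.Perm.inv_eq_iff_eq.mpr hi.symm
  have hunit := unitVec_inv_apply (isSigned_of_mem t.2.1).inv.1 (pos n i) k
  rw [inv_inv, hinv] at hunit
  rw [h.eq_smul_unitVec_of_side hn hx, Pi.smul_apply, Pi.smul_apply, hunit]

theorem IsChord.comp_of_apply_pos_succ_eq (h : IsChord s i (i + 1)) (hn : 2 ≤ n) (ht : rk t = 1)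
    (hi : t.1 (pos n (i + 1)) = pos n (i + 1)) : Comp s t := by
  refine (comp_of_fixedSpace_mul_cox_le hn ht (h.rk_eq_one hn) fun x hx => ?_).symm
  have hfix := hx.2 (pos n i)
  rw [Equiv.Perm.mul_apply, cox_pos, hi] at hfix
  exact (h.mem_fixedSpace_iff hn hx.1).mpr hfix.symm

theorem IsChord.comp_of_side (h : IsChord s i (i + 1)) (hn : 3 ≤ n) (ht : rk t = 1) (hst : s ≠ t)
    (hne : ¬IsChord t (i + 1) (i + ((n : ℤ) - 1))) : Comp s t := by
  have hn' : 2 ≤ n := by omega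
  by_contra hcomp
  obtain ⟨a, b, hab, hab_eq⟩ := exists_isRoot_of_mem_refl (mem_refl_of_rk_eq_one ht)
  have hi := mt (h.comp_of_apply_pos_eq hn' ht) hcomp
  have hi' := mt (h.comp_of_apply_pos_succ_eq hn' ht) hcomp
  rw [hab_eq] at hi hi'
  have hroot := h.isRoot hn'
  rcases hab.paired_eq_of_apply_ne hi hi' hroot.ne hroot.ne_neg with e | e
  · exact hst (Subtype.ext (by rw [h.coe_eq, hab_eq, e]))
  · refine hne ⟨by omega, by omega, ?_⟩
    rw [hab_eq, e, pos_add_pred hn', ← hroot.paired_neg_left, paired_comm]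

/-- Two non-crossing partitions are *incompatible* if they are distinct and not compatible. -/
def Inc (s t : NC n) : Prop := s ≠ t ∧ ¬Comp s t

theorem Inc.symm (h : Inc s t) : Inc t s :=
  ⟨h.1.symm, fun h' => h.2 h'.symm⟩

theorem IsChord.inc_opposite (h : IsChord s i j) (h' : IsChord t j (i + ((n : ℤ) - 1)))
    (hn : 2 ≤ n) : Inc s t := by
  obtain ⟨hij, hji, hs⟩ := id h
  obtain ⟨hji', hij', ht⟩ := id h'
  have hst : s ≠ t := by
    rintro rfl
    have := h.index_unique h' hn hij.le hji
    omega
  refine ⟨hst, ?_⟩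
  rw [comp_iff hn (h.rk_eq_one hn) (h'.rk_eq_one hn) hst, hs, ht]
  rintro (hle | hle)
  · obtain ⟨x, hx, hx0⟩ := exists_mem_fixedSpace_chord hn hij hji
    have hxt := hle hx
    rw [← ht, h'.mem_fixedSpace_iff hn hx.1,
      apply_pos_eq_zero_of_mem_fixedSpace_chord hn hij hji hx le_rfl hji,
      apply_pos_add_pred hn hx.1, zero_eq_neg] at hxt
    exact hx0 hxt
  · obtain ⟨x, hx, hx0⟩ := exists_mem_fixedSpace_chord hn hji' hij'
    have hxs := hle hx
    have hzero := apply_pos_eq_zero_of_mem_fixedSpace_chord hn hji' hij' hx le_rfl hij'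
    rw [apply_pos_add_pred hn hx.1, neg_eq_zero] at hzero
    rw [← hs, h.mem_fixedSpace_iff hn hx.1, hzero] at hxs
    exact hx0 hxs.symm

theorem IsChord.inc_of_isSpoke (h : IsChord s i j) (h' : IsSpoke t k) (hn : 2 ≤ n) (hik : i < k)
    (hkj : k < j) : Inc s t := by
  obtain ⟨hij, hji, hs⟩ := id h
  refine ⟨h.ne_of_isSpoke h' hn, ?_⟩
  rw [comp_iff hn (h.rk_eq_one hn) (h'.rk_eq_one hn) (h.ne_of_isSpoke h' hn)]
  rintro (hle | hle)
  · obtain ⟨x, hx, hx0⟩ := exists_mem_fixedSpace_chord hn hij hji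
    have hxt := hle (hs ▸ hx)
    rw [h'.mem_fixedSpace_iff hn hx.1,
      apply_pos_eq_of_mem_fixedSpace_chord hn hij hji hx hik.le hkj,
      apply_last_eq_zero_of_mem_fixedSpace_chord hn hij hji hx] at hxt
    exact hx0 hxt
  · obtain ⟨x, hx, hx0⟩ := exists_mem_fixedSpace_spoke hn k
    have hxs := hle (h' ▸ hx)
    have hopp := apply_pos_eq_of_mem_fixedSpace_spoke hn hx (j := i + ((n : ℤ) - 1)) (by omega)
      (by omega)
    rw [apply_pos_add_pred hn hx.1] at hopp
    rw [h.mem_fixedSpace_iff hn hx.1,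
      apply_pos_eq_of_mem_fixedSpace_spoke hn hx hkj.le (by omega)] at hxs
    exact hx0 (by linarith)

theorem IsSpoke.comp_of_add_pred_le (h : IsSpoke s i) (h' : IsSpoke t j) (hn : 2 ≤ n)
    (hij : i + ((n : ℤ) - 1) ≤ j) (hji : j < i + 2 * ((n : ℤ) - 1)) : Comp s t := by
  refine comp_of_fixedSpace_mul_cox_le hn (h.rk_eq_one hn) (h'.rk_eq_one hn) fun x hx => ?_
  rw [h] at hx
  rw [h'.mem_fixedSpace_iff hn hx.1, ← sub_add_cancel j ((n : ℤ) - 1), apply_pos_add_pred hn hx.1,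
    apply_pos_eq_of_mem_fixedSpace_spoke hn hx (by omega) (by omega),
    apply_last_eq_neg_of_mem_fixedSpace_spoke hn hx]

theorem IsSpoke.comp (h : IsSpoke s i) (h' : IsSpoke t j) (hn : 2 ≤ n) (hst : s ≠ t) :
    Comp s t := by
  obtain ⟨j, hij, hji, h'⟩ := h'.exists_mem_window hn i
  have hne : j ≠ i := by
    rintro rfl
    exact hst (h.eq h')
  rcases lt_or_ge j (i + ((n : ℤ) - 1)) with hj | hj
  · exact (h'.comp_of_add_pred_le (h.congr (pos_periodic hn i).symm) hn (by omega)
      (by omega)).symm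
  · exact h.comp_of_add_pred_le h' hn hj hji

theorem IsChord.tri (hs : IsChord s i j) (ht : IsChord t j k) (hu : IsChord u i k) (hn : 2 ≤ n) :
    Tri s t u := by
  obtain ⟨hij, hji, hs_eq⟩ := id hs
  obtain ⟨hjk, -, -⟩ := id ht
  obtain ⟨-, hki, -⟩ := id hu
  refine Comp.tri ?_ (hs.rk_eq_one hn) (ht.rk_eq_one hn) (hu.rk_eq_one hn) ?_ ?_ ?_ ?_
  · refine comp_of_fixedSpace_mul_cox_le hn (hs.rk_eq_one hn) (ht.rk_eq_one hn) fun x hx => ?_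
    rw [hs_eq] at hx
    rw [ht.mem_fixedSpace_iff hn hx.1,
      apply_pos_eq_zero_of_mem_fixedSpace_chord hn hij hji hx le_rfl hji,
      apply_pos_eq_zero_of_mem_fixedSpace_chord hn hij hji hx hjk.le hki]
  · rintro rfl
    have := hs.index_unique ht hn hij.le hji
    omega
  · rintro rfl
    have := hs.index_unique hu hn le_rfl (by omega)
    omega
  · rintro rfl
    have := hu.index_unique ht hn hij.le hji
    omega
  · exact fun x hx => (hu.mem_fixedSpace_iff hn hx.1.1).mpr
      (((hs.mem_fixedSpace_iff hn hx.1.1).mp hx.1).trans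
        ((ht.mem_fixedSpace_iff hn hx.1.1).mp hx.2))

theorem IsSpoke.tri (hs : IsSpoke s i) (ht : IsSpoke t j) (hu : IsChord u i j) (hn : 2 ≤ n) :
    Tri s t u := by
  have hst : s ≠ t := by
    rintro rfl
    exact (hu.isRoot hn).ne (hs.pos_eq ht hn)
  exact (hs.comp ht hn hst).tri (hs.rk_eq_one hn) (ht.rk_eq_one hn) (hu.rk_eq_one hn) hst
    (hu.ne_of_isSpoke hs hn).symm (hu.ne_of_isSpoke ht hn).symm fun x hx =>
      (hu.mem_fixedSpace_iff hn hx.1.1).mpr (((hs.mem_fixedSpace_iff hn hx.1.1).mp hx.1).trans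
        ((ht.mem_fixedSpace_iff hn hx.1.1).mp hx.2).symm)

theorem Tri.isRoot_and_coe_eq_of_isSpoke (h : Tri s t u) (hs : IsSpoke s i) (ht : IsSpoke t j)
    (hn : 2 ≤ n) : IsRoot n (pos n i) (pos n j) ∧ u.1 = paired (pos n i) (pos n j) := by
  have hi := isRoot_pos_last hn i
  have hj := isRoot_pos_last hn j
  have hu : u.1 = paired (paired (pos n i) n (pos n j)) (pos n i) := by
    have hconj := conj_paired (paired (pos n i) n) (isSigned_of_mem hi.mem_W).1 (pos n j) n
    rw [hi.inv_paired, hi.paired_apply_right] at hconj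
    rw [h.eq hn, hs, ht, hconj]
  have hne : pos n j ≠ pos n i := fun e => h.left_ne_mid (hs.eq (ht.congr e))
  have hne' : pos n j ≠ -pos n i := fun e => by
    refine h.mid_ne_right (Subtype.ext ?_)
    have hlast : paired (pos n i) n (pos n j) = -n := by
      rw [e, (isSigned_of_mem hi.mem_W).1, hi.paired_apply_left]
    rw [hu, hlast, ht, e, hi.paired_neg_left, paired_comm]
  refine ⟨⟨hi.1, hj.1, hi.3, hj.3, hne.symm, by omega⟩, ?_⟩
  rw [hu, hi.paired_apply_of_ne hne hj.ne hne' hj.ne_neg, paired_comm]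

theorem Tri.isChord_or_isChord_of_isSpoke (h : Tri s t u) (hs : IsSpoke s i)
    (ht : IsChord t k (k + 1)) (hn : 2 ≤ n) : IsChord t i (i + 1) ∨ IsChord t (i - 1) i := by
  obtain ⟨k, l, hik, hki, hl, ht⟩ := ht.exists_mem_window hn i
  obtain rfl : l = k + 1 := by omega
  rcases hik.eq_or_lt with rfl | hik
  · exact .inl ht
  rcases (show k + 1 ≤ i + ((n : ℤ) - 1) by omega).eq_or_lt with hki' | hki'
  · right
    convert ht.add_mul_pred hn (-1) using 1 <;> omega
  exfalso
  have hi := isRoot_pos_last hn i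
  have hfix : ∀ j, i < j → j < i + ((n : ℤ) - 1) → paired (pos n i) n (pos n j) = pos n j :=
    fun j hij hji =>
      have hj := isRoot_pos_last hn j
      hi.paired_apply_of_ne (pos_ne hn hij (by omega)).symm hj.ne
        (pos_ne_neg hn (by omega) (by omega)) hj.ne_neg
  have hconj := conj_paired (paired (pos n i) n) (isSigned_of_mem hi.mem_W).1 (pos n k)
    (pos n (k + 1))
  rw [hi.inv_paired, hfix _ hik hki, hfix _ (by omega) hki', ← ht.coe_eq, ← hs, ← h.eq hn] at hconj
  exact h.mid_ne_right (Subtype.ext hconj.symm)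

theorem Tri.pos_eq_of_isSpoke (h : Tri s t u) (hs : IsSpoke s i) (ht : IsSpoke t j)
    (hu : IsChord u k (k + 1)) (hn : 2 ≤ n) :
    pos n j = pos n (i + 1) ∨ pos n j = pos n (i - 1) := by
  obtain ⟨hroot, hu_eq⟩ := h.isRoot_and_coe_eq_of_isSpoke hs ht hn
  have hneg := (isSigned_cox hn).1
  have hinj := (cox n).injective
  have hi : pos n i = cox n (pos n (i - 1)) := by rw [cox_pos, sub_add_cancel]
  have hk := cox_pos n k
  rw [← cox_pos n i]
  rcases (hu.isRoot hn).paired_inj hroot (hu.coe_eq.symm.trans hu_eq) with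
    ⟨hki, hkj⟩ | ⟨hkj, hki⟩ | ⟨hki, hkj⟩ | ⟨hkj, hki⟩
  · left
    rw [← hki, hk, hkj]
  · right
    apply hinj
    rw [← hi, ← hki, ← hkj, hk]
  · left
    rw [show pos n i = -pos n k by omega, hneg, hk]
    omega
  · right
    apply hinj
    rw [← hi, show pos n j = -pos n k by omega, hneg, hk]
    omega

end Chords

section Spokes

variable {n : ℕ} {i j k l : ℤ} {s t u : NC n} {ψ : NC n ≃o NC n}

/-! ### Recognising spokes inside the poset -/

/-- Atoms with a unique incompatible atom. For `n ≠ 4` these are the sides, that is the chords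
joining neighbouring points. -/
def UniqueInc (s : NC n) : Prop := rk s = 1 ∧ ∃! t, rk t = 1 ∧ Inc s t

/-- Order-theoretic properties that, for `n ≠ 4`, single out the spokes among the atoms. -/
structure SpokeLike (s : NC n) : Prop where
  rk_eq_one : rk s = 1
  not_uniqueInc : ¬UniqueInc s
  comp_of_uniqueInc : ∀ t, UniqueInc t → Comp s t
  encard_le_two : {t | UniqueInc t ∧ ∃ u, Tri s t u}.encard ≤ 2

theorem inc_map_iff (hn : 2 ≤ n) (ψ : NC n ≃o NC n) : Inc (ψ s) (ψ t) ↔ Inc s t := by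
  rw [Inc, Inc, comp_map_iff hn, ψ.injective.ne_iff]

theorem UniqueInc.map (h : UniqueInc s) (hn : 2 ≤ n) (ψ : NC n ≃o NC n) : UniqueInc (ψ s) := by
  obtain ⟨hs, t, ⟨ht, hst⟩, huniq⟩ := h
  refine ⟨by rwa [rk_apply hn], ψ t, ⟨by rwa [rk_apply hn], (inc_map_iff hn ψ).mpr hst⟩, ?_⟩
  rintro u ⟨hu, hsu⟩
  rw [← huniq (ψ.symm u), ψ.apply_symm_apply]
  exact ⟨by rwa [rk_apply hn], by rwa [← inc_map_iff hn ψ, ψ.apply_symm_apply]⟩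

theorem uniqueInc_map_iff (hn : 2 ≤ n) (ψ : NC n ≃o NC n) : UniqueInc (ψ s) ↔ UniqueInc s :=
  ⟨fun h => by simpa using h.map hn ψ.symm, fun h => h.map hn ψ⟩

theorem SpokeLike.map (h : SpokeLike s) (hn : 2 ≤ n) (ψ : NC n ≃o NC n) : SpokeLike (ψ s) where
  rk_eq_one := by rw [rk_apply hn, h.rk_eq_one]
  not_uniqueInc := by rw [uniqueInc_map_iff hn]; exact h.not_uniqueInc
  comp_of_uniqueInc t ht := by
    rw [← ψ.apply_symm_apply t, comp_map_iff hn]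
    exact h.comp_of_uniqueInc _ (ht.map hn ψ.symm)
  encard_le_two := by
    rw [← ψ.symm.injective.encard_image]
    refine (Set.encard_le_encard ?_).trans h.encard_le_two
    rintro _ ⟨t, ⟨ht, u, hu⟩, rfl⟩
    exact ⟨ht.map hn ψ.symm, ψ.symm u, by simpa using hu.map hn ψ.symm⟩

theorem IsChord.uniqueInc (h : IsChord s i (i + 1)) (hn : 3 ≤ n) : UniqueInc s := by
  have hn' : 2 ≤ n := by omega
  obtain ⟨t, ht⟩ :=
    exists_isChord hn' (i := i + 1) (j := i + ((n : ℤ) - 1)) (by omega) (by omega)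
  refine ⟨h.rk_eq_one hn', t, ⟨ht.rk_eq_one hn', h.inc_opposite ht hn'⟩, fun u ⟨hu, hsu⟩ => ?_⟩
  by_contra hne
  exact hsu.2 (h.comp_of_side hn hu hsu.1 fun hu' => hne (hu'.eq ht))

theorem IsChord.not_uniqueInc (h : IsChord s i j) (hn : 2 ≤ n) (hj : j ≠ i + 1) :
    ¬UniqueInc s := by
  have hij := h.lt
  have hji := h.lt_add
  rintro ⟨-, t, -, huniq⟩
  obtain ⟨u, hu⟩ := exists_isChord hn (i := j) (j := i + ((n : ℤ) - 1)) (by omega) (by omega)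
  obtain ⟨v, hv⟩ := exists_isSpoke hn (i + 1)
  have hut := huniq u ⟨hu.rk_eq_one hn, h.inc_opposite hu hn⟩
  have hvt := huniq v ⟨hv.rk_eq_one hn, h.inc_of_isSpoke hv hn (by omega) (by omega)⟩
  exact hu.ne_of_isSpoke hv hn (hut.trans hvt.symm)

theorem IsSpoke.not_uniqueInc_of_eq_three (h : IsSpoke s i) (hn : n = 3) : ¬UniqueInc s := by
  have hn' : 2 ≤ n := by omega
  rintro ⟨-, t, ⟨ht, hst⟩, -⟩
  rcases exists_isChord_or_exists_isSpoke hn' ht with ⟨k, l, hk⟩ | ⟨k, hk⟩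
  · have hkl := hk.lt
    have hlk := hk.lt_add
    obtain rfl : l = k + 1 := by omega
    exact hst.symm.2 (hk.comp_of_side hn.ge (h.rk_eq_one hn') hst.1.symm
      fun hc => hc.ne_of_isSpoke h hn' rfl)
  · exact hst.2 (h.comp hk hn' hst.1)

theorem IsSpoke.not_uniqueInc_of_five_le (h : IsSpoke s i) (hn : 5 ≤ n) : ¬UniqueInc s := by
  have hn' : 2 ≤ n := by omega
  rintro ⟨-, t, -, huniq⟩
  obtain ⟨u, hu⟩ := exists_isChord hn' (i := i - 1) (j := i + 1) (by omega) (by omega)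
  obtain ⟨v, hv⟩ := exists_isChord hn' (i := i - 1) (j := i + 2) (by omega) (by omega)
  have hut := huniq u ⟨hu.rk_eq_one hn', (hu.inc_of_isSpoke h hn' (by omega) (by omega)).symm⟩
  have hvt := huniq v ⟨hv.rk_eq_one hn', (hv.inc_of_isSpoke h hn' (by omega) (by omega)).symm⟩
  have hindex := hu.index_unique (hut.trans hvt.symm ▸ hv) hn' le_rfl (by omega)
  omega

theorem IsSpoke.not_uniqueInc (h : IsSpoke s i) (hn : 3 ≤ n) (hn4 : n ≠ 4) : ¬UniqueInc s := by
  obtain hn3 | hn5 : n = 3 ∨ 5 ≤ n := by omega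
  · exact h.not_uniqueInc_of_eq_three hn3
  · exact h.not_uniqueInc_of_five_le hn5

theorem uniqueInc_iff (hn : 3 ≤ n) (hn4 : n ≠ 4) : UniqueInc s ↔ ∃ i, IsChord s i (i + 1) := by
  refine ⟨fun h => ?_, fun ⟨i, h⟩ => h.uniqueInc hn⟩
  rcases exists_isChord_or_exists_isSpoke (by omega) h.1 with ⟨i, j, hc⟩ | ⟨i, hs⟩
  · by_cases hj : j = i + 1
    · exact ⟨i, hj ▸ hc⟩
    · exact absurd h (hc.not_uniqueInc (by omega) hj)
  · exact absurd h (hs.not_uniqueInc hn hn4)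

theorem IsSpoke.spokeLike (h : IsSpoke s i) (hn : 3 ≤ n) (hn4 : n ≠ 4) : SpokeLike s := by
  have hn' : 2 ≤ n := by omega
  refine ⟨h.rk_eq_one hn', h.not_uniqueInc hn hn4, fun t ht => ?_, ?_⟩
  · obtain ⟨k, hk⟩ := (uniqueInc_iff hn hn4).mp ht
    exact (hk.comp_of_side hn (h.rk_eq_one hn') (hk.ne_of_isSpoke h hn')
      fun hc => hc.ne_of_isSpoke h hn' rfl).symm
  · obtain ⟨t₁, ht₁⟩ := exists_isChord hn' (i := i) (j := i + 1) (by omega) (by omega)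
    obtain ⟨t₂, ht₂⟩ := exists_isChord hn' (i := i - 1) (j := i) (by omega) (by omega)
    have hpair : ({t₁, t₂} : Set (NC n)).encard ≤ 2 := by
      simpa only [Set.encard_singleton, one_add_one_eq_two] using Set.encard_insert_le {t₂} t₁
    refine (Set.encard_le_encard ?_).trans hpair
    rintro t ⟨ht, u, hu⟩
    obtain ⟨k, hk⟩ := (uniqueInc_iff hn hn4).mp ht
    exact (hu.isChord_or_isChord_of_isSpoke h hk hn').imp (·.eq ht₁) (·.eq ht₂)

theorem IsChord.not_spokeLike (h : IsChord s i j) (hn : 3 ≤ n) : ¬SpokeLike s := by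
  intro hs
  have hn' : 2 ≤ n := by omega
  have hij := h.lt
  have hji := h.lt_add
  have hj : j ≠ i + 1 := fun e => hs.not_uniqueInc ((e ▸ h :).uniqueInc hn)
  obtain ⟨t₃, ht₃⟩ := exists_isChord hn' (i := j) (j := j + 1) (by omega) (by omega)
  by_cases hj' : i + ((n : ℤ) - 1) = j + 1
  · exact (h.inc_opposite (hj' ▸ ht₃) hn').2 (hs.comp_of_uniqueInc _ (ht₃.uniqueInc hn))
  obtain ⟨t₁, ht₁⟩ := exists_isChord hn' (i := i - 1) (j := i - 1 + 1) (by omega) (by omega)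
  obtain ⟨t₂, ht₂⟩ := exists_isChord hn' (i := i) (j := i + 1) (by omega) (by omega)
  obtain ⟨u₁, hu₁⟩ := exists_isChord hn' (i := i - 1) (j := j) (by omega) (by omega)
  obtain ⟨u₂, hu₂⟩ := exists_isChord hn' (i := i + 1) (j := j) (by omega) (by omega)
  obtain ⟨u₃, hu₃⟩ := exists_isChord hn' (i := i) (j := j + 1) (by omega) (by omega)
  have hne {k l : ℤ} {t t' : NC n} (ht : IsChord t k (k + 1)) (ht' : IsChord t' l (l + 1))
      (hkl : k < l) (hlk : l < k + ((n : ℤ) - 1)) : t ≠ t' := by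
    rintro rfl
    exact hkl.ne' (ht.index_unique ht' hn' hkl.le hlk).1
  have hsides : {t₁, t₂, t₃} ⊆ {t | UniqueInc t ∧ ∃ u, Tri s t u} := by
    rintro _ (rfl | rfl | rfl)
    · exact ⟨ht₁.uniqueInc hn, u₁, ((sub_add_cancel i 1 ▸ ht₁ :).tri h hu₁ hn').swap₁₂⟩
    · exact ⟨ht₂.uniqueInc hn, u₂, (ht₂.tri hu₂ h hn').swap₂₃.swap₁₂⟩
    · exact ⟨ht₃.uniqueInc hn, u₃, h.tri ht₃ hu₃ hn'⟩
  have hthree : ({t₁, t₂, t₃} : Set (NC n)).encard = 3 :=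
    Set.encard_eq_three.mpr ⟨t₁, t₂, t₃, hne ht₁ ht₂ (by omega) (by omega),
      hne ht₁ ht₃ (by omega) (by omega), hne ht₂ ht₃ (by omega) (by omega), rfl⟩
  exact absurd ((hthree.symm.trans_le (Set.encard_le_encard hsides)).trans hs.encard_le_two)
    (by norm_num)

theorem IsSpoke.exists_isSpoke_map (h : IsSpoke s i) (hn : 3 ≤ n) (hn4 : n ≠ 4)
    (ψ : NC n ≃o NC n) : ∃ j, IsSpoke (ψ s) j := by
  have hψs := (h.spokeLike hn hn4).map (by omega) ψ
  rcases exists_isChord_or_exists_isSpoke (by omega) hψs.rk_eq_one with ⟨i, j, hc⟩ | hs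
  · exact absurd hψs (hc.not_spokeLike hn)
  · exact hs

/-! ### Automorphisms fixing the spokes -/

theorem apply_eq_of_isSpoke_add_two (hn : 3 ≤ n) (hn4 : n ≠ 4) (hs : IsSpoke s k)
    (ht : IsSpoke t (k + 1)) (hu : IsSpoke u (k + 1 + 1)) (hψs : ψ s = s) (hψt : ψ t = t) :
    ψ u = u := by
  have hn' : 2 ≤ n := by omega
  obtain ⟨v, hv⟩ := exists_isChord hn' (i := k + 1) (j := k + 1 + 1) (by omega) (by omega)
  obtain ⟨j, hj⟩ := hu.exists_isSpoke_map hn hn4 ψ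
  obtain ⟨l, hl⟩ := (uniqueInc_iff hn hn4).mp ((hv.uniqueInc hn).map hn' ψ)
  have htri : Tri t (ψ u) (ψ v) := by simpa only [hψt] using (ht.tri hu hv hn').map hn' ψ
  rcases htri.pos_eq_of_isSpoke ht hj hl hn' with hpos | hpos
  · exact (hj.congr hpos).eq hu
  · rw [add_sub_cancel_right] at hpos
    have hus : u = s := ψ.injective (((hj.congr hpos).eq hs).trans hψs.symm)
    exact absurd (hs.pos_eq (hus ▸ hu) hn') (pos_ne hn' (by omega) (by omega))

theorem IsSpoke.apply_eq (hs : IsSpoke s i) (hn : 3 ≤ n) (hn4 : n ≠ 4) (h₀ : IsSpoke t 0)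
    (h₁ : IsSpoke u 1) (hψt : ψ t = t) (hψu : ψ u = u) : ψ s = s := by
  have hn' : 2 ≤ n := by omega
  have hfix (k : ℕ) : (∀ t, IsSpoke t k → ψ t = t) ∧ ∀ t, IsSpoke t (k + 1) → ψ t = t := by
    induction k with
    | zero =>
      refine ⟨fun t' ht' => ?_, fun t' ht' => ?_⟩
      · rwa [ht'.eq (by simpa using h₀)]
      · rwa [ht'.eq (by simpa using h₁)]
    | succ k ih =>
      push_cast
      refine ⟨ih.2, fun v hv => ?_⟩
      obtain ⟨w, hw⟩ := exists_isSpoke hn' k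
      obtain ⟨w', hw'⟩ := exists_isSpoke hn' (k + 1)
      exact apply_eq_of_isSpoke_add_two hn hn4 hw hw' hv (ih.1 w hw) (ih.2 w' hw')
  obtain ⟨k, hk, -, hsk⟩ := hs.exists_mem_window hn' 0
  lift k to ℕ using hk
  exact (hfix k).1 s hsk

theorem eq_one_of_isSpoke_zero_one (hn : 3 ≤ n) (hn4 : n ≠ 4) (h₀ : IsSpoke s 0)
    (h₁ : IsSpoke t 1) (hψs : ψ s = s) (hψt : ψ t = t) : ψ = 1 := by
  have hn' : 2 ≤ n := by omega
  have hfix {k : ℤ} {u : NC n} (hu : IsSpoke u k) : ψ u = u :=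
    hu.apply_eq hn hn4 h₀ h₁ hψs hψt
  refine eq_one_of_forall_atom_apply_eq hn' fun u hu => ?_
  rcases exists_isChord_or_exists_isSpoke hn' hu with ⟨i, j, hc⟩ | ⟨i, hi⟩
  · obtain ⟨v, hv⟩ := exists_isSpoke hn' i
    obtain ⟨w, hw⟩ := exists_isSpoke hn' j
    have htri : Tri v w (ψ u) := by
      simpa only [hfix hv, hfix hw] using (hv.tri hw hc hn').map hn' ψ
    exact Subtype.ext ((htri.isRoot_and_coe_eq_of_isSpoke hv hw hn').2.trans hc.coe_eq.symm)
  · exact hfix hi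

end Spokes

/-! ### Dihedral groups -/

section Dihedral

variable {G : Type*} [Group G] {x z ρ : G} {N : ℕ}

/-- The homomorphism `k ↦ ρ ^ k` on `ZMod N`, for an element `ρ` with `ρ ^ N = 1`. -/
def zmodPow (hρ : ρ ^ N = 1) : Multiplicative (ZMod N) →* G :=
  AddMonoidHom.toMultiplicativeLeft <|
    ZMod.lift N ⟨zmultiplesHom (Additive G) (Additive.ofMul ρ), by simp [← ofMul_pow, hρ]⟩

theorem zmodPow_intCast (hρ : ρ ^ N = 1) (k : ℤ) :
    zmodPow hρ (Multiplicative.ofAdd (k : ZMod N)) = ρ ^ k := by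
  simp [zmodPow]

/-- The homomorphism from the dihedral group that sends the rotation `r i` to `ρ ^ i` and the
reflection `sr i` to `x * ρ ^ i`. -/
def dihedralHom (hρ : ρ ^ N = 1) (hx : x * x = 1) (hxρ : SemiconjBy x ρ ρ⁻¹) :
    DihedralGroup N →* G where
  toFun
    | .r i => zmodPow hρ (Multiplicative.ofAdd i)
    | .sr i => x * zmodPow hρ (Multiplicative.ofAdd i)
  map_one' := map_one (zmodPow hρ)
  map_mul' := by
    have hswap (k : ℤ) : ρ ^ k * x = x * ρ ^ (-k) := by
      simpa only [inv_zpow, zpow_neg, inv_inv] using (hxρ.zpow_right (-k)).eq.symm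
    rintro (i | i) (j | j) <;> obtain ⟨i, rfl⟩ := ZMod.intCast_surjective i <;>
      obtain ⟨j, rfl⟩ := ZMod.intCast_surjective j <;>
      simp only [DihedralGroup.r_mul_r, DihedralGroup.r_mul_sr, DihedralGroup.sr_mul_r,
        DihedralGroup.sr_mul_sr, ← Int.cast_add, ← Int.cast_sub, zmodPow_intCast]
    · exact zpow_add ρ i j
    · rw [← mul_assoc, hswap, mul_assoc, ← zpow_add, sub_eq_neg_add]
    · rw [zpow_add, mul_assoc]
    · rw [← mul_assoc, mul_assoc x, hswap, ← mul_assoc, hx, one_mul, ← zpow_add, sub_eq_neg_add]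

theorem dihedralHom_r (hρ : ρ ^ N = 1) (hx : x * x = 1) (hxρ : SemiconjBy x ρ ρ⁻¹) (k : ℤ) :
    dihedralHom hρ hx hxρ (.r k) = ρ ^ k := zmodPow_intCast hρ k

theorem dihedralHom_sr (hρ : ρ ^ N = 1) (hx : x * x = 1) (hxρ : SemiconjBy x ρ ρ⁻¹) (k : ℤ) :
    dihedralHom hρ hx hxρ (.sr k) = x * ρ ^ k := congrArg (x * ·) (zmodPow_intCast hρ k)

theorem dihedralHom_injective (hN : orderOf ρ = N) (hρ : ρ ^ N = 1) (hx : x * x = 1)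
    (hxρ : SemiconjBy x ρ ρ⁻¹) (hmem : x ∉ Subgroup.zpowers ρ) :
    Function.Injective (dihedralHom hρ hx hxρ) := by
  have hcast {i j : ℤ} (h : ρ ^ i = ρ ^ j) : (i : ZMod N) = j := by
    rwa [ZMod.intCast_eq_intCast_iff, ← hN, ← zpow_eq_zpow_iff_modEq]
  have hne (i j : ℤ) : ρ ^ i ≠ x * ρ ^ j := fun h =>
    hmem ⟨i - j, by simp only [zpow_sub, h, mul_inv_cancel_right]⟩
  rintro (i | i) (j | j) h <;> obtain ⟨i, rfl⟩ := ZMod.intCast_surjective i <;>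
    obtain ⟨j, rfl⟩ := ZMod.intCast_surjective j <;>
    simp only [dihedralHom_r, dihedralHom_sr] at h
  · rw [hcast h]
  · exact absurd h (hne i j)
  · exact absurd h.symm (hne j i)
  · rw [hcast (mul_left_cancel h)]

theorem range_dihedralHom (hρ : ρ ^ N = 1) (hx : x * x = 1) (hxρ : SemiconjBy x ρ ρ⁻¹) :
    (dihedralHom hρ hx hxρ).range = Subgroup.closure {x, ρ} := by
  have hxmem : x ∈ Subgroup.closure {x, ρ} := Subgroup.subset_closure (by simp)
  have hρmem : ρ ∈ Subgroup.closure {x, ρ} := Subgroup.subset_closure (by simp)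
  refine le_antisymm ?_ (Subgroup.closure_le _ |>.mpr ?_)
  · rintro _ ⟨i | i, rfl⟩ <;> obtain ⟨i, rfl⟩ := ZMod.intCast_surjective i
    · rw [dihedralHom_r]
      exact zpow_mem hρmem i
    · rw [dihedralHom_sr]
      exact mul_mem hxmem (zpow_mem hρmem i)
  · rintro _ (rfl | rfl)
    · exact ⟨.sr (0 : ℤ), by rw [dihedralHom_sr, zpow_zero, mul_one]⟩
    · exact ⟨.r (1 : ℤ), by rw [dihedralHom_r, zpow_one]⟩

theorem closure_pair_mul (x z : G) :
    Subgroup.closure {x, x * z} = Subgroup.closure {x, z} := by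
  have hmem {s : Set G} {g : G} (hg : g ∈ s) : g ∈ Subgroup.closure s := Subgroup.subset_closure hg
  refine le_antisymm ?_ ?_ <;> rw [Subgroup.closure_le] <;> rintro _ (rfl | rfl)
  · exact hmem (by simp)
  · exact mul_mem (hmem (by simp)) (hmem (by simp))
  · exact hmem (by simp)
  · exact (Subgroup.mul_mem_cancel_left _ (hmem (by simp))).mp (hmem (Set.mem_insert_of_mem x rfl))

theorem orderOf_dvd_two_of_semiconjBy_inv (hxρ : SemiconjBy x ρ ρ⁻¹)
    (hx : x ∈ Subgroup.zpowers ρ) : orderOf ρ ∣ 2 := by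
  obtain ⟨k, rfl⟩ := Subgroup.mem_zpowers_iff.mp hx
  have hinv : ρ = ρ⁻¹ := mul_right_cancel ((Commute.self_zpow ρ k).eq.trans hxρ.eq)
  exact orderOf_dvd_of_pow_eq_one (by rw [sq, mul_eq_one_iff_eq_inv, ← hinv])

theorem nonempty_closure_mulEquiv_dihedralGroup (hx : x * x = 1) (hz : z * z = 1)
    (hN₁ : orderOf (x * z) ≠ 1) (hN₂ : orderOf (x * z) ≠ 2) :
    Nonempty (Subgroup.closure {x, z} ≃* DihedralGroup (orderOf (x * z))) := by
  have hconj : SemiconjBy x (x * z) (x * z)⁻¹ := by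
    rw [SemiconjBy, mul_inv_rev, inv_eq_of_mul_eq_one_left hx, inv_eq_of_mul_eq_one_left hz,
      ← mul_assoc, hx, one_mul, mul_assoc, hx, mul_one]
  have hmem : x ∉ Subgroup.zpowers (x * z) := fun hx' =>
    ((Nat.dvd_prime Nat.prime_two).mp (orderOf_dvd_two_of_semiconjBy_inv hconj hx')).elim hN₁ hN₂
  have hinj := dihedralHom_injective rfl (pow_orderOf_eq_one _) hx hconj hmem
  have hrange := (range_dihedralHom (pow_orderOf_eq_one _) hx hconj).trans (closure_pair_mul x z)
  exact ⟨((MonoidHom.ofInjective hinj).trans (MulEquiv.subgroupCongr hrange)).symm⟩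

end Dihedral

/-! ### Bipartitions of the Coxeter element -/

section Bipartition

variable {n : ℕ} {a b κ : ℤ} {g l r v w : Equiv.Perm ℤ}

theorem IsSigned.mul (hv : IsSigned n v) (hw : IsSigned n w) : IsSigned n (v * w) :=
  ⟨fun k => by rw [Equiv.Perm.mul_apply, Equiv.Perm.mul_apply, hw.1, hv.1],
    fun k hk => by rw [Equiv.Perm.mul_apply, hw.2 k hk, hv.2 k hk]⟩

theorem isSigned_one (n : ℕ) : IsSigned n 1 := isSigned_of_mem (one_mem (W n))

theorem IsSigned.pow (hw : IsSigned n w) (m : ℕ) : IsSigned n (w ^ m) := by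
  induction m with
  | zero => exact isSigned_one n
  | succ m ih => exact pow_succ w m ▸ ih.mul hw

theorem IsSigned.ext_of_pos (hn : 2 ≤ n) (hv : IsSigned n v) (hw : IsSigned n w)
    (hpos : ∀ k, v (pos n k) = w (pos n k)) (hlast : v n = w n) : v = w := by
  ext k
  rcases eq_or_ne k 0 with rfl | hk0
  · rw [hv.map_zero, hw.map_zero]
  rcases lt_trichotomy |k| n with hk | hk | hk
  · obtain ⟨j, -, -, rfl⟩ := exists_pos_eq hn 0 hk0 (Int.le_sub_one_of_lt hk)
    exact hpos j
  · rcases eq_or_eq_neg_of_abs_eq hk with rfl | rfl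
    · exact hlast
    · rw [hv.1, hw.1, hlast]
  · rw [hv.2 k hk, hw.2 k hk]

theorem exists_mem_W_reversing (ha : 1 ≤ a) (hb : b ≤ n) :
    ∃ g ∈ W n, ∀ k, 1 ≤ k → g k = if a ≤ k ∧ k ≤ b then a + b - k else k := by
  induction hm : (b - a).toNat using Nat.strong_induction_on generalizing a b with
  | _ m ih =>
    by_cases hab : a < b
    · obtain ⟨g, hg, hgk⟩ := ih (b - 1 - (a + 1)).toNat (by omega) (by omega) (by omega) rfl
      have hroot := isRoot_of_pos_of_lt (by omega) hab hb
      refine ⟨paired a b * g, mul_mem hroot.mem_W hg, fun k hk => ?_⟩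
      rw [Equiv.Perm.mul_apply, hgk k hk, hroot.paired_apply]
      split_ifs <;> omega
    · refine ⟨1, one_mem _, fun k _ => ?_⟩
      rw [Equiv.Perm.one_apply]
      split_ifs <;> omega

theorem exists_mem_W_pos_reversing (hn : 2 ≤ n) :
    ∃ g ∈ W n, g n = n ∧ ∀ k, g (pos n k) = pos n (n - 2 - k) := by
  obtain ⟨g, hg, hgk⟩ := exists_mem_W_reversing (n := n) (b := n - 1) le_rfl (by omega)
  refine ⟨g, hg, by rw [hgk n (by omega), if_neg (by omega)], fun k => ?_⟩
  obtain ⟨k', hk'₀, hk'₁, hk'⟩ := exists_pos_eq hn 0 (pos_ne_zero hn k) (abs_pos_le hn k)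
  have hdvd : 2 * ((n : ℤ) - 1) ∣ n - 2 - k - (n - 2 - k') := by
    simpa only [sub_sub_sub_cancel_left] using dvd_sub_of_pos_eq hn hk'
  rw [← hk', pos_eq_of_dvd hn hdvd]
  rcases lt_or_ge k' ((n : ℤ) - 1) with h | h
  · rw [pos_eq hn hk'₀ h, pos_eq hn (by omega) (by omega), hgk _ (by omega), if_pos (by omega)]
    ring
  · rw [pos_eq_neg hn h (by omega), (isSigned_of_mem hg).1, hgk _ (by omega), if_pos (by omega),
      neg_eq_iff_eq_neg, ← pos_add_pred hn, pos_eq hn (by omega) (by omega)]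
    ring

theorem isBipartition_of_pos_reversing (hn : 2 ≤ n) (hg : g ∈ W n) (hlast : g n = n)
    (hpos : ∀ k, g (pos n k) = pos n (κ - k)) : IsBipartition n g (g * cox n) := by
  have hsigned := isSigned_of_mem hg
  have hsq : g * g = 1 := by
    refine (hsigned.mul hsigned).ext_of_pos hn (isSigned_one n) (fun k => ?_) ?_
    · rw [Equiv.Perm.mul_apply, hpos, hpos, sub_sub_cancel, Equiv.Perm.one_apply]
    · rw [Equiv.Perm.mul_apply, hlast, hlast, Equiv.Perm.one_apply]
  have hcox := hsigned.mul (isSigned_cox hn)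
  have hcoxsq : g * cox n * (g * cox n) = 1 := by
    refine (hcox.mul hcox).ext_of_pos hn (isSigned_one n) (fun k => ?_) ?_ <;>
      simp only [Equiv.Perm.mul_apply, Equiv.Perm.one_apply]
    · rw [cox_pos, hpos, cox_pos, hpos]
      congr 1
      ring
    · rw [cox_apply_self hn, hsigned.1, hlast, (isSigned_cox hn).1, cox_apply_self hn, neg_neg,
        hlast]
  exact ⟨hg, mul_mem hg (cox_mem hn), hsq, hcoxsq, by rw [← mul_assoc, hsq, one_mul]⟩

theorem exists_isBipartition (hn : 2 ≤ n) : ∃ l r : Equiv.Perm ℤ, IsBipartition n l r :=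
  have ⟨l, hl, hlast, hpos⟩ := exists_mem_W_pos_reversing hn
  ⟨l, l * cox n, isBipartition_of_pos_reversing hn hl hlast hpos⟩

namespace IsBipartition

theorem inv_left (h : IsBipartition n l r) : l⁻¹ = l := inv_eq_of_mul_eq_one_left h.left_sq

theorem inv_right (h : IsBipartition n l r) : r⁻¹ = r := inv_eq_of_mul_eq_one_left h.right_sq

theorem right_eq (h : IsBipartition n l r) : r = l * cox n := by
  rw [← h.mul_eq, ← mul_assoc, h.left_sq, one_mul]

theorem left_apply_left (h : IsBipartition n l r) (k : ℤ) : l (l k) = k := by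
  rw [← Equiv.Perm.mul_apply, h.left_sq, Equiv.Perm.one_apply]

theorem cox_left_cox (h : IsBipartition n l r) (k : ℤ) : cox n (l (cox n k)) = l k := by
  have hconj : cox n * l * cox n = l := by
    rw [← mul_inv_eq_iff_eq_mul.mp h.conj_left, inv_mul_cancel_right]
  exact congrArg (· k) hconj

theorem left_last (h : IsBipartition n l r) (hn : 3 ≤ n) : l n = n ∨ l n = -n := by
  have hn₂ : 2 ≤ n := le_of_lt hn
  have hl := isSigned_of_mem h.left_mem
  have habs := hl.abs_apply_le (i := n) (by rw [Nat.abs_cast])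
  rcases habs.eq_or_lt with heq | hlt
  · exact eq_or_eq_neg_of_abs_eq heq
  obtain ⟨i, -, -, hi⟩ := exists_pos_eq hn₂ 0 (hl.apply_ne_zero (i := n) (by omega))
    (Int.le_sub_one_of_lt hlt)
  -- Evaluated at `n`, the relation `c l c = l` becomes `pᵢ₊₁ = -pᵢ`.
  have hcox := h.cox_left_cox n
  rw [cox_apply_self hn₂, hl.1, (isSigned_cox hn₂).1, ← hi, cox_pos] at hcox
  exact absurd hcox.symm (pos_ne_neg hn₂ (by omega) (by omega))

theorem exists_left_pos (h : IsBipartition n l r) (hn : 3 ≤ n) :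
    ∃ κ, ∀ k, l (pos n k) = pos n (κ - k) := by
  have hn₂ : 2 ≤ n := le_of_lt hn
  have hl := isSigned_of_mem h.left_mem
  have hpos := abs_pos_le hn₂ 0
  have hlt : |l (pos n 0)| < n := by
    refine lt_of_le_of_ne (hl.abs_apply_le (by omega)) fun heq => ?_
    have hll : |l (l (pos n 0))| = n := by
      rcases eq_or_eq_neg_of_abs_eq heq with heq | heq <;> rcases h.left_last hn with hn' | hn' <;>
        simp only [heq, hl.1, hn', abs_neg, Nat.abs_cast]
    rw [h.left_apply_left] at hll
    omega
  obtain ⟨κ, -, -, hκ⟩ := exists_pos_eq hn₂ 0 (hl.apply_ne_zero (pos_ne_zero hn₂ 0))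
    (Int.le_sub_one_of_lt hlt)
  refine ⟨κ, fun k => ?_⟩
  induction k with
  | zero => rw [sub_zero, hκ]
  | succ k ih =>
    apply (cox n).injective
    rw [← cox_pos, h.cox_left_cox, ih, cox_pos]
    congr 1
    ring
  | pred k ih =>
    rw [← h.cox_left_cox, cox_pos, sub_add_cancel, ih, cox_pos]
    congr 1
    ring

theorem right_last (h : IsBipartition n l r) (hn : 3 ≤ n) : r n = n ∨ r n = -n := by
  rw [h.right_eq, Equiv.Perm.mul_apply, cox_apply_self (le_of_lt hn),
    (isSigned_of_mem h.left_mem).1, neg_inj, neg_eq_iff_eq_neg]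
  exact (h.left_last hn).symm

theorem right_mul_balanced_mul_right (h : IsBipartition n l r) (hn : 3 ≤ n) :
    r * balanced n * r = balanced n := by
  suffices r * balanced n * r⁻¹ = balanced n by rwa [h.inv_right] at this
  rw [balanced, Equiv.mul_swap_eq_swap_mul, mul_inv_cancel_right, (isSigned_of_mem h.right_mem).1]
  rcases h.right_last hn with hr | hr <;> rw [hr]
  rw [neg_neg, Equiv.swap_comm]

end IsBipartition

end Bipartition

/-! ### The dihedral group `D*` -/

section DStar

variable {n : ℕ} {i j a : ℤ} {l r : Equiv.Perm ℤ} {s t : NC n} {ψ : NC n ≃o NC n}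

theorem IsBipartition.exists_isSpoke_phiL (h : IsBipartition n l r) (hn : 3 ≤ n) :
    ∃ κ, ∀ s i, IsSpoke s i → IsSpoke (phiL h s) (κ - i) := by
  have hn₂ : 2 ≤ n := le_of_lt hn
  obtain ⟨κ, hκ⟩ := h.exists_left_pos hn
  have hphiL (s i) (hs : IsSpoke s i) : (phiL h s).1 = paired (pos n (κ - i)) (l n) := by
    have hconj := conj_paired l (isSigned_of_mem h.left_mem).1 (pos n i) n
    rw [h.inv_left, hκ] at hconj
    rw [coe_phiL, hs, (isRoot_pos_last hn₂ i).inv_paired, hconj]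
  rcases h.left_last hn with hlast | hlast
  · exact ⟨κ, fun s i hs => (hphiL s i hs).trans (by rw [hlast])⟩
  · refine ⟨κ + ((n : ℤ) - 1), fun s i hs => (hphiL s i hs).trans ?_⟩
    rw [hlast, add_sub_right_comm, pos_add_pred hn₂, (isRoot_pos_last hn₂ _).paired_neg_left]

theorem phiL_mul_self (h : IsBipartition n l r) : phiL h * phiL h = 1 := by
  refine RelIso.ext fun w => Subtype.ext ?_
  rw [RelIso.mul_apply, coe_phiL, coe_phiL, mul_inv_rev, mul_inv_rev, inv_inv, h.inv_left]
  calc l * (l * (w.1 * l)) * l = (l * l) * w.1 * (l * l) := by simp only [mul_assoc]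
    _ = w.1 := by rw [h.left_sq, one_mul, mul_one]

theorem phiR_mul_phiN_mul_self (hn : 3 ≤ n) (h : IsBipartition n l r) :
    phiR h * phiN (le_of_lt hn) * (phiR h * phiN (le_of_lt hn)) = 1 := by
  refine RelIso.ext fun w => Subtype.ext ?_
  simp only [RelIso.mul_apply, coe_phiR, coe_phiN, mul_inv_rev, inv_inv, h.inv_right, balanced_inv]
  calc r * (balanced n * (r * (balanced n * w.1 * balanced n) * r) * balanced n) * r
      = (r * balanced n * r) * balanced n * w.1 * (balanced n * (r * balanced n * r)) := by
        simp only [mul_assoc]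
    _ = w.1 := by rw [h.right_mul_balanced_mul_right hn, balanced_sq, one_mul, mul_one]

/-- The signed permutation `c [n]`, which fixes `n` and sends `pₖ` to `pₖ₊₁`. -/
def rot (n : ℕ) : Equiv.Perm ℤ := cox n * balanced n

theorem isSigned_rot (hn : 2 ≤ n) : IsSigned n (rot n) := (isSigned_cox hn).mul (balanced_signed hn)

theorem rot_pos (hn : 2 ≤ n) (k : ℤ) : rot n (pos n k) = pos n (k + 1) := by
  obtain ⟨hlower, hupper⟩ := abs_le.mp (abs_pos_le hn k)
  rw [rot, Equiv.Perm.mul_apply, balanced, Equiv.swap_apply_of_ne_of_ne (by omega) (by omega),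
    cox_pos]

theorem rot_last (hn : 2 ≤ n) : rot n n = n := by
  rw [rot, Equiv.Perm.mul_apply, balanced, Equiv.swap_apply_left, (isSigned_cox hn).1,
    cox_apply_self hn, neg_neg]

theorem rot_pow_pos (hn : 2 ≤ n) (m : ℕ) (k : ℤ) : (rot n ^ m) (pos n k) = pos n (k + m) := by
  induction m with
  | zero => rw [pow_zero, Equiv.Perm.one_apply, Nat.cast_zero, add_zero]
  | succ m ih =>
    rw [pow_succ', Equiv.Perm.mul_apply, ih, rot_pos hn, add_assoc, Nat.cast_add_one]

theorem rot_pow_eq_one (hn : 2 ≤ n) : rot n ^ (2 * (n - 1)) = 1 := by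
  refine ((isSigned_rot hn).pow _).ext_of_pos hn (isSigned_one n) (fun k => ?_)
    (Equiv.Perm.pow_apply_eq_self_of_apply_eq_self (rot_last hn) _)
  rw [rot_pow_pos hn, Nat.cast_mul, Nat.cast_pred (by omega)]
  exact pos_periodic hn k

/-- The automorphism `φ_l ∘ φ_r ∘ φ_n` of `NC(D_n)`, which is the conjugation by `c [n]`. -/
def rho (hn : 2 ≤ n) (h : IsBipartition n l r) : NC n ≃o NC n :=
  phiL h * (phiR h * phiN hn)

theorem coe_rho (hn : 2 ≤ n) (h : IsBipartition n l r) (w : NC n) :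
    (rho hn h w).1 = rot n * w.1 * (rot n)⁻¹ := by
  simp only [rho, RelIso.mul_apply, coe_phiL, coe_phiR, coe_phiN, rot, ← h.mul_eq, mul_inv_rev,
    inv_inv, h.inv_right, h.inv_left, balanced_inv, mul_assoc]

theorem coe_rho_pow (hn : 2 ≤ n) (h : IsBipartition n l r) (m : ℕ) (w : NC n) :
    ((rho hn h ^ m) w).1 = rot n ^ m * w.1 * (rot n ^ m)⁻¹ := by
  induction m with
  | zero => simp only [pow_zero, RelIso.one_apply, one_mul, inv_one, mul_one]
  | succ m ih =>
    rw [pow_succ', RelIso.mul_apply, coe_rho, ih, pow_succ', mul_inv_rev]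
    simp only [mul_assoc]

theorem IsSpoke.rho (hs : IsSpoke s i) (hn : 2 ≤ n) (h : IsBipartition n l r) :
    IsSpoke (rho hn h s) (i + 1) := by
  rw [IsSpoke, coe_rho, hs, conj_paired _ (isSigned_rot hn).1, rot_pos hn, rot_last hn]

theorem IsSpoke.rho_zpow (hs : IsSpoke s i) (hn : 2 ≤ n) (h : IsBipartition n l r) (k : ℤ) :
    IsSpoke ((NCD.rho hn h ^ k) s) (i + k) := by
  induction k generalizing i s with
  | zero => simpa only [zpow_zero, RelIso.one_apply, add_zero] using hs
  | succ k ih =>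
    rw [zpow_add_one, RelIso.mul_apply, add_comm (k : ℤ), ← add_assoc]
    exact ih (hs.rho hn h)
  | pred k ih =>
    obtain ⟨t, ht⟩ := exists_isSpoke hn (i - 1)
    have hst : s = NCD.rho hn h t := hs.eq (sub_add_cancel i 1 ▸ ht.rho hn h)
    rw [hst, ← RelIso.mul_apply, ← zpow_add_one, sub_add_cancel, add_sub, add_sub_right_comm]
    exact ih ht

theorem orderOf_rho (hn : 2 ≤ n) (h : IsBipartition n l r) :
    orderOf (rho hn h) = 2 * (n - 1) := by
  refine Nat.dvd_antisymm (orderOf_dvd_of_pow_eq_one ?_) ?_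
  · refine RelIso.ext fun w => Subtype.ext ?_
    rw [coe_rho_pow, rot_pow_eq_one hn, one_mul, inv_one, mul_one, RelIso.one_apply]
  · obtain ⟨s, hs⟩ := exists_isSpoke hn 0
    have hpow := hs.rho_zpow hn h (orderOf (rho hn h))
    rw [zpow_natCast, pow_orderOf_eq_one, RelIso.one_apply] at hpow
    have hdvd := dvd_sub_of_pos_eq hn (hpow.pos_eq hs hn)
    rw [zero_add, sub_zero] at hdvd
    zify [show 1 ≤ n by omega]
    exact hdvd

theorem nonempty_dStar_mulEquiv (hn : 3 ≤ n) (h : IsBipartition n l r) :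
    Nonempty (DStar (le_of_lt hn) h ≃* DihedralGroup (2 * (n - 1))) := by
  have horder := orderOf_rho (le_of_lt hn) h
  rw [← horder]
  rw [rho] at horder ⊢
  exact nonempty_closure_mulEquiv_dihedralGroup (phiL_mul_self h) (phiR_mul_phiN_mul_self hn h)
    (by omega) (by omega)

theorem phiL_mem_dStar (hn : 2 ≤ n) (h : IsBipartition n l r) : phiL h ∈ DStar hn h :=
  Subgroup.subset_closure (Set.mem_insert _ _)

theorem rho_mem_dStar (hn : 2 ≤ n) (h : IsBipartition n l r) : rho hn h ∈ DStar hn h :=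
  mul_mem (phiL_mem_dStar hn h) (Subgroup.subset_closure (Set.mem_insert_of_mem _ rfl))

theorem eq_rho_zpow_of_isSpoke (hn : 3 ≤ n) (hn4 : n ≠ 4) (h : IsBipartition n l r)
    (h₀ : IsSpoke s 0) (h₁ : IsSpoke t 1) (hψs : IsSpoke (ψ s) a) (hψt : IsSpoke (ψ t) (a + 1)) :
    ψ = rho (le_of_lt hn) h ^ a := by
  have hs : (rho (le_of_lt hn) h ^ (-a)) (ψ s) = s :=
    (add_neg_cancel a ▸ hψs.rho_zpow (le_of_lt hn) h (-a)).eq h₀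
  have ht : (rho (le_of_lt hn) h ^ (-a)) (ψ t) = t :=
    (add_neg_cancel_comm a 1 ▸ hψt.rho_zpow (le_of_lt hn) h (-a)).eq h₁
  have hone : rho (le_of_lt hn) h ^ (-a) * ψ = 1 := eq_one_of_isSpoke_zero_one hn hn4 h₀ h₁ hs ht
  rw [← inv_eq_of_mul_eq_one_right hone, zpow_neg, inv_inv]

theorem isSpoke_map_add_one_or_sub_one (hn : 3 ≤ n) (hn4 : n ≠ 4) (hs : IsSpoke s i)
    (ht : IsSpoke t (i + 1)) (hψs : IsSpoke (ψ s) a) :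
    IsSpoke (ψ t) (a + 1) ∨ IsSpoke (ψ t) (a - 1) := by
  have hn₂ : 2 ≤ n := le_of_lt hn
  obtain ⟨b, hψt⟩ := ht.exists_isSpoke_map hn hn4 ψ
  obtain ⟨u, hu⟩ := exists_isChord hn₂ (i := i) (j := i + 1) (by omega) (by omega)
  obtain ⟨k, hk⟩ := (uniqueInc_iff hn hn4).mp ((hu.uniqueInc hn).map hn₂ ψ)
  exact (((hs.tri ht hu hn₂).map hn₂ ψ).pos_eq_of_isSpoke hψs hψt hk hn₂).imp hψt.congr hψt.congr

theorem dStar_eq_top (hn : 3 ≤ n) (hn4 : n ≠ 4) (h : IsBipartition n l r) :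
    DStar (le_of_lt hn) h = ⊤ := by
  refine (Subgroup.eq_top_iff' _).mpr fun ψ => ?_
  obtain ⟨s, h₀⟩ := exists_isSpoke (le_of_lt hn) 0
  obtain ⟨t, h₁⟩ := exists_isSpoke (le_of_lt hn) 1
  obtain ⟨a, hψs⟩ := h₀.exists_isSpoke_map hn hn4 ψ
  rcases isSpoke_map_add_one_or_sub_one hn hn4 h₀ h₁ hψs with hψt | hψt
  · rw [eq_rho_zpow_of_isSpoke hn hn4 h h₀ h₁ hψs hψt]
    exact zpow_mem (rho_mem_dStar _ h) a
  · obtain ⟨κ, hκ⟩ := h.exists_isSpoke_phiL hn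
    have hφt := hκ _ _ hψt
    rw [← sub_add] at hφt
    have heq : phiL h * ψ = rho (le_of_lt hn) h ^ (κ - a) :=
      eq_rho_zpow_of_isSpoke hn hn4 h h₀ h₁ (hκ _ _ hψs) hφt
    refine (Subgroup.mul_mem_cancel_left _ (phiL_mem_dStar _ h)).mp ?_
    rw [heq]
    exact zpow_mem (rho_mem_dStar _ h) _

theorem IsSpoke.exists_isSpoke_of_mem_dStar (hs : IsSpoke s i) (hn : 3 ≤ n)
    (h : IsBipartition n l r) (hψ : ψ ∈ DStar (le_of_lt hn) h) : ∃ j, IsSpoke (ψ s) j := by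
  obtain ⟨κ, hκ⟩ := h.exists_isSpoke_phiL hn
  have hphiL (s i) (hs : IsSpoke s i) : ∃ j, IsSpoke (phiL h s) j := ⟨_, hκ s i hs⟩
  have hphiRN (s i) (hs : IsSpoke s i) : ∃ j, IsSpoke ((phiR h * phiN (le_of_lt hn)) s) j := by
    have heq : phiR h * phiN (le_of_lt hn) = phiL h * NCD.rho (le_of_lt hn) h := by
      rw [NCD.rho, ← mul_assoc, phiL_mul_self, one_mul]
    rw [heq]
    exact hphiL _ _ (hs.rho _ h)
  induction hψ using Subgroup.closure_induction'' generalizing s i with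
  | mem φ hφ =>
    rcases hφ with rfl | rfl
    · exact hphiL s i hs
    · exact hphiRN s i hs
  | inv_mem φ hφ =>
    rcases hφ with rfl | rfl
    · rw [inv_eq_of_mul_eq_one_left (phiL_mul_self h)]
      exact hphiL s i hs
    · rw [inv_eq_of_mul_eq_one_left (phiR_mul_phiN_mul_self hn h)]
      exact hphiRN s i hs
  | one => exact ⟨i, hs⟩
  | mul φ χ _ _ ihφ ihχ =>
    obtain ⟨j, hj⟩ := ihχ hs
    exact ihφ hj

end DStar

/-! ### The exotic automorphism of `NC(D₄)` -/

section Exotic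

variable {a b c d : ℤ} {v v' w w' : Equiv.Perm ℤ} {x y : ℤ → ℚ}

/-- An orthogonal involution of `ℚ⁴`, written on odd vectors, that permutes the roots of `D₄` but is
not a signed permutation. It is chosen to act on the root lines as in `exoticPairs`. -/
def spin : (ℤ → ℚ) →ₗ[ℚ] (ℤ → ℚ) where
  toFun x :=
    ((x 1 - x 2 - x 3 - x 4) / 2) • unitVec 1 + ((-x 1 - x 2 - x 3 + x 4) / 2) • unitVec 2 +
      ((-x 1 - x 2 + x 3 - x 4) / 2) • unitVec 3 + ((-x 1 + x 2 - x 3 - x 4) / 2) • unitVec 4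
  map_add' x y := by
    simp only [Pi.add_apply]
    module
  map_smul' c x := by
    simp only [Pi.smul_apply, smul_eq_mul, RingHom.id_apply]
    module

theorem spin_mem_oddSpace (x : ℤ → ℚ) : spin x ∈ oddSpace 4 := by
  refine add_mem (add_mem (add_mem ?_ ?_) ?_) ?_ <;>
    exact Submodule.smul_mem _ _ (unitVec_mem_oddSpace (by norm_num))

theorem spin_apply_one (x : ℤ → ℚ) : spin x 1 = (x 1 - x 2 - x 3 - x 4) / 2 := by
  simp [spin, unitVec_apply]

theorem spin_apply_two (x : ℤ → ℚ) : spin x 2 = (-x 1 - x 2 - x 3 + x 4) / 2 := by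
  simp [spin, unitVec_apply]

theorem spin_apply_three (x : ℤ → ℚ) : spin x 3 = (-x 1 - x 2 + x 3 - x 4) / 2 := by
  simp [spin, unitVec_apply]

theorem spin_apply_four (x : ℤ → ℚ) : spin x 4 = (-x 1 + x 2 - x 3 - x 4) / 2 := by
  simp [spin, unitVec_apply]

theorem oddSpace_four_ext (hx : x ∈ oddSpace 4) (hy : y ∈ oddSpace 4) (h₁ : x 1 = y 1)
    (h₂ : x 2 = y 2) (h₃ : x 3 = y 3) (h₄ : x 4 = y 4) : x = y := by
  refine sub_eq_zero.mp (eq_zero_of_mem_oddSpace (sub_mem hx hy) fun k hk hk4 => ?_)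
  push_cast at hk4
  rw [Pi.sub_apply, sub_eq_zero]
  interval_cases k <;> assumption

theorem spin_spin (hx : x ∈ oddSpace 4) : spin (spin x) = x := by
  refine oddSpace_four_ext (spin_mem_oddSpace _) hx ?_ ?_ ?_ ?_ <;>
  · simp only [spin_apply_one, spin_apply_two, spin_apply_three, spin_apply_four]
    ring

theorem pairing_four (hx : x ∈ oddSpace 4) (hy : y ∈ oddSpace 4) :
    pairing 4 x y = 2 * (x 1 * y 1 + x 2 * y 2 + x 3 * y 3 + x 4 * y 4) := by
  have hIcc : Finset.Icc (-((4 : ℕ) : ℤ)) (4 : ℕ) = {-4, -3, -2, -1, 0, 1, 2, 3, 4} := by decide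
  rw [pairing_apply, hIcc]
  norm_num [hx.1, hy.1, oddSpace_apply_zero hx]
  ring

theorem pairing_spin_spin (hx : x ∈ oddSpace 4) (hy : y ∈ oddSpace 4) :
    pairing 4 (spin x) (spin y) = pairing 4 x y := by
  rw [pairing_four (spin_mem_oddSpace x) (spin_mem_oddSpace y), pairing_four hx hy]
  simp only [spin_apply_one, spin_apply_two, spin_apply_three, spin_apply_four]
  ring

/-- `SpinConj w w'` says that `w'` is the conjugate of `w` by `spin`. Signed permutations act on odd
vectors by precomposition. -/
structure SpinConj (w w' : Equiv.Perm ℤ) : Prop where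
  left_mem : w ∈ W 4
  right_mem : w' ∈ W 4
  spin_apply : ∀ x ∈ oddSpace 4, ∀ k, spin x (w' k) = spin (fun i => x (w i)) k

namespace SpinConj

theorem one : SpinConj 1 1 := ⟨one_mem _, one_mem _, fun _ _ _ => rfl⟩

theorem mul (hv : SpinConj v v') (hw : SpinConj w w') : SpinConj (v * w) (v' * w') where
  left_mem := mul_mem hv.left_mem hw.left_mem
  right_mem := mul_mem hv.right_mem hw.right_mem
  spin_apply x hx k := by
    rw [Equiv.Perm.mul_apply, hv.spin_apply x hx,
      hw.spin_apply _ (comp_mem_oddSpace (isSigned_of_mem hv.left_mem) hx)]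
    rfl

theorem inv (hw : SpinConj w w') : SpinConj w⁻¹ w'⁻¹ where
  left_mem := inv_mem hw.left_mem
  right_mem := inv_mem hw.right_mem
  spin_apply x hx k := by
    have h := hw.spin_apply _ (comp_mem_oddSpace (isSigned_of_mem (inv_mem hw.left_mem)) hx)
      (w'⁻¹ k)
    rw [perm_apply_inv_self] at h
    simp only [h, perm_inv_apply_self]

theorem symm (hw : SpinConj w w') : SpinConj w' w where
  left_mem := hw.right_mem
  right_mem := hw.left_mem
  spin_apply x hx k := by
    have hcomp : (fun i => x (w' i)) = spin fun i => spin x (w i) := by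
      funext i
      rw [← hw.spin_apply _ (spin_mem_oddSpace x), spin_spin hx]
    rw [hcomp,
      spin_spin (comp_mem_oddSpace (isSigned_of_mem hw.left_mem) (spin_mem_oddSpace x))]

theorem unique (hv : SpinConj w v) (hv' : SpinConj w v') : v = v' := by
  have hcomp (x) (hx : x ∈ oddSpace 4) (k) : x (v k) = x (v' k) := by
    rw [← spin_spin hx, hv.spin_apply _ (spin_mem_oddSpace x),
      hv'.spin_apply _ (spin_mem_oddSpace x)]
  refine mul_inv_eq_one.mp (eq_one_of_oddSpace_le_fixedSpace
    (mul_mem hv.right_mem (inv_mem hv'.right_mem)) fun x hx => ⟨hx, fun k => ?_⟩)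
  rw [Equiv.Perm.mul_apply, hcomp x hx, perm_apply_inv_self]

theorem finrank_fixedSpace_le (h : SpinConj w w') :
    finrank ℚ (fixedSpace 4 w) ≤ finrank ℚ (fixedSpace 4 w') := by
  let spinFixed : fixedSpace 4 w →ₗ[ℚ] fixedSpace 4 w' := spin.restrict fun x hx =>
    ⟨spin_mem_oddSpace x, fun k => by rw [h.spin_apply x hx.1, funext hx.2]⟩
  refine LinearMap.finrank_le_finrank_of_injective (f := spinFixed) fun x y hxy => ?_
  have hspin : spin x.1 = spin y.1 := congrArg Subtype.val hxy
  exact Subtype.ext (by rw [← spin_spin x.2.1, hspin, spin_spin y.2.1])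

theorem absLength_eq (h : SpinConj w w') : absLength 4 w' = absLength 4 w := by
  have hcarter := absLength_add_finrank_fixedSpace h.left_mem
  have hcarter' := absLength_add_finrank_fixedSpace h.right_mem
  have hle := h.finrank_fixedSpace_le
  have hge := h.symm.finrank_fixedSpace_le
  omega

theorem absLE (hv : SpinConj v v') (hw : SpinConj w w') (h : AbsLE 4 v w) : AbsLE 4 v' w' := by
  rw [AbsLE, hv.absLength_eq, hw.absLength_eq, (hv.inv.mul hw).absLength_eq]
  exact h

end SpinConj

theorem IsRoot.spinConj (h : IsRoot 4 a b) (h' : IsRoot 4 c d)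
    (hspin : spin (unitVec a - unitVec b) = unitVec c - unitVec d) :
    SpinConj (paired a b) (paired c d) := by
  refine ⟨h.mem_W, h'.mem_W, fun x hx k => ?_⟩
  have hcoeff : spin x c - spin x d = x a - x b := by
    have hpair := pairing_spin_spin hx h.sub_unitVec_mem_oddSpace
    rw [hspin, h'.pairing_sub_unitVec (spin_mem_oddSpace x), h.pairing_sub_unitVec hx] at hpair
    linarith
  have hcomp : (fun i => x (paired a b i)) = x + (x b - x a) • (unitVec a - unitVec b) :=
    funext (h.apply_paired hx)
  rw [h'.apply_paired (spin_mem_oddSpace x), hcomp, map_add, map_smul, hspin, Pi.add_apply,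
    Pi.smul_apply, smul_eq_mul, ← neg_sub (x a), ← neg_sub (spin x c), hcoeff]

theorem isRoot_four (h : a ≠ 0 ∧ b ≠ 0 ∧ |a| ≤ 4 ∧ |b| ≤ 4 ∧ a ≠ b ∧ a ≠ -b) : IsRoot 4 a b :=
  ⟨h.1, h.2.1, h.2.2.1, h.2.2.2.1, h.2.2.2.2.1, h.2.2.2.2.2⟩

-- The signs of `c` and `d` are chosen so that `spin` maps the root of `a` and `b` to that of `c`
-- and `d`, not to its negative.
theorem exists_isRoot_of_mem_exoticPairs {p : Equiv.Perm ℤ × Equiv.Perm ℤ}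
    (hp : p ∈ exoticPairs) : ∃ a b c d, IsRoot 4 a b ∧ IsRoot 4 c d ∧
      p = (paired a b, paired c d) ∧ spin (unitVec a - unitVec b) = unitVec c - unitVec d := by
  simp only [exoticPairs, List.mem_cons, List.not_mem_nil, or_false] at hp
  rcases hp with rfl | rfl | rfl | rfl | rfl | rfl | rfl
  on_goal 1 => refine ⟨1, 2, 1, 4, ?_⟩
  on_goal 2 => refine ⟨2, 3, 4, 3, ?_⟩
  on_goal 3 => refine ⟨1, -3, -2, 4, ?_⟩
  on_goal 4 => refine ⟨-1, 4, 4, -3, ?_⟩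
  on_goal 5 => refine ⟨2, 4, 4, 2, ?_⟩
  on_goal 6 => refine ⟨2, -3, -2, 1, ?_⟩
  on_goal 7 => refine ⟨1, 3, 1, 3, ?_⟩
  all_goals
    refine ⟨isRoot_four (by norm_num), isRoot_four (by norm_num), by simp only [paired_comm],
      oddSpace_four_ext (spin_mem_oddSpace _)
        (isRoot_four (by norm_num)).sub_unitVec_mem_oddSpace ?_ ?_ ?_ ?_⟩ <;>
    norm_num [spin_apply_one, spin_apply_two, spin_apply_three, spin_apply_four, unitVec_apply]

theorem exists_mem_exoticPairs_of_mem_refl {t : Equiv.Perm ℤ} (ht : t ∈ refl 4) :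
    ∃ p ∈ exoticPairs, t = p.1 ∨ t = p.2 := by
  obtain ⟨i, j, hi, hij, hj, rfl⟩ := ht
  have hi4 : i < 4 := lt_of_lt_of_le hij hj
  rcases eq_or_ne j (-4) with rfl | hj4
  · rw [← (isRoot_of_pos_of_lt hi hi4 le_rfl).paired_neg_left]
    interval_cases i <;> simp [exoticPairs]
  · obtain ⟨hjlower, hjupper⟩ := abs_le.mp hj
    push_cast at hjlower hjupper
    interval_cases i <;> interval_cases j <;> simp_all [exoticPairs]

theorem exists_spinConj (hw : w ∈ W 4) : ∃ w', SpinConj w w' := by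
  induction hw using Subgroup.closure_induction with
  | mem t ht =>
    obtain ⟨p, hp, ht'⟩ := exists_mem_exoticPairs_of_mem_refl ht
    obtain ⟨a, b, c, d, hab, hcd, rfl, hspin⟩ := exists_isRoot_of_mem_exoticPairs hp
    rcases ht' with rfl | rfl
    · exact ⟨_, hab.spinConj hcd hspin⟩
    · exact ⟨_, (hab.spinConj hcd hspin).symm⟩
  | one => exact ⟨1, .one⟩
  | mul v w _ _ ihv ihw =>
    obtain ⟨v', hv⟩ := ihv
    obtain ⟨w', hw⟩ := ihw
    exact ⟨_, hv.mul hw⟩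
  | inv w _ ih =>
    obtain ⟨w', hw⟩ := ih
    exact ⟨_, hw.inv⟩

theorem spinConj_cox : SpinConj (cox 4) (cox 4)⁻¹ := by
  have hmem : cox 4 ∈ W 4 := cox_mem (by norm_num)
  have hsigned := isSigned_of_mem hmem
  have hcox₁ : cox 4 1 = 2 := cox_apply_of_lt (by norm_num) (by norm_num) (by norm_num)
  have hcox₂ : cox 4 2 = 3 := cox_apply_of_lt (by norm_num) (by norm_num) (by norm_num)
  have hcox₃ : cox 4 3 = -1 := cox_apply_pred (by norm_num)
  have hcox₄ : cox 4 4 = -4 := cox_apply_self (by norm_num)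
  have hinv₁ : (cox 4)⁻¹ 1 = -3 :=
    Equiv.Perm.inv_eq_iff_eq.mpr (by rw [hsigned.1, hcox₃, neg_neg])
  have hinv₂ : (cox 4)⁻¹ 2 = 1 := Equiv.Perm.inv_eq_iff_eq.mpr hcox₁.symm
  have hinv₃ : (cox 4)⁻¹ 3 = 2 := Equiv.Perm.inv_eq_iff_eq.mpr hcox₂.symm
  have hinv₄ : (cox 4)⁻¹ 4 = -4 :=
    Equiv.Perm.inv_eq_iff_eq.mpr (by rw [hsigned.1, hcox₄, neg_neg])
  refine ⟨hmem, inv_mem hmem, fun x hx => congrFun (oddSpace_four_ext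
    (comp_mem_oddSpace hsigned.inv (spin_mem_oddSpace x)) (spin_mem_oddSpace _) ?_ ?_ ?_ ?_)⟩ <;>
  · simp only [hinv₁, hinv₂, hinv₃, hinv₄, (spin_mem_oddSpace x).1, spin_apply_one, spin_apply_two,
      spin_apply_three, spin_apply_four, hcox₁, hcox₂, hcox₃, hcox₄, hx.1]
    ring

/-- The conjugate of an element of `W(D₄)` by `spin`. -/
def spinConj (hw : w ∈ W 4) : Equiv.Perm ℤ := (exists_spinConj hw).choose

theorem spinConj_spec (hw : w ∈ W 4) : SpinConj w (spinConj hw) := (exists_spinConj hw).choose_spec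

/-- The map `w ↦ g w⁻¹ g⁻¹` of `NC(D₄)`, where `g` is `spin`. The inverse makes up for `g c g⁻¹`
being `c⁻¹`. -/
def exoticMap (w : NC 4) : NC 4 :=
  ⟨(spinConj w.2.1)⁻¹, inv_mem (spinConj_spec w.2.1).right_mem, by
    have h := absLE_inv (spinConj_spec w.2.1).right_mem spinConj_cox.right_mem
      ((spinConj_spec w.2.1).absLE spinConj_cox w.2.2)
    rwa [inv_inv] at h⟩

variable {s t : NC 4}

theorem SpinConj.exoticMap_eq (h : SpinConj s.1 t.1⁻¹) : exoticMap s = t :=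
  Subtype.ext (inv_eq_iff_eq_inv.mpr ((spinConj_spec s.2.1).unique h))

theorem exoticMap_exoticMap (s : NC 4) : exoticMap (exoticMap s) = s :=
  (spinConj_spec s.2.1).inv.symm.exoticMap_eq

theorem exoticMap_monotone : Monotone exoticMap := fun s t h =>
  absLE_inv (spinConj_spec s.2.1).right_mem (spinConj_spec t.2.1).right_mem
    ((spinConj_spec s.2.1).absLE (spinConj_spec t.2.1) h)

/-- The automorphism `ζ` of `NC(D₄)`. -/
def exotic : NC 4 ≃o NC 4 :=
  Equiv.toOrderIso ⟨exoticMap, exoticMap, exoticMap_exoticMap, exoticMap_exoticMap⟩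
    exoticMap_monotone exoticMap_monotone

theorem exotic_exchanges {p : Equiv.Perm ℤ × Equiv.Perm ℤ} (hp : p ∈ exoticPairs) :
    ∃ s t : NC 4, s.1 = p.1 ∧ t.1 = p.2 ∧ exotic s = t ∧ exotic t = s := by
  obtain ⟨a, b, c, d, hab, hcd, rfl, hspin⟩ := exists_isRoot_of_mem_exoticPairs hp
  have hconj := hab.spinConj hcd hspin
  refine ⟨⟨_, hab.mem_W, hab.absLE_cox (by norm_num)⟩, ⟨_, hcd.mem_W, hcd.absLE_cox (by norm_num)⟩,
    rfl, rfl, SpinConj.exoticMap_eq ?_, SpinConj.exoticMap_eq ?_⟩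
  · rwa [hcd.inv_paired]
  · rw [hab.inv_paired]
    exact hconj.symm

theorem exists_isChord_eq_exotic_of_isSpoke :
    ∃ s t : NC 4, IsChord s 0 1 ∧ IsSpoke t 0 ∧ exotic t = s := by
  obtain ⟨s, t, hs, ht, -, hts⟩ :=
    exotic_exchanges (p := (paired 1 2, paired 1 4)) (by simp [exoticPairs])
  have hpos₀ : pos 4 0 = 1 := pos_eq (by norm_num) (by norm_num) (by norm_num)
  have hpos₁ : pos 4 1 = 2 := pos_eq (by norm_num) (by norm_num) (by norm_num)
  refine ⟨s, t, ⟨by norm_num, by norm_num, ?_⟩, ?_, hts⟩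
  · rw [hs, hpos₀, hpos₁]
  · rw [IsSpoke, ht, hpos₀, Nat.cast_ofNat]

theorem exotic_notMem_dStar {l r : Equiv.Perm ℤ} (h : IsBipartition 4 l r) (hn : 3 ≤ 4) :
    exotic ∉ DStar (le_of_lt hn) h := fun hmem => by
  obtain ⟨s, t, hs, ht, hts⟩ := exists_isChord_eq_exotic_of_isSpoke
  obtain ⟨j, hj⟩ := ht.exists_isSpoke_of_mem_dStar hn h hmem
  exact hs.ne_of_isSpoke hj (le_of_lt hn) hts.symm

theorem orderOf_exotic : orderOf exotic = 2 := by
  refine orderOf_eq_prime ?_ fun hone => ?_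
  · rw [sq]
    exact RelIso.ext exoticMap_exoticMap
  · obtain ⟨s, t, hs, ht, hts⟩ := exists_isChord_eq_exotic_of_isSpoke
    rw [hone, RelIso.one_apply] at hts
    exact hs.ne_of_isSpoke ht (by norm_num) hts.symm

end Exotic

end NCD

end

theorem mainTheorem3 (n : ℕ) (hn : 3 ≤ n) :
    (∃ l r : Equiv.Perm ℤ, NCD.IsBipartition n l r) ∧
    ∀ (l r : Equiv.Perm ℤ) (h : NCD.IsBipartition n l r),
      (Nonempty (NCD.DStar (le_of_lt hn) h ≃* DihedralGroup (2 * (n - 1))) ∧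
        Nat.card (NCD.DStar (le_of_lt hn) h) = 4 * (n - 1)) ∧
      (n ≠ 4 → NCD.DStar (le_of_lt hn) h = ⊤) ∧
      (n = 4 → NCD.DStar (le_of_lt hn) h < ⊤ ∧
        ∃ ζ : NCD.NC n ≃o NCD.NC n, orderOf ζ = 2 ∧ ζ ∉ NCD.DStar (le_of_lt hn) h ∧
          ∀ p ∈ NCD.exoticPairs, ∃ x y : NCD.NC n,
            x.1 = p.1 ∧ y.1 = p.2 ∧ ζ x = y ∧ ζ y = x) := by
  refine ⟨NCD.exists_isBipartition (le_of_lt hn),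
    fun l r h => ⟨?_, fun hn4 => NCD.dStar_eq_top hn hn4 h, ?_⟩⟩
  · obtain ⟨e⟩ := NCD.nonempty_dStar_mulEquiv hn h
    refine ⟨⟨e⟩, ?_⟩
    rw [Nat.card_congr e.toEquiv, DihedralGroup.nat_card]
    ring
  · rintro rfl
    exact ⟨lt_top_iff_ne_top.mpr fun htop =>
        NCD.exotic_notMem_dStar h hn (htop ▸ Subgroup.mem_top _),
      NCD.exotic, NCD.orderOf_exotic, NCD.exotic_notMem_dStar h hn,
      fun _ hp => NCD.exotic_exchanges hp⟩
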